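/- Let $(M_\ell,\omega_\ell)$, $\ell=0,1,2$, be symplectic manifolds without boundary (not necessarily compact), with compatible almost complex structures $J_\ell$ of class $\mathcal C^k$ for some $1\le k\le\infty$ (so $\omega_\ell(\cdot,J_\ell\cdot)$ is a Riemannian metric). Let $L_{01}\subset M_0^-\times M_1$ and $L_{12}\subset M_1^-\times M_2$ be compact Lagrangian submanifolds, where $M_\ell^-=(M_\ell,-\omega_\ell)$. Put $$L_{01}\times_{M_1}L_{12}:=\{(x_0,x_1,x_1',x_2) : (x_0,x_1)\in L_{01},\ (x_1',x_2)\in L_{12},\ x_1=x_1'\},$$ let $\pi_{02}(x_0,x_1,x_1',x_2):=(x_0,x_2)$, and $L_{01}\circ L_{12}:=\pi_{02}(L_{01}\times_{M_1}L_{12})$. No transversality or immersedness of the composition is assumed. A *figure eight bubble* is a triple of smooth maps $w_0:\mathbb R\times(-\infty,-\frac12]\to M_0$, $w_1:\mathbb R\times[-\frac12,\frac12]\to M_1$, $w_2:\mathbb R\times[\frac12,\infty)\to M_2$ with $\partial_sw_\ell+J_\ell(w_\ell)\partial_tw_\ell=0$, with $(w_0(s,-\frac12),w_1(s,-\frac12))\in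 L_{01}$ and $(w_1(s,\frac12),w_2(s,\frac12))\in L_{12}$ for all $s\in\mathbb R$, and with finite energy $\int w_0^*\omega_0+\int w_1^*\omega_1+\int w_2^*\omega_2<\infty$. A *squashed eight bubble* is a triple of smooth maps $w_0:\mathbb R\times(-\infty,0]\to M_0$, $\overline w_1:\mathbb R\to M_1$, $w_2:\mathbb R\times[0,\infty)\to M_2$ with $\partial_sw_\ell+J_\ell(w_\ell)\partial_tw_\ell=0$ for $\ell=0,2$, with $(w_0(s,0),\overline w_1(s),\overline w_1(s),w_2(s,0))\in L_{01}\times_{M_1}L_{12}$ for all $s\in\mathbb R$, and with finite energy $\int w_0^*\omega_0+\int w_2^*\omega_2<\infty$; for such a bubble put $w_1(s,t):=\overline w_1(s)$ on $\mathbb R\times[-\frac12,\frac12]$. **Proposition (weak removal of singularity).** Let $(w_0,w_1,w_2)$ be a figure eight bubble or a squashed eight bubble. Then for every $\epsilon>0$ there are smooth maps $u_0:D^2\to M_0$, $\widehat u_1:[0,2\pi]\times[-\frac12,\frac12]\to M_1$, $u_2:D^2\to M_2$ ($D^2\subset\mathbb C$ the closed unit disk) with $$(u_0(e^{-i\theta}),\widehat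 u_1(\theta,-\tfrac12))\in L_{01},\qquad(\widehat u_1(\theta,\tfrac12),u_2(e^{i\theta}))\in L_{12}\qquad\text{for all }\theta\in[0,2\pi],$$ $$\Bigl|\Bigl(\int u_0^*\omega_0+\int\widehat u_1^*\omega_1+\int u_2^*\omega_2\Bigr)-\Bigl(\int w_0^*\omega_0+\int w_1^*\omega_1+\int w_2^*\omega_2\Bigr)\Bigr|\le\epsilon,$$ such that $\widehat u_1$ is constant on each of the segments $\{0\}\times[-\frac12,\frac12]$ and $\{2\pi\}\times[-\frac12,\frac12]$, with values $p_1^+$ and $p_1^-$ respectively, and, with $p_0:=u_0(1)$ and $p_2:=u_2(1)$, both $(p_0,p_1^+,p_1^+,p_2)$ and $(p_0,p_1^-,p_1^-,p_2)$ lie in $L_{01}\times_{M_1}L_{12}$; they are thus two (not necessarily distinct) lifts of the same point $(p_0,p_2)\in L_{01}\circ L_{12}$. If moreover $\pi_{02}:L_{01}\times_{M_1}L_{12}\to L_{01}\circ L_{12}$ is injective, then these maps can be chosen such that, in addition, $\widehat u_1$ induces a smooth map $u_1:S^1\times[-\frac12,\frac12]\to M_1$, i.e. $\widehat u_1(\theta,t)=u_1(e^{i\theta},t)$.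 -/

import Mathlib

open scoped Manifold ContDiff Topology
open MeasureTheory

noncomputable section

namespace QuiltBubble

/-! ### Symplectic manifolds

A manifold without boundary is a charted space over a finite-dimensional real normed space `E`
(with model `𝓘(ℝ, E)`). -/

section Symplectic

variable (E : Type*) [NormedAddCommGroup E] [NormedSpace ℝ E]
variable (M : Type*) [TopologicalSpace M] [ChartedSpace E M]

variable {E M} in
/-- The coordinate expression, in the preferred chart `φ` at `x₀`, of a family of bilinear forms
on the tangent spaces: its value at `y` is the pullback of `form (φ⁻¹ y)` under `d(φ⁻¹)(y)`. -/
def coordForm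
    (form : ∀ x : M, TangentSpace 𝓘(ℝ, E) x →L[ℝ] TangentSpace 𝓘(ℝ, E) x →L[ℝ] ℝ)
    (x₀ : M) (y : E) : E →L[ℝ] E →L[ℝ] ℝ :=
  ContinuousLinearMap.bilinearComp (E := E) (F := E) (E' := E) (F' := E)
    (form ((extChartAt 𝓘(ℝ, E) x₀).symm y))
    (mfderiv 𝓘(ℝ, E) 𝓘(ℝ, E) (extChartAt 𝓘(ℝ, E) x₀).symm y)
    (mfderiv 𝓘(ℝ, E) 𝓘(ℝ, E) (extChartAt 𝓘(ℝ, E) x₀).symm y)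

variable {E M} in
/-- The coordinate expression, in the preferred chart `φ` at `x₀`, of a family of endomorphisms
of the tangent spaces: its value at `y` is `dφ ∘ J (φ⁻¹ y) ∘ d(φ⁻¹)(y)`. -/
def coordEndo (J : ∀ x : M, TangentSpace 𝓘(ℝ, E) x →L[ℝ] TangentSpace 𝓘(ℝ, E) x)
    (x₀ : M) (y : E) : E →L[ℝ] E :=
  (mfderiv 𝓘(ℝ, E) 𝓘(ℝ, E) (extChartAt 𝓘(ℝ, E) x₀) ((extChartAt 𝓘(ℝ, E) x₀).symm y)).comp
    ((J ((extChartAt 𝓘(ℝ, E) x₀).symm y)).comp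
      (mfderiv 𝓘(ℝ, E) 𝓘(ℝ, E) (extChartAt 𝓘(ℝ, E) x₀).symm y))

/-- A symplectic form on `M`: a smooth, closed, nondegenerate, alternating 2-form.  Smoothness and
closedness are expressed in the charts; `closed` is the coordinate formula
`dσ (a, b, c) = a ⬝ σ (b, c) + b ⬝ σ (c, a) + c ⬝ σ (a, b) = 0` for constant vector fields. -/
structure SymplecticForm where
  form : ∀ x : M, TangentSpace 𝓘(ℝ, E) x →L[ℝ] TangentSpace 𝓘(ℝ, E) x →L[ℝ] ℝ
  alternating : ∀ (x : M) (v : TangentSpace 𝓘(ℝ, E) x), form x v v = 0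
  nondegenerate : ∀ (x : M) (v : TangentSpace 𝓘(ℝ, E) x), (∀ u, form x v u = 0) → v = 0
  smooth : ∀ x₀ : M, ContDiffOn ℝ ∞ (coordForm form x₀) (extChartAt 𝓘(ℝ, E) x₀).target
  closed : ∀ x₀ : M, ∀ y ∈ (extChartAt 𝓘(ℝ, E) x₀).target, ∀ a b c : E,
    fderiv ℝ (coordForm form x₀) y a b c + fderiv ℝ (coordForm form x₀) y b c a
      + fderiv ℝ (coordForm form x₀) y c a b = 0

variable {E M} in
/-- An almost complex structure of class `C^k` on `M` that is compatible with `σ`, that is,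
`σ (·, J ·)` is a Riemannian metric. -/
structure CompatibleJ (σ : SymplecticForm E M) (k : ℕ∞) where
  J : ∀ x : M, TangentSpace 𝓘(ℝ, E) x →L[ℝ] TangentSpace 𝓘(ℝ, E) x
  sq : ∀ (x : M) (v : TangentSpace 𝓘(ℝ, E) x), J x (J x v) = -v
  regular : ∀ x₀ : M, ContDiffOn ℝ k (coordEndo J x₀) (extChartAt 𝓘(ℝ, E) x₀).target
  metric_symm : ∀ (x : M) (u v : TangentSpace 𝓘(ℝ, E) x),
    σ.form x u (J x v) = σ.form x v (J x u)
  metric_pos : ∀ (x : M) (v : TangentSpace 𝓘(ℝ, E) x), v ≠ 0 → 0 < σ.form x v (J x v)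

end Symplectic

/-! ### Lagrangian submanifolds and correspondences -/

section Lagrangian

variable {E : Type*} [NormedAddCommGroup E] [NormedSpace ℝ E] {H : Type*} [TopologicalSpace H]
variable (I : ModelWithCorners ℝ E H) {X : Type*} [TopologicalSpace X] [ChartedSpace H X]

/-- `φ` is a smooth chart of `X` that carries `L` (inside the domain of `φ`) onto the intersection
of its image with the linear subspace `F`. -/
def IsSliceChart (L : Set X) (φ : OpenPartialHomeomorph X H) (F : Submodule ℝ E) : Prop :=
  φ ∈ IsManifold.maximalAtlas I ∞ X ∧ ∀ q ∈ φ.source, (q ∈ L ↔ φ.extend I q ∈ F)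

/-- `L` is a Lagrangian (embedded) submanifold, without boundary, of `X` with respect to the 2-form
`Ω`: near each of its points `p` it is cut out by a slice chart, and its tangent space
`T_p L = (dφ_p)⁻¹ F` is equal to its own `Ω`-orthogonal complement. -/
def IsLagrangian (Ω : ∀ p : X, TangentSpace I p → TangentSpace I p → ℝ) (L : Set X) : Prop :=
  ∀ p ∈ L, ∃ (φ : OpenPartialHomeomorph X H) (F : Submodule ℝ E),
    p ∈ φ.source ∧ IsSliceChart I L φ F ∧
    ∀ u : TangentSpace I p,
      (mfderiv I 𝓘(ℝ, E) (φ.extend I) p u ∈ F ↔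
        ∀ v : TangentSpace I p, mfderiv I 𝓘(ℝ, E) (φ.extend I) p v ∈ F → Ω p u v = 0)

end Lagrangian

section Correspondence

variable {E : Type*} [NormedAddCommGroup E] [NormedSpace ℝ E]
variable {M : Type*} [TopologicalSpace M] [ChartedSpace E M]
variable {E' : Type*} [NormedAddCommGroup E'] [NormedSpace ℝ E']
variable {M' : Type*} [TopologicalSpace M'] [ChartedSpace E' M']

/-- The symplectic form `(-σ) ⊕ σ'` of `M⁻ × M'`. -/
def twistedForm (σ : SymplecticForm E M) (σ' : SymplecticForm E' M') (p : M × M')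
    (u v : TangentSpace (𝓘(ℝ, E).prod 𝓘(ℝ, E')) p) : ℝ :=
  - σ.form p.1 (u : E × E').1 (v : E × E').1 + σ'.form p.2 (u : E × E').2 (v : E × E').2

/-- A compact Lagrangian correspondence `L ⊂ M⁻ × M'`. -/
structure IsCompactLagrangianCorrespondence (σ : SymplecticForm E M) (σ' : SymplecticForm E' M')
    (L : Set (M × M')) : Prop where
  isCompact : IsCompact L
  isLagrangian : IsLagrangian (𝓘(ℝ, E).prod 𝓘(ℝ, E')) (twistedForm σ σ') L

end Correspondence

section Composition

variable {M₀ M₁ M₂ : Type*}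

/-- The fiber product `L₀₁ ×_{M₁} L₁₂ ⊂ M₀ × M₁ × M₁ × M₂`, the intersection of `L₀₁ × L₁₂` with
`M₀ × Δ × M₂`. -/
def fiberProduct (L₀₁ : Set (M₀ × M₁)) (L₁₂ : Set (M₁ × M₂)) : Set (M₀ × M₁ × M₁ × M₂) :=
  {x | (x.1, x.2.1) ∈ L₀₁ ∧ (x.2.2.1, x.2.2.2) ∈ L₁₂ ∧ x.2.1 = x.2.2.1}

/-- The projection `π₀₂ : M₀ × M₁ × M₁ × M₂ → M₀ × M₂`. -/
def proj02 (x : M₀ × M₁ × M₁ × M₂) : M₀ × M₂ := (x.1, x.2.2.2)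

/-- The geometric composition `L₀₁ ∘ L₁₂`, the image of the fiber product under `π₀₂`. -/
def geomComposition (L₀₁ : Set (M₀ × M₁)) (L₁₂ : Set (M₁ × M₂)) : Set (M₀ × M₂) :=
  proj02 '' fiberProduct L₀₁ L₁₂

end Composition

/-! ### Maps from planar domains

A smooth map on a closed domain `D ⊂ ℝ²` is represented by a map on `ℝ × ℝ` of which only the
restriction to `D` matters; derivatives are taken within `D`. -/

/-- The lower half plane `ℝ × (-∞, a]`. -/
def lowerHalf (a : ℝ) : Set (ℝ × ℝ) := {z | z.2 ≤ a}

/-- The upper half plane `ℝ × [a, ∞)`. -/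
def upperHalf (a : ℝ) : Set (ℝ × ℝ) := {z | a ≤ z.2}

/-- The strip `ℝ × [-1/2, 1/2]`. -/
def strip : Set (ℝ × ℝ) := {z | -(1 / 2) ≤ z.2 ∧ z.2 ≤ 1 / 2}

/-- The closed unit disk `D²`. -/
def disk : Set (ℝ × ℝ) := {z | z.1 ^ 2 + z.2 ^ 2 ≤ 1}

/-- The rectangle `[0, 2π] × [-1/2, 1/2]`. -/
def rectangle : Set (ℝ × ℝ) := Set.Icc 0 (2 * Real.pi) ×ˢ Set.Icc (-(1 / 2)) (1 / 2)

section Maps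

variable {E : Type*} [NormedAddCommGroup E] [NormedSpace ℝ E]
variable {M : Type*} [TopologicalSpace M] [ChartedSpace E M]

/-- `w` is smooth on `D`. -/
def SmoothOn (D : Set (ℝ × ℝ)) (w : ℝ × ℝ → M) : Prop :=
  ContMDiffOn 𝓘(ℝ, ℝ × ℝ) 𝓘(ℝ, E) ∞ w D

/-- The partial derivative `∂_s w` on `D`. -/
def dS (D : Set (ℝ × ℝ)) (w : ℝ × ℝ → M) (z : ℝ × ℝ) : TangentSpace 𝓘(ℝ, E) (w z) :=
  mfderivWithin 𝓘(ℝ, ℝ × ℝ) 𝓘(ℝ, E) w D z ((1, 0) : ℝ × ℝ)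

/-- The partial derivative `∂_t w` on `D`. -/
def dT (D : Set (ℝ × ℝ)) (w : ℝ × ℝ → M) (z : ℝ × ℝ) : TangentSpace 𝓘(ℝ, E) (w z) :=
  mfderivWithin 𝓘(ℝ, ℝ × ℝ) 𝓘(ℝ, E) w D z ((0, 1) : ℝ × ℝ)

/-- The density `σ (∂_s w, ∂_t w)` of the pullback form `w^* σ = σ (∂_s w, ∂_t w) ds ∧ dt`. -/
def pullbackDensity (σ : SymplecticForm E M) (D : Set (ℝ × ℝ)) (w : ℝ × ℝ → M) (z : ℝ × ℝ) : ℝ :=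
  σ.form (w z) (dS D w z) (dT D w z)

/-- The symplectic area `∫_D w^* σ`. -/
def area (σ : SymplecticForm E M) (D : Set (ℝ × ℝ)) (w : ℝ × ℝ → M) : ℝ :=
  ∫ z in D, pullbackDensity σ D w z

/-- `w` is smooth on `D` and solves `∂_s w + J(w) ∂_t w = 0` there. -/
structure IsHolomorphicOn {σ : SymplecticForm E M} {k : ℕ∞} (J : CompatibleJ σ k)
    (D : Set (ℝ × ℝ)) (w : ℝ × ℝ → M) : Prop where
  smooth : SmoothOn (E := E) D w
  cauchyRiemann : ∀ z ∈ D, dS D w z + J.J (w z) (dT D w z) = 0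

/-- The integral `∫_D w^* σ` converges.  For pseudoholomorphic `w` the integrand is nonnegative,
so this says that the integral is finite. -/
def HasFiniteArea (σ : SymplecticForm E M) (D : Set (ℝ × ℝ)) (w : ℝ × ℝ → M) : Prop :=
  IntegrableOn (pullbackDensity σ D w) D

end Maps

/-! ### Figure eight and squashed eight bubbles -/

section Bubbles

variable {E₀ : Type*} [NormedAddCommGroup E₀] [NormedSpace ℝ E₀]
variable {M₀ : Type*} [TopologicalSpace M₀] [ChartedSpace E₀ M₀]
variable {E₁ : Type*} [NormedAddCommGroup E₁] [NormedSpace ℝ E₁]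
variable {M₁ : Type*} [TopologicalSpace M₁] [ChartedSpace E₁ M₁]
variable {E₂ : Type*} [NormedAddCommGroup E₂] [NormedSpace ℝ E₂]
variable {M₂ : Type*} [TopologicalSpace M₂] [ChartedSpace E₂ M₂]
variable {σ₀ : SymplecticForm E₀ M₀} {σ₁ : SymplecticForm E₁ M₁} {σ₂ : SymplecticForm E₂ M₂}
variable {k : ℕ∞}

/-- `(w₀, w₁, w₂)` is a figure eight bubble between `L₀₁` and `L₁₂`. -/
structure IsFigureEight (J₀ : CompatibleJ σ₀ k) (J₁ : CompatibleJ σ₁ k) (J₂ : CompatibleJ σ₂ k)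
    (L₀₁ : Set (M₀ × M₁)) (L₁₂ : Set (M₁ × M₂))
    (w₀ : ℝ × ℝ → M₀) (w₁ : ℝ × ℝ → M₁) (w₂ : ℝ × ℝ → M₂) : Prop where
  holo₀ : IsHolomorphicOn J₀ (lowerHalf (-(1 / 2))) w₀
  holo₁ : IsHolomorphicOn J₁ strip w₁
  holo₂ : IsHolomorphicOn J₂ (upperHalf (1 / 2)) w₂
  seam₀₁ : ∀ s : ℝ, (w₀ (s, -(1 / 2)), w₁ (s, -(1 / 2))) ∈ L₀₁
  seam₁₂ : ∀ s : ℝ, (w₁ (s, 1 / 2), w₂ (s, 1 / 2)) ∈ L₁₂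
  finite₀ : HasFiniteArea σ₀ (lowerHalf (-(1 / 2))) w₀
  finite₁ : HasFiniteArea σ₁ strip w₁
  finite₂ : HasFiniteArea σ₂ (upperHalf (1 / 2)) w₂

/-- `(w₀, w₁, w₂)`, with `w₁` defined on the line, is a squashed eight bubble with seam in
`L₀₁ ×_{M₁} L₁₂`. -/
structure IsSquashedEight (J₀ : CompatibleJ σ₀ k) (J₂ : CompatibleJ σ₂ k)
    (L₀₁ : Set (M₀ × M₁)) (L₁₂ : Set (M₁ × M₂))
    (w₀ : ℝ × ℝ → M₀) (w₁ : ℝ → M₁) (w₂ : ℝ × ℝ → M₂) : Prop where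
  holo₀ : IsHolomorphicOn J₀ (lowerHalf 0) w₀
  smooth₁ : ContMDiff 𝓘(ℝ, ℝ) 𝓘(ℝ, E₁) ∞ w₁
  holo₂ : IsHolomorphicOn J₂ (upperHalf 0) w₂
  seam : ∀ s : ℝ, (w₀ (s, 0), w₁ s, w₁ s, w₂ (s, 0)) ∈ fiberProduct L₀₁ L₁₂
  finite₀ : HasFiniteArea σ₀ (lowerHalf 0) w₀
  finite₂ : HasFiniteArea σ₂ (upperHalf 0) w₂

end Bubbles

end QuiltBubble

end

open QuiltBubble

/-! The proof is a cut-and-cap argument in which finite energy does the work of elliptic estimates.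
A bubble of either kind is a quilt of two half planes and a strip. It has four ends: one for each
half plane, in polar coordinates, and one for each half of the strip. All are parametrized by `(r,
t)` in `(0, ∞) × [0, 1]`, where the Cauchy-Riemann equation, or the vanishing of the vertical speed
on a squashed strip, gives `|∂_t w|² ≤ 4 r · density` for `r ≥ 1` (`IsEnd`).

The total density is integrable and `1/r` is not, so there are radii `r_n → ∞` at which `r_n` times
the integral of the density over the slice tends to `0`, for all four ends at once (`exists_radii`).
The slices at these radii therefore have energy tending to `0`. Their end points lie on the compact
seams and converge along an ultrafilter. A slice of small energy that starts near a point stays near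
it (`exists_short_arc`); this replaces compactness of the manifolds. Hence each slice shrinks to a
single point. Each half plane is adjacent to both ends of the strip, so the limits are `p₀`, `p₂`
and one point for each strip end, `p₁` and `p₁'`, both of which lift `(p₀, p₂)`. Nothing forces `p₁
= p₁'` unless `π₀₂` is injective.

Each end is cut at one such radius and closed by a cap. The corners of the slices are joined to the
limit points inside the Lagrangians, by segments in slice charts (`exists_cornerPaths`), and the
slice is contracted in a chart, relative to these paths (`exists_cap`). The cap has small area
because it moves slowly in the contracting direction and the slice is short. The area changes only
by the discarded tail and the cap (`exists_isCapped`, `exists_capped_quilt`).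

The capped maps are constant near infinity, so they extend smoothly over the compactified domains:
half planes become disks by the Cayley transform, and the strip becomes a rectangle by `s = -cot
(θ/2)`, which is the boundary value of the same transform, so the seams match. When `p₁ = p₁'` the
rectangle closes up to an annulus (`fromStripCircle`). -/

noncomputable section

namespace QuiltBubble

/-! ### Pullback densities and change of variables -/

section Basics

variable {E : Type*} [NormedAddCommGroup E] [NormedSpace ℝ E]
variable {M : Type*} [TopologicalSpace M] [ChartedSpace E M]

/-- The form of `σ`, on the model space. -/
def SymplecticForm.bilin (σ : SymplecticForm E M) (x : M) : E →L[ℝ] E →L[ℝ] ℝ := σ.form x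

/-- The derivative of a map from a normed space to `M`, with values in the model space. -/
def der {F : Type*} [NormedAddCommGroup F] [NormedSpace ℝ F] (w : F → M) (z : F) : F →L[ℝ] E :=
  mfderiv 𝓘(ℝ, F) 𝓘(ℝ, E) w z

/-- The density of `w^* σ` at interior points. -/
def dens (σ : SymplecticForm E M) (w : ℝ × ℝ → M) (z : ℝ × ℝ) : ℝ :=
  σ.bilin (w z) (der (E := E) w z (1, 0)) (der (E := E) w z (0, 1))

lemma SymplecticForm.bilin_self (σ : SymplecticForm E M) (x : M) (v : E) : σ.bilin x v v = 0 :=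
  σ.alternating x v

lemma SymplecticForm.bilin_swap (σ : SymplecticForm E M) (x : M) (u v : E) :
    σ.bilin x u v = - σ.bilin x v u := by
  have h := σ.bilin_self x (u + v)
  simp only [map_add, add_apply, σ.bilin_self] at h
  linarith

lemma der_congr {F : Type*} [NormedAddCommGroup F] [NormedSpace ℝ F] {v w : F → M} {z : F}
    (h : v =ᶠ[𝓝 z] w) : der (E := E) v z = der w z := h.mfderiv_eq

lemma der_comp {F G : Type*} [NormedAddCommGroup F] [NormedSpace ℝ F] [NormedAddCommGroup G]
    [NormedSpace ℝ G] {w : F → M} {Φ : G → F} {Φ' : G →L[ℝ] F} {z : G}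
    (hw : MDifferentiableAt 𝓘(ℝ, F) 𝓘(ℝ, E) w (Φ z)) (hΦ : HasFDerivAt Φ Φ' z) :
    der (E := E) (w ∘ Φ) z = (der w (Φ z)).comp Φ' := by
  have h1 := mfderiv_comp (I := 𝓘(ℝ, G)) (I' := 𝓘(ℝ, F)) (I'' := 𝓘(ℝ, E)) z hw
    hΦ.differentiableAt.mdifferentiableAt
  rw [mfderiv_eq_fderiv, hΦ.fderiv] at h1
  exact h1

lemma der_eq_of_mem_nhds {F : Type*} [NormedAddCommGroup F] [NormedSpace ℝ F] {w : F → M}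
    {D : Set F} {z : F} (h : D ∈ 𝓝 z) :
    der (E := E) w z = mfderivWithin 𝓘(ℝ, F) 𝓘(ℝ, E) w D z :=
  (mfderivWithin_of_mem_nhds h).symm

lemma dens_congr (σ : SymplecticForm E M) {v w : ℝ × ℝ → M} {z : ℝ × ℝ}
    (h : v =ᶠ[𝓝 z] w) : dens σ v z = dens σ w z := by
  unfold dens
  rw [der_congr h, h.eq_of_nhds]

lemma dens_const (σ : SymplecticForm E M) {v : ℝ × ℝ → M} {p : M} {z : ℝ × ℝ}
    (h : v =ᶠ[𝓝 z] fun _ => p) : dens σ v z = 0 := by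
  have h1 : der (E := E) (fun _ : ℝ × ℝ => p) z = 0 := by
    unfold der; exact mfderiv_const
  rw [dens_congr σ h, dens, h1]
  simp

lemma det_eq_of_prod (A : ℝ × ℝ →L[ℝ] ℝ × ℝ) :
    A.det = (A (1, 0)).1 * (A (0, 1)).2 - (A (1, 0)).2 * (A (0, 1)).1 := by
  rw [ContinuousLinearMap.det, ← LinearMap.det_toMatrix (Module.Basis.finTwoProd ℝ),
    Matrix.det_fin_two]
  simp [LinearMap.toMatrix_apply]
  ring

/-- An alternating form on the plane is determined by its value on the standard basis, so a linear
substitution only contributes its determinant. -/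
lemma SymplecticForm.bilin_det (σ : SymplecticForm E M) (x : M) (D : ℝ × ℝ →L[ℝ] E)
    (A : ℝ × ℝ →L[ℝ] ℝ × ℝ) :
    σ.bilin x (D (A (1, 0))) (D (A (0, 1))) = A.det * σ.bilin x (D (1, 0)) (D (0, 1)) := by
  have key : ∀ p : ℝ × ℝ, D p = p.1 • D (1, 0) + p.2 • D (0, 1) := by
    intro p
    rw [← map_smul, ← map_smul, ← map_add]
    simp
  rw [key (A (1, 0)), key (A (0, 1)), det_eq_of_prod]
  simp only [map_add, map_smul, add_apply, smul_apply,
    σ.bilin_self, smul_eq_mul]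
  rw [σ.bilin_swap x (D (0, 1)) (D (1, 0))]
  ring

lemma dens_comp (σ : SymplecticForm E M) {w : ℝ × ℝ → M} {Φ : ℝ × ℝ → ℝ × ℝ}
    {Φ' : ℝ × ℝ →L[ℝ] ℝ × ℝ} {z : ℝ × ℝ}
    (hw : MDifferentiableAt 𝓘(ℝ, ℝ × ℝ) 𝓘(ℝ, E) w (Φ z)) (hΦ : HasFDerivAt Φ Φ' z) :
    dens σ (w ∘ Φ) z = Φ'.det * dens σ w (Φ z) := by
  unfold dens
  rw [der_comp hw hΦ]
  exact σ.bilin_det _ _ _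

/-- Every change of coordinates below rests on this. The nonnegative Jacobian identifies the signed
factor in the pullback of a 2-form with the absolute value in the change of variables formula.
Integrability is transported as well, because a divergent integral would silently be `0`. -/
lemma integral_dens_comp (σ : SymplecticForm E M) {w v : ℝ × ℝ → M} {Φ : ℝ × ℝ → ℝ × ℝ}
    {Φ' : ℝ × ℝ → ℝ × ℝ →L[ℝ] ℝ × ℝ} {U V : Set (ℝ × ℝ)} (hU : IsOpen U)
    (hΦ : ∀ z ∈ U, HasFDerivAt Φ (Φ' z) z) (hinj : Set.InjOn Φ U) (him : Φ '' U = V)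
    (hdet : ∀ z ∈ U, 0 ≤ (Φ' z).det)
    (hw : ∀ z ∈ V, MDifferentiableAt 𝓘(ℝ, ℝ × ℝ) 𝓘(ℝ, E) w z) (hv : ∀ z ∈ U, v z = w (Φ z)) :
    ∫ z in U, dens σ v z = ∫ z in V, dens σ w z ∧
      (IntegrableOn (dens σ v) U ↔ IntegrableOn (dens σ w) V) := by
  have hd : ∀ z ∈ U, dens σ v z = |(Φ' z).det| • dens σ w (Φ z) := by
    intro z hz
    have : v =ᶠ[𝓝 z] w ∘ Φ := by
      filter_upwards [hU.mem_nhds hz] with y hy using hv y hy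
    rw [dens_congr σ this, dens_comp σ (hw _ (him ▸ Set.mem_image_of_mem _ hz)) (hΦ z hz),
      abs_of_nonneg (hdet z hz), smul_eq_mul]
  have hΦ2 : ∀ z ∈ U, HasFDerivWithinAt Φ (Φ' z) U z := fun z hz => (hΦ z hz).hasFDerivWithinAt
  subst him
  constructor
  · rw [integral_image_eq_integral_abs_det_fderiv_smul volume hU.measurableSet hΦ2 hinj]
    exact setIntegral_congr_fun hU.measurableSet hd
  · rw [integrableOn_image_iff_integrableOn_abs_det_fderiv_smul volume hU.measurableSet hΦ2 hinj]
    exact integrableOn_congr_fun hd hU.measurableSet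

lemma pullbackDensity_eq_dens (σ : SymplecticForm E M) {w : ℝ × ℝ → M} {D : Set (ℝ × ℝ)}
    {z : ℝ × ℝ} (h : D ∈ 𝓝 z) : pullbackDensity σ D w z = dens σ w z := by
  unfold dens pullbackDensity
  rw [der_eq_of_mem_nhds h]
  rfl

/-- Areas over convex domains are computed in the interior. -/
lemma area_eq_of_convex (σ : SymplecticForm E M) {w : ℝ × ℝ → M} {D U : Set (ℝ × ℝ)}
    (hD : Convex ℝ D) (hU : interior D = U) :
    area σ D w = ∫ z in U, dens σ w z ∧ (HasFiniteArea σ D w ↔ IntegrableOn (dens σ w) U) := by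
  subst hU
  -- A convex set has null frontier, so derivatives within `D` at boundary points do not affect the
  -- area.
  have h1 : D =ᵐ[volume] interior D := (interior_ae_eq_of_null_frontier
    (hD.addHaar_frontier volume)).symm
  have h2 : ∀ z ∈ interior D, pullbackDensity σ D w z = dens σ w z := fun z hz =>
    pullbackDensity_eq_dens σ (mem_interior_iff_mem_nhds.1 hz)
  constructor
  · rw [area, setIntegral_congr_set h1]
    exact setIntegral_congr_fun isOpen_interior.measurableSet h2
  · rw [HasFiniteArea, integrableOn_congr_set_ae h1]
    exact integrableOn_congr_fun h2 isOpen_interior.measurableSet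

end Basics

/-! ### Forms, almost complex structures and metrics in charts -/

section Charts

variable {E : Type*} [NormedAddCommGroup E] [NormedSpace ℝ E]
variable {M : Type*} [TopologicalSpace M] [ChartedSpace E M]

lemma isOpen_target (p : M) : IsOpen (extChartAt 𝓘(ℝ, E) p).target :=
  isOpen_extChartAt_target p

lemma coordForm_apply (σ : SymplecticForm E M) (p : M) (y a b : E) :
    coordForm σ.form p y a b = σ.bilin ((extChartAt 𝓘(ℝ, E) p).symm y)
      (der (E := E) (extChartAt 𝓘(ℝ, E) p).symm y a)
      (der (E := E) (extChartAt 𝓘(ℝ, E) p).symm y b) := rfl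

/-- The almost complex structure, on the model space. -/
def CompatibleJ.op {σ : SymplecticForm E M} {k : ℕ∞} (J : CompatibleJ σ k) (x : M) : E →L[ℝ] E :=
  J.J x

lemma CompatibleJ.op_op {σ : SymplecticForm E M} {k : ℕ∞} (J : CompatibleJ σ k) (x : M) (v : E) :
    J.op x (J.op x v) = -v := J.sq x v

/-- The squared norm of a tangent vector in the metric `σ (·, J ·)`. -/
def CompatibleJ.normSq {σ : SymplecticForm E M} {k : ℕ∞} (J : CompatibleJ σ k) (x : M) (v : E) :
    ℝ := σ.bilin x v (J.op x v)

lemma CompatibleJ.normSq_nonneg {σ : SymplecticForm E M} {k : ℕ∞} (J : CompatibleJ σ k) (x : M)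
    (v : E) : 0 ≤ J.normSq x v := by
  by_cases h : v = 0
  · subst h
    rw [CompatibleJ.normSq, map_zero]
    exact le_rfl
  · exact (J.metric_pos x v h).le

variable [IsManifold 𝓘(ℝ, E) ∞ M]

lemma contMDiffAt_symm (p : M) {y : E} (hy : y ∈ (extChartAt 𝓘(ℝ, E) p).target) :
    ContMDiffAt 𝓘(ℝ, E) 𝓘(ℝ, E) ∞ (extChartAt 𝓘(ℝ, E) p).symm y :=
  (contMDiffOn_extChartAt_symm p).contMDiffAt ((isOpen_target p).mem_nhds hy)

/-- The derivative of a map written in a chart. -/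
lemma der_symm_comp {F : Type*} [NormedAddCommGroup F] [NormedSpace ℝ F] (p : M) {G : F → E}
    {G' : F →L[ℝ] E} {z : F} (hG : HasFDerivAt G G' z)
    (hz : G z ∈ (extChartAt 𝓘(ℝ, E) p).target) {v : F → M}
    (hv : v =ᶠ[𝓝 z] (extChartAt 𝓘(ℝ, E) p).symm ∘ G) :
    der (E := E) v z = (der (E := E) (extChartAt 𝓘(ℝ, E) p).symm (G z)).comp G' := by
  rw [der_congr hv]
  exact der_comp ((contMDiffAt_symm p hz).mdifferentiableAt (by simp)) hG

lemma dens_symm_comp (σ : SymplecticForm E M) (p : M) {G : ℝ × ℝ → E}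
    {G' : ℝ × ℝ →L[ℝ] E} {z : ℝ × ℝ} (hG : HasFDerivAt G G' z)
    (hz : G z ∈ (extChartAt 𝓘(ℝ, E) p).target) {v : ℝ × ℝ → M}
    (hv : v =ᶠ[𝓝 z] (extChartAt 𝓘(ℝ, E) p).symm ∘ G) :
    dens σ v z = coordForm σ.form p (G z) (G' (1, 0)) (G' (0, 1)) := by
  rw [dens, der_symm_comp p hG hz hv, hv.eq_of_nhds, coordForm_apply]
  rfl

lemma der_chart_comp_der_symm (p : M) {y : E} (hy : y ∈ (extChartAt 𝓘(ℝ, E) p).target) (a : E) :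
    (mfderiv 𝓘(ℝ, E) 𝓘(ℝ, E) (extChartAt 𝓘(ℝ, E) p) ((extChartAt 𝓘(ℝ, E) p).symm y) :)
      (der (E := E) (extChartAt 𝓘(ℝ, E) p).symm y a) = a := by
  have : IsManifold 𝓘(ℝ, E) 1 M := IsManifold.of_le (n := ∞) (by simp)
  have h := mfderiv_extChartAt_comp_mfderivWithin_extChartAt_symm (I := 𝓘(ℝ, E)) hy
  simp only [modelWithCornersSelf_coe, Set.range_id, mfderivWithin_univ] at h
  exact DFunLike.congr_fun h a

lemma der_symm_comp_der_chart (p : M) {y : E} (hy : y ∈ (extChartAt 𝓘(ℝ, E) p).target)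
    (a : TangentSpace 𝓘(ℝ, E) ((extChartAt 𝓘(ℝ, E) p).symm y)) :
    der (E := E) (extChartAt 𝓘(ℝ, E) p).symm y
    ((mfderiv 𝓘(ℝ, E) 𝓘(ℝ, E) (extChartAt 𝓘(ℝ, E) p) ((extChartAt 𝓘(ℝ, E) p).symm y) :)
      a) = a := by
  have : IsManifold 𝓘(ℝ, E) 1 M := IsManifold.of_le (n := ∞) (by simp)
  have h := mfderivWithin_extChartAt_symm_comp_mfderiv_extChartAt (I := 𝓘(ℝ, E)) hy
  simp only [modelWithCornersSelf_coe, Set.range_id, mfderivWithin_univ] at h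
  exact DFunLike.congr_fun h a

/-- The chart derivatives in `coordEndo` and `coordForm` cancel, leaving the metric `σ (·, J ·)` on
the manifold. -/
lemma coordForm_coordEndo {σ : SymplecticForm E M} {k : ℕ∞} (J : CompatibleJ σ k) (p : M) {y : E}
    (hy : y ∈ (extChartAt 𝓘(ℝ, E) p).target) (a : E) :
    coordForm σ.form p y a (coordEndo J.J p y a) =
      J.normSq ((extChartAt 𝓘(ℝ, E) p).symm y)
        (der (E := E) (extChartAt 𝓘(ℝ, E) p).symm y a) := by
  rw [coordForm_apply]
  have h : der (E := E) (extChartAt 𝓘(ℝ, E) p).symm y (coordEndo J.J p y a) =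
      J.J ((extChartAt 𝓘(ℝ, E) p).symm y)
        (der (E := E) (extChartAt 𝓘(ℝ, E) p).symm y a) :=
    der_symm_comp_der_chart p hy _
  rw [h]
  rfl

end Charts

/-! ### Paths of small energy stay in a chart -/

section Arcs

variable {E : Type*} [NormedAddCommGroup E] [NormedSpace ℝ E]
variable {M : Type*} [TopologicalSpace M] [ChartedSpace E M]

/-- The points whose coordinates in the preferred chart at `p` have distance less than `δ` from
those of `p`. -/
def chartBall (p : M) (δ : ℝ) : Set M :=
  {x | x ∈ (extChartAt 𝓘(ℝ, E) p).source ∧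
    ‖extChartAt 𝓘(ℝ, E) p x - extChartAt 𝓘(ℝ, E) p p‖ < δ}

lemma chartBall_eq (p : M) (δ : ℝ) : chartBall (E := E) p δ =
    (extChartAt 𝓘(ℝ, E) p).source ∩
      extChartAt 𝓘(ℝ, E) p ⁻¹' Metric.ball (extChartAt 𝓘(ℝ, E) p p) δ := by
  ext x
  simp [chartBall, dist_eq_norm]

lemma isOpen_chartBall (p : M) (δ : ℝ) : IsOpen (chartBall (E := E) p δ) := by
  rw [chartBall_eq, extChartAt_source]
  exact isOpen_extChartAt_preimage p Metric.isOpen_ball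

lemma chartBall_mem_nhds (p : M) {δ : ℝ} (hδ : 0 < δ) : chartBall (E := E) p δ ∈ 𝓝 p :=
  (isOpen_chartBall p δ).mem_nhds ⟨mem_extChartAt_source p, by simpa using hδ⟩

lemma exists_chartBall_subset (p : M) {U : Set M} (hU : U ∈ 𝓝 p) :
    ∃ δ > 0, chartBall (E := E) p δ ⊆ U := by
  have h := extChartAt_preimage_mem_nhds (I := 𝓘(ℝ, E)) hU
  obtain ⟨δ, hδ, hb⟩ := Metric.mem_nhds_iff.1 h
  refine ⟨δ, hδ, fun x hx => ?_⟩
  have := hb (show extChartAt 𝓘(ℝ, E) p x ∈ _ by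
    rw [Metric.mem_ball, dist_eq_norm]; exact hx.2)
  rwa [Set.mem_preimage, (extChartAt 𝓘(ℝ, E) p).left_inv hx.1] at this

lemma chartBall_mono (p : M) {δ δ' : ℝ} (h : δ ≤ δ') :
    chartBall (E := E) p δ ⊆ chartBall (E := E) p δ' := fun _ hx => ⟨hx.1, hx.2.trans_le h⟩

lemma norm_sub_le_setIntegral [FiniteDimensional ℝ E] {g : ℝ → E} {T : ℝ} (hT : 0 < T)
    (hg : ContDiffOn ℝ 1 g (Set.Icc 0 T)) :
    IntegrableOn (fun t => ‖deriv g t‖) (Set.Ioo 0 T) ∧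
      ‖g T - g 0‖ ≤ ∫ t in Set.Ioo 0 T, ‖deriv g t‖ := by
  have hc : ContinuousOn (derivWithin g (Set.Icc 0 T)) (Set.Icc 0 T) :=
    hg.continuousOn_derivWithin (uniqueDiffOn_Icc hT) le_rfl
  have he : ∀ t ∈ Set.Ioo 0 T, deriv g t = derivWithin g (Set.Icc 0 T) t := fun t ht =>
    (derivWithin_of_mem_nhds (Icc_mem_nhds ht.1 ht.2)).symm
  have hi : IntegrableOn (deriv g) (Set.Ioo 0 T) :=
    (integrableOn_congr_fun he measurableSet_Ioo).2
      ((hc.integrableOn_Icc).mono_set Set.Ioo_subset_Icc_self)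
  have hii : IntervalIntegrable (deriv g) volume 0 T :=
    (intervalIntegrable_iff_integrableOn_Ioo_of_le hT.le).2 hi
  have hd : ∀ t ∈ Set.Ioo 0 T, HasDerivAt g (deriv g t) t := fun t ht =>
    (((hg.differentiableOn one_ne_zero) t ⟨ht.1.le, ht.2.le⟩).differentiableAt
      (Icc_mem_nhds ht.1 ht.2)).hasDerivAt
  refine ⟨hi.norm, ?_⟩
  rw [← intervalIntegral.integral_eq_sub_of_hasDerivAt_of_le hT.le hg.continuousOn hd hii,
    ← integral_Ioc_eq_integral_Ioo, ← intervalIntegral.integral_of_le hT.le]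
  exact intervalIntegral.norm_integral_le_integral_norm hT.le

variable [IsManifold 𝓘(ℝ, E) ∞ M]

lemma contMDiffOn_chartAt_self (p : M) :
    ContMDiffOn 𝓘(ℝ, E) 𝓘(ℝ, E) ∞ (extChartAt 𝓘(ℝ, E) p) (extChartAt 𝓘(ℝ, E) p).source := by
  rw [extChartAt_source]
  exact contMDiffOn_extChartAt

lemma contDiffOn_chart_comp {F : Type*} [NormedAddCommGroup F] [NormedSpace ℝ F] (p : M)
    {γ : F → M} {s : Set F} (hγ : ContMDiffOn 𝓘(ℝ, F) 𝓘(ℝ, E) ∞ γ s)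
    (h : ∀ t ∈ s, γ t ∈ (extChartAt 𝓘(ℝ, E) p).source) :
    ContDiffOn ℝ ∞ (extChartAt 𝓘(ℝ, E) p ∘ γ) s := by
  rw [← contMDiffOn_iff_contDiffOn]
  exact (contMDiffOn_chartAt_self p).comp hγ h

/-- Positivity of the metric on the compact product of a closed ball and the unit sphere gives a
positive minimum, and quadratic homogeneity extends the bound to all vectors. This turns energy
bounds into bounds on coordinate speed. -/
lemma exists_normSq_lower_bound [FiniteDimensional ℝ E] {σ : SymplecticForm E M} {k : ℕ∞}
    (J : CompatibleJ σ k) (p : M) :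
    ∃ r > 0, ∃ c > 0, Metric.closedBall (extChartAt 𝓘(ℝ, E) p p) r ⊆ (extChartAt 𝓘(ℝ, E) p).target ∧
      ∀ y ∈ Metric.closedBall (extChartAt 𝓘(ℝ, E) p p) r, ∀ a : E,
        c * ‖a‖ ^ 2 ≤ coordForm σ.form p y a (coordEndo J.J p y a) := by
  obtain ⟨r, hr, hrt⟩ := Metric.nhds_basis_closedBall.mem_iff.1
    ((isOpen_target p).mem_nhds (mem_extChartAt_target (I := 𝓘(ℝ, E)) p))
  set F : E × E → ℝ := fun q => coordForm σ.form p q.1 q.2 (coordEndo J.J p q.1 q.2) with hF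
  have hmaps : Set.MapsTo (Prod.fst : E × E → E)
      (Metric.closedBall (extChartAt 𝓘(ℝ, E) p p) r ×ˢ Metric.sphere (0 : E) 1)
      (extChartAt 𝓘(ℝ, E) p).target := fun q hq => hrt hq.1
  have hFc : ContinuousOn F
      (Metric.closedBall (extChartAt 𝓘(ℝ, E) p p) r ×ˢ Metric.sphere (0 : E) 1) := by
    have h1 := (σ.smooth p).continuousOn.comp continuousOn_fst hmaps
    have h2 := (J.regular p).continuousOn.comp continuousOn_fst hmaps
    exact (h1.clm_apply continuousOn_snd).clm_apply (h2.clm_apply continuousOn_snd)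
  have hpos : ∀ y ∈ Metric.closedBall (extChartAt 𝓘(ℝ, E) p p) r,
      ∀ a : E, a ≠ 0 → 0 < F (y, a) := by
    intro y hy a ha
    rw [hF]
    simp only
    rw [coordForm_coordEndo J p (hrt hy)]
    refine J.metric_pos _ _ fun h0 => ha ?_
    have := der_chart_comp_der_symm (E := E) p (hrt hy) a
    rw [← this]
    erw [h0]
    exact map_zero _
  have hK : IsCompact (Metric.closedBall (extChartAt 𝓘(ℝ, E) p p) r ×ˢ Metric.sphere (0 : E) 1) :=
    (isCompact_closedBall _ _).prod (isCompact_sphere _ _)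
  obtain ⟨c, hc, hcF⟩ : ∃ c > 0, ∀ q ∈ Metric.closedBall (extChartAt 𝓘(ℝ, E) p p) r ×ˢ
      Metric.sphere (0 : E) 1, c ≤ F q := by
    -- The unit sphere is empty when `E` is trivial, and any constant works then.
    rcases Set.eq_empty_or_nonempty (Metric.closedBall (extChartAt 𝓘(ℝ, E) p p) r ×ˢ
      Metric.sphere (0 : E) 1) with h | h
    · exact ⟨1, one_pos, fun q hq => absurd hq (h ▸ Set.notMem_empty q)⟩
    · obtain ⟨q, hq, hmin⟩ := hK.exists_isMinOn h hFc
      refine ⟨F q, hpos q.1 hq.1 q.2 ?_, fun q' hq' => hmin hq'⟩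
      have := hq.2
      intro h0
      simp [h0] at this
  refine ⟨r, hr, c, hc, hrt, fun y hy a => ?_⟩
  by_cases ha : a = 0
  · simp [ha]
  · have hn : ‖a‖ ≠ 0 := norm_ne_zero_iff.2 ha
    have h1 := hcF (y, ‖a‖⁻¹ • a) ⟨hy, by simp [norm_smul, hn]⟩
    simp only [hF, map_smul, smul_apply, smul_eq_mul] at h1
    calc c * ‖a‖ ^ 2 ≤ (‖a‖⁻¹ * (‖a‖⁻¹ * coordForm σ.form p y a (coordEndo J.J p y a))) * ‖a‖ ^ 2 :=
          mul_le_mul_of_nonneg_right h1 (by positivity)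
      _ = _ := by field_simp

/-- The squared speed of a path, in coordinates. -/
lemma normSq_der_eq {σ : SymplecticForm E M} {k : ℕ∞}
    (J : CompatibleJ σ k) (p : M) {γ : ℝ → M} {t : ℝ}
    (hγ : ContMDiffAt 𝓘(ℝ, ℝ) 𝓘(ℝ, E) ∞ γ t) (ht : γ t ∈ (extChartAt 𝓘(ℝ, E) p).source) :
    J.normSq (γ t) (der (E := E) γ t 1) =
      coordForm σ.form p (extChartAt 𝓘(ℝ, E) p (γ t)) (deriv (extChartAt 𝓘(ℝ, E) p ∘ γ) t)
        (coordEndo J.J p (extChartAt 𝓘(ℝ, E) p (γ t)) (deriv (extChartAt 𝓘(ℝ, E) p ∘ γ) t)) := by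
  have hsrc : (extChartAt 𝓘(ℝ, E) p).source ∈ 𝓝 (γ t) := by
    rw [extChartAt_source]
    rw [extChartAt_source] at ht
    exact (chartAt E p).open_source.mem_nhds ht
  have hg : DifferentiableAt ℝ (extChartAt 𝓘(ℝ, E) p ∘ γ) t := by
    have h1 : ContMDiffAt 𝓘(ℝ, E) 𝓘(ℝ, E) ∞ (extChartAt 𝓘(ℝ, E) p) (γ t) :=
      (contMDiffOn_chartAt_self p).contMDiffAt hsrc
    have h2 := h1.comp t hγ
    exact (contMDiffAt_iff_contDiffAt.1 h2).differentiableAt (by simp)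
  have hev : γ =ᶠ[𝓝 t] (extChartAt 𝓘(ℝ, E) p).symm ∘ (extChartAt 𝓘(ℝ, E) p ∘ γ) := by
    filter_upwards [hγ.continuousAt.preimage_mem_nhds hsrc] with s hs
    exact ((extChartAt 𝓘(ℝ, E) p).left_inv hs).symm
  rw [coordForm_coordEndo J p ((extChartAt 𝓘(ℝ, E) p).map_source ht),
    (extChartAt 𝓘(ℝ, E) p).left_inv ht,
    der_symm_comp p hg.hasFDerivAt ((extChartAt 𝓘(ℝ, E) p).map_source ht) hev]
  simp

/-- Paths of small energy which start near `p` stay near `p` and are short. -/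
theorem exists_short_arc [T2Space M] [FiniteDimensional ℝ E] {σ : SymplecticForm E M} {k : ℕ∞}
    (J : CompatibleJ σ k) (p : M) {δ : ℝ} (hδ : 0 < δ) :
    ∃ U ∈ 𝓝 p, ∃ η > 0, ∀ (γ : ℝ → M) (h : ℝ → ℝ),
      ContMDiffOn 𝓘(ℝ, ℝ) 𝓘(ℝ, E) ∞ γ (Set.Icc 0 1) → γ 0 ∈ U →
      IntegrableOn h (Set.Ioo 0 1) →
      (∀ t ∈ Set.Ioo 0 1, J.normSq (γ t) (der (E := E) γ t 1) ≤ h t) →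
      ∫ t in Set.Ioo 0 1, h t < η →
      (∀ t ∈ Set.Icc 0 1, γ t ∈ chartBall (E := E) p δ) ∧
      IntegrableOn (fun t => ‖deriv (extChartAt 𝓘(ℝ, E) p ∘ γ) t‖) (Set.Ioo 0 1) ∧
      ∫ t in Set.Ioo 0 1, ‖deriv (extChartAt 𝓘(ℝ, E) p ∘ γ) t‖ ≤ δ := by
  obtain ⟨r, hr, c, hc, hrt, hlow⟩ := exists_normSq_lower_bound J p
  set δ' := min δ r with hδ'
  have hδ'0 : 0 < δ' := lt_min hδ hr
  refine ⟨chartBall (E := E) p (δ' / 4), chartBall_mem_nhds p (by positivity), c * (δ' / 4) ^ 2,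
    by positivity, fun γ h hγ h0 hint hle hη => ?_⟩
  set g := extChartAt 𝓘(ℝ, E) p ∘ γ with hg
  -- With `λ = δ'/4`, the inequality `2 ‖g'‖ ≤ λ + ‖g'‖²/λ` bounds the speed by `k`; it plays the
  -- role of Cauchy-Schwarz without square roots. The choice `η = c λ²` makes the integral of `k` at
  -- most `λ`.
  set k : ℝ → ℝ := fun t => (δ' / 4 + h t / (c * (δ' / 4))) / 2 with hk
  have hkint : IntegrableOn k (Set.Ioo 0 1) :=
    ((integrable_const _).add (hint.div_const _)).div_const _
  have hk0 : ∀ t ∈ Set.Ioo (0 : ℝ) 1, 0 ≤ k t := fun t ht => by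
    have := (J.normSq_nonneg _ _).trans (hle t ht)
    simp only [hk]
    positivity
  have hkle : ∫ t in Set.Ioo 0 1, k t ≤ δ' / 4 := by
    have e : ∫ t in Set.Ioo 0 1, k t =
        (δ' / 4 + (∫ t in Set.Ioo 0 1, h t) / (c * (δ' / 4))) / 2 := by
      simp only [hk]
      rw [integral_div, integral_add (integrable_const _) (hint.div_const _)]
      simp [integral_div]
    have : (∫ t in Set.Ioo 0 1, h t) / (c * (δ' / 4)) ≤ δ' / 4 := by
      rw [div_le_iff₀ (by positivity)]
      nlinarith
    rw [e]
    linarith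
  have hγat : ∀ t ∈ Set.Ioo (0 : ℝ) 1, ContMDiffAt 𝓘(ℝ, ℝ) 𝓘(ℝ, E) ∞ γ t := fun t ht =>
    hγ.contMDiffAt (Icc_mem_nhds ht.1 ht.2)
  have hspeed : ∀ t ∈ Set.Ioo (0 : ℝ) 1, γ t ∈ chartBall (E := E) p δ' → ‖deriv g t‖ ≤ k t := by
    intro t ht hb
    have h1 := hle t ht
    rw [normSq_der_eq J p (hγat t ht) hb.1] at h1
    have h2 := (hlow _ (by
      rw [Metric.mem_closedBall, dist_eq_norm]
      exact hb.2.le.trans (min_le_right _ _)) _).trans h1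
    simp only [hk]
    have h3 : ‖deriv g t‖ ^ 2 / (δ' / 4) ≤ h t / (c * (δ' / 4)) := by
      rw [div_le_div_iff₀ (by positivity) (by positivity)]
      nlinarith
    have h4 : 2 * ‖deriv g t‖ ≤ δ' / 4 + ‖deriv g t‖ ^ 2 / (δ' / 4) := by
      have : 0 ≤ (δ' / 4 - ‖deriv g t‖) ^ 2 / (δ' / 4) := by positivity
      have e : (δ' / 4 - ‖deriv g t‖) ^ 2 / (δ' / 4) =
        δ' / 4 - 2 * ‖deriv g t‖ + ‖deriv g t‖ ^ 2 / (δ' / 4) := by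
        field_simp
        ring
      linarith
    linarith
  have hstay : ∀ T, 0 < T → T ≤ 1 → (∀ t ∈ Set.Icc 0 T, γ t ∈ chartBall (E := E) p δ') →
      IntegrableOn (fun t => ‖deriv g t‖) (Set.Ioo 0 T) ∧
        ‖g T - g 0‖ ≤ ∫ t in Set.Ioo 0 T, ‖deriv g t‖ ∧
        ∫ t in Set.Ioo 0 T, ‖deriv g t‖ ≤ δ' / 4 := by
    intro T hT hT1 hb
    have hgs : ContDiffOn ℝ 1 g (Set.Icc 0 T) :=
      (contDiffOn_chart_comp p (hγ.mono (Set.Icc_subset_Icc_right hT1))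
        fun t ht => (hb t ht).1).of_le (by simp)
    obtain ⟨h1, h2⟩ := norm_sub_le_setIntegral hT hgs
    refine ⟨h1, h2, ?_⟩
    have hsub : Set.Ioo (0 : ℝ) T ⊆ Set.Ioo 0 1 := Set.Ioo_subset_Ioo_right hT1
    calc ∫ t in Set.Ioo 0 T, ‖deriv g t‖ ≤ ∫ t in Set.Ioo 0 T, k t :=
          setIntegral_mono_on h1 (hkint.mono_set hsub) measurableSet_Ioo
            fun t ht => hspeed t (hsub ht) (hb t ⟨ht.1.le, ht.2.le⟩)
      _ ≤ ∫ t in Set.Ioo 0 1, k t :=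
          setIntegral_mono_set hkint ((ae_restrict_iff' measurableSet_Ioo).2 (.of_forall hk0))
            hsub.eventuallyLE
      _ ≤ δ' / 4 := hkle
  -- Continuity argument at the first exit time `T`: before `T` the speed bound holds, so the
  -- coordinates remain within `δ'/4 + δ'/4` of those of `p`, strictly inside the ball of radius
  -- `δ'`.
  have hall : ∀ t ∈ Set.Icc (0 : ℝ) 1, γ t ∈ chartBall (E := E) p δ' := by
    by_contra! hne
    set A := Set.Icc (0 : ℝ) 1 ∩ γ ⁻¹' (chartBall (E := E) p δ')ᶜ with hA
    have hAc : IsClosed A := hγ.continuousOn.preimage_isClosed_of_isClosed isClosed_Icc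
      (isOpen_chartBall p δ').isClosed_compl
    have hAn : A.Nonempty := by
      obtain ⟨t, ht, ht'⟩ := hne
      exact ⟨t, ht, ht'⟩
    have hAb : BddBelow A := ⟨0, fun t ht => ht.1.1⟩
    have hm := hAc.csInf_mem hAn hAb
    set T := sInf A with hT
    have hbelow : ∀ t, 0 ≤ t → t < T → γ t ∈ chartBall (E := E) p δ' := by
      intro t h0t htT
      by_contra hnb
      exact (notMem_of_lt_csInf htT hAb) ⟨⟨h0t, htT.le.trans hm.1.2⟩, hnb⟩
    have h00 : γ 0 ∈ chartBall (E := E) p δ' := chartBall_mono p (by linarith) h0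
    have hTpos : 0 < T := by
      rcases hm.1.1.eq_or_lt with h | h
      · exact absurd (h ▸ h00) hm.2
      · exact h
    -- The path could leave the chart domain with bounded coordinates. This is excluded because `C`,
    -- the image of a compact ball, is closed in the Hausdorff space `M`, so `γ T` still lies in
    -- `C`.
    set C := (extChartAt 𝓘(ℝ, E) p).symm '' Metric.closedBall (extChartAt 𝓘(ℝ, E) p p) (δ' / 2)
    have hsubt : Metric.closedBall (extChartAt 𝓘(ℝ, E) p p) (δ' / 2) ⊆
        (extChartAt 𝓘(ℝ, E) p).target :=
      (Metric.closedBall_subset_closedBall (by linarith [min_le_right δ r])).trans hrt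
    have hC : IsClosed C := ((isCompact_closedBall _ _).image_of_continuousOn
      ((continuousOn_extChartAt_symm p).mono hsubt)).isClosed
    have hin : ∀ t ∈ Set.Ioo 0 T, γ t ∈ C := by
      intro t ht
      obtain ⟨-, h2, h3⟩ := hstay t ht.1 (ht.2.le.trans hm.1.2)
        fun s hs => hbelow s hs.1 (hs.2.trans_lt ht.2)
      refine ⟨g t, ?_, (extChartAt 𝓘(ℝ, E) p).left_inv (hbelow t ht.1.le ht.2).1⟩
      rw [Metric.mem_closedBall, dist_eq_norm]
      calc ‖g t - extChartAt 𝓘(ℝ, E) p p‖ ≤ ‖g t - g 0‖ + ‖g 0 - extChartAt 𝓘(ℝ, E) p p‖ :=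
            norm_sub_le_norm_sub_add_norm_sub _ _ _
        _ ≤ δ' / 4 + δ' / 4 := add_le_add (h2.trans h3) h0.2.le
        _ = δ' / 2 := by ring
    have hTC : γ T ∈ C := by
      have hcw : ContinuousWithinAt γ (Set.Ioo 0 T) T :=
        (hγ.continuousOn T hm.1).mono fun t ht => ⟨ht.1.le, ht.2.le.trans hm.1.2⟩
      have hcl : T ∈ closure (Set.Ioo 0 T) := by
        rw [closure_Ioo hTpos.ne]
        exact ⟨hTpos.le, le_rfl⟩
      have := hcw.mem_closure hcl hin
      rwa [hC.closure_eq] at this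
    obtain ⟨y, hy, hyT⟩ := hTC
    apply hm.2
    rw [← hyT]
    refine ⟨(extChartAt 𝓘(ℝ, E) p).map_target (hsubt hy), ?_⟩
    rw [(extChartAt 𝓘(ℝ, E) p).right_inv (hsubt hy), ← dist_eq_norm]
    exact (Metric.mem_closedBall.1 hy).trans_lt (by linarith)
  obtain ⟨h1, -, h3⟩ := hstay 1 one_pos le_rfl hall
  exact ⟨fun t ht => chartBall_mono p (min_le_left _ _) (hall t ht), h1,
    h3.trans (by linarith [min_le_left δ r])⟩

end Arcs

/-! ### Small paths inside the Lagrangians -/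

section CornerPaths

/-- A smooth function which is `1` on `(-∞, 1/3]` and `0` on `[2/3, ∞)`. -/
def plateau (τ : ℝ) : ℝ := 1 - Real.smoothTransition (3 * τ - 1)

lemma contDiff_plateau : ContDiff ℝ ∞ plateau :=
  contDiff_const.sub (Real.smoothTransition.contDiff.comp
    ((contDiff_const.mul contDiff_id).sub contDiff_const))

lemma plateau_of_le {τ : ℝ} (h : τ ≤ 1 / 3) : plateau τ = 1 := by
  rw [plateau, Real.smoothTransition.zero_of_nonpos (by linarith), sub_zero]

lemma plateau_of_ge {τ : ℝ} (h : 2 / 3 ≤ τ) : plateau τ = 0 := by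
  rw [plateau, Real.smoothTransition.one_of_one_le (by linarith), sub_self]

lemma plateau_nonneg (τ : ℝ) : 0 ≤ plateau τ := by
  have := Real.smoothTransition.le_one (3 * τ - 1)
  unfold plateau
  linarith

lemma plateau_le_one (τ : ℝ) : plateau τ ≤ 1 := by
  have := Real.smoothTransition.nonneg (3 * τ - 1)
  unfold plateau
  linarith

lemma hasDerivAt_plateau (τ : ℝ) : HasDerivAt plateau (deriv plateau τ) τ :=
  (contDiff_plateau.differentiable (by simp) τ).hasDerivAt

lemma exists_deriv_plateau_bound : ∃ K > 0, ∀ τ, |deriv plateau τ| ≤ K := by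
  have hc : Continuous (deriv plateau) := contDiff_plateau.continuous_deriv (by simp)
  obtain ⟨C, hC⟩ := (isCompact_Icc (a := (0 : ℝ)) (b := 1)).exists_bound_of_continuousOn
    hc.continuousOn
  refine ⟨max C 1, by positivity, fun τ => ?_⟩
  by_cases h : τ ∈ Set.Icc (0 : ℝ) 1
  · exact (hC τ h).trans (le_max_left _ _)
  · have h0 : deriv plateau τ = 0 := by
      rw [Set.mem_Icc, not_and_or, not_le, not_le] at h
      rcases h with h | h
      · have : plateau =ᶠ[𝓝 τ] fun _ => 1 := by
          filter_upwards [Iio_mem_nhds h] with s hs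
          exact plateau_of_le (by linarith [Set.mem_Iio.1 hs])
        rw [this.deriv_eq, deriv_const]
      · have : plateau =ᶠ[𝓝 τ] fun _ => 0 := by
          filter_upwards [Ioi_mem_nhds h] with s hs
          exact plateau_of_ge (by linarith [Set.mem_Ioi.1 hs])
        rw [this.deriv_eq, deriv_const]
    rw [h0, abs_zero]
    positivity

variable {E : Type*} [NormedAddCommGroup E] [NormedSpace ℝ E]
variable {M : Type*} [TopologicalSpace M] [ChartedSpace E M]

/-- A smooth path, stationary near both ends, from `x` to `p`, which in the preferred chart at `p`
is `δ`-small in the `C^1` sense. -/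
structure IsCornerPath (p : M) (δ : ℝ) (x : M) (a : ℝ → M) : Prop where
  smooth : ContMDiff 𝓘(ℝ, ℝ) 𝓘(ℝ, E) ∞ a
  left : ∀ τ ≤ 1 / 3, a τ = x
  right : ∀ τ, 2 / 3 ≤ τ → a τ = p
  mem : ∀ τ, a τ ∈ chartBall (E := E) p δ
  deriv_le : ∀ τ, ‖deriv (extChartAt 𝓘(ℝ, E) p ∘ a) τ‖ ≤ δ

/-- Images of short segments are corner paths. -/
lemma exists_isCornerPath_comp [IsManifold 𝓘(ℝ, E) ∞ M] {V : Type*} [NormedAddCommGroup V]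
    [NormedSpace ℝ V] {f : V → M} {O : Set V} (hO : IsOpen O)
    (hf : ContMDiffOn 𝓘(ℝ, V) 𝓘(ℝ, E) ∞ f O) {y₀ : V} (hy₀ : y₀ ∈ O) {δ : ℝ} (hδ : 0 < δ) :
    ∃ r > 0, ∀ y ∈ Metric.ball y₀ r,
      IsCornerPath (E := E) (f y₀) δ (f y) (fun τ => f (y₀ + plateau τ • (y - y₀))) := by
  obtain ⟨K, hK, hKb⟩ := exists_deriv_plateau_bound
  have hnh : O ∩ f ⁻¹' chartBall (E := E) (f y₀) δ ∈ 𝓝 y₀ := Filter.inter_mem (hO.mem_nhds hy₀)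
    ((hf.continuousOn.continuousAt (hO.mem_nhds hy₀)).preimage_mem_nhds (chartBall_mem_nhds _ hδ))
  obtain ⟨r₁, hr₁, hb₁⟩ := Metric.mem_nhds_iff.1 hnh
  set g := extChartAt 𝓘(ℝ, E) (f y₀) ∘ f with hg
  have hgs : ContDiffOn ℝ ∞ g (Metric.ball y₀ r₁) :=
    contDiffOn_chart_comp _ (hf.mono fun y hy => (hb₁ hy).1) fun y hy => (hb₁ hy).2.1
  have hfc : ContinuousOn (fderiv ℝ g) (Metric.ball y₀ r₁) :=
    hgs.continuousOn_fderiv_of_isOpen Metric.isOpen_ball (by simp)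
  have hlt : ∀ᶠ y in 𝓝 y₀, ‖fderiv ℝ g y‖ < ‖fderiv ℝ g y₀‖ + 1 :=
    (hfc.continuousAt (Metric.ball_mem_nhds _ hr₁)).norm.eventually_lt_const (by linarith)
  obtain ⟨r₂, hr₂, hb₂⟩ := Metric.eventually_nhds_iff_ball.1 hlt
  set C := ‖fderiv ℝ g y₀‖ + 1 with hC
  have hC0 : 0 < C := by positivity
  -- The velocity in the chart is at most `C * K * ‖y - y₀‖`, with `C` bounding the derivative of
  -- `g` and `K` that of `plateau`.
  refine ⟨min (min r₁ r₂) (δ / (C * K)), by positivity, fun y hy => ?_⟩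
  have hy' : ‖y - y₀‖ < min (min r₁ r₂) (δ / (C * K)) := by
    rwa [Metric.mem_ball, dist_eq_norm] at hy
  have hmem : ∀ τ, y₀ + plateau τ • (y - y₀) ∈ Metric.ball y₀ (min r₁ r₂) := by
    intro τ
    rw [Metric.mem_ball, dist_eq_norm, add_sub_cancel_left, norm_smul,
      Real.norm_of_nonneg (plateau_nonneg τ)]
    calc plateau τ * ‖y - y₀‖ ≤ 1 * ‖y - y₀‖ := by gcongr; exact plateau_le_one τ
      _ < _ := by rw [one_mul]; exact hy'.trans_le (min_le_left _ _)
  have hm1 := fun τ => Metric.ball_subset_ball (min_le_left r₁ r₂) (hmem τ)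
  have hm2 := fun τ => Metric.ball_subset_ball (min_le_right r₁ r₂) (hmem τ)
  have hcs : ContDiff ℝ ∞ fun τ => y₀ + plateau τ • (y - y₀) :=
    contDiff_const.add (contDiff_plateau.smul contDiff_const)
  refine ⟨?_, ?_, ?_, ?_, ?_⟩
  · rw [← contMDiffOn_univ]
    exact hf.comp hcs.contMDiff.contMDiffOn fun τ _ => (hb₁ (hm1 τ)).1
  · intro τ hτ
    simp only [plateau_of_le hτ, one_smul, add_sub_cancel]
  · intro τ hτ
    simp only [plateau_of_ge hτ, zero_smul, add_zero]
  · exact fun τ => (hb₁ (hm1 τ)).2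
  · intro τ
    have hd1 : HasDerivAt (fun τ => y₀ + plateau τ • (y - y₀)) (deriv plateau τ • (y - y₀)) τ :=
      ((hasDerivAt_plateau τ).smul_const _).const_add _
    have hd2 : HasFDerivAt g (fderiv ℝ g (y₀ + plateau τ • (y - y₀)))
        (y₀ + plateau τ • (y - y₀)) :=
      ((hgs.contDiffAt (Metric.isOpen_ball.mem_nhds (hm1 τ))).differentiableAt
        (by simp)).hasFDerivAt
    have hd3 := hd2.comp_hasDerivAt τ hd1
    have hd4 : deriv (extChartAt 𝓘(ℝ, E) (f y₀) ∘ fun τ => f (y₀ + plateau τ • (y - y₀))) τ =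
      fderiv ℝ g (y₀ + plateau τ • (y - y₀)) (deriv plateau τ • (y - y₀)) := hd3.deriv
    rw [hd4]
    calc _ ≤ ‖fderiv ℝ g (y₀ + plateau τ • (y - y₀))‖ * ‖deriv plateau τ • (y - y₀)‖ :=
          ContinuousLinearMap.le_opNorm _ _
      _ ≤ C * (K * (δ / (C * K))) := by
          rw [norm_smul]
          gcongr
          · exact (hb₂ _ (hm2 τ)).le
          · exact hKb τ
          · exact hy'.le.trans (min_le_right _ _)
      _ = δ := by field_simp

variable {E' : Type*} [NormedAddCommGroup E'] [NormedSpace ℝ E']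
variable {M' : Type*} [TopologicalSpace M'] [ChartedSpace E' M']

/-- Nearby points of a submanifold `L ⊂ M × M'` are joined by small paths in `L`. -/
lemma exists_cornerPaths [IsManifold 𝓘(ℝ, E) ∞ M] [IsManifold 𝓘(ℝ, E') ∞ M']
    {Ω : ∀ p : M × M', TangentSpace (𝓘(ℝ, E).prod 𝓘(ℝ, E')) p →
      TangentSpace (𝓘(ℝ, E).prod 𝓘(ℝ, E')) p → ℝ} {L : Set (M × M')}
    (hL : IsLagrangian (𝓘(ℝ, E).prod 𝓘(ℝ, E')) Ω L) {q : M × M'} (hq : q ∈ L) {δ : ℝ}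
    (hδ : 0 < δ) :
    ∃ U ∈ 𝓝 q, ∀ x ∈ U, x ∈ L → ∃ (a : ℝ → M) (b : ℝ → M'),
      (∀ τ, (a τ, b τ) ∈ L) ∧ IsCornerPath (E := E) q.1 δ x.1 a ∧
        IsCornerPath (E := E') q.2 δ x.2 b := by
  obtain ⟨ψ, F, hqs, ⟨hψ, hslice⟩, -⟩ := hL q hq
  set I := 𝓘(ℝ, E).prod 𝓘(ℝ, E') with hI
  have hopen : IsOpen (ψ.extend I).target := ψ.isOpen_extend_target
  have htgt : (ψ.extend I).target = I '' ψ.target := by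
    rw [ψ.extend_target']
  have hs : ContMDiffOn 𝓘(ℝ, E × E') I ∞ (ψ.extend I).symm (ψ.extend I).target := by
    rw [htgt]
    exact contMDiffOn_extend_symm hψ
  have hqs' : q ∈ (ψ.extend I).source := by rwa [ψ.extend_source]
  have hy₀ := (ψ.extend I).map_source hqs'
  have hfst : ContMDiffOn 𝓘(ℝ, E × E') 𝓘(ℝ, E) ∞ (fun y => ((ψ.extend I).symm y).1)
      (ψ.extend I).target := contMDiff_fst.comp_contMDiffOn hs
  have hsnd : ContMDiffOn 𝓘(ℝ, E × E') 𝓘(ℝ, E') ∞ (fun y => ((ψ.extend I).symm y).2)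
      (ψ.extend I).target := contMDiff_snd.comp_contMDiffOn hs
  obtain ⟨r₁, hr₁, h₁⟩ := exists_isCornerPath_comp hopen hfst hy₀ hδ
  obtain ⟨r₂, hr₂, h₂⟩ := exists_isCornerPath_comp hopen hsnd hy₀ hδ
  obtain ⟨r₃, hr₃, h₃⟩ := Metric.mem_nhds_iff.1 (hopen.mem_nhds hy₀)
  have hcont : ContinuousAt (ψ.extend I) q := ψ.continuousAt_extend hqs
  refine ⟨ψ.source ∩ ψ.extend I ⁻¹' Metric.ball (ψ.extend I q) (min (min r₁ r₂) r₃),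
    Filter.inter_mem (ψ.open_source.mem_nhds hqs)
      (hcont.preimage_mem_nhds (Metric.ball_mem_nhds _ (by positivity))), fun x hx hxL => ?_⟩
  have hxs : x ∈ (ψ.extend I).source := by rw [ψ.extend_source]; exact hx.1
  have hx1 := h₁ _ (Metric.ball_subset_ball ((min_le_left _ _).trans (min_le_left _ _)) hx.2)
  have hx2 := h₂ _ (Metric.ball_subset_ball ((min_le_left _ _).trans (min_le_right _ _)) hx.2)
  simp only [(ψ.extend I).left_inv hqs', (ψ.extend I).left_inv hxs] at hx1 hx2
  refine ⟨_, _, fun τ => ?_, hx1, hx2⟩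
  set y := ψ.extend I q + plateau τ • (ψ.extend I x - ψ.extend I q) with hy
  -- In the slice chart `L` is a linear subspace, so the segment between two of its points stays in
  -- `L`.
  have hyF : y ∈ F := by
    have e1 := (hslice q hqs).1 hq
    have e2 := (hslice x hx.1).1 hxL
    exact F.add_mem e1 (F.smul_mem _ (F.sub_mem e2 e1))
  have hyt : y ∈ (ψ.extend I).target := by
    apply h₃
    rw [Metric.mem_ball, dist_eq_norm, hy, add_sub_cancel_left, norm_smul,
      Real.norm_of_nonneg (plateau_nonneg τ)]
    have hlt : ‖ψ.extend I x - ψ.extend I q‖ < r₃ := by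
      have := hx.2
      rw [Set.mem_preimage, Metric.mem_ball, dist_eq_norm] at this
      exact this.trans_le (min_le_right _ _)
    calc _ ≤ 1 * ‖ψ.extend I x - ψ.extend I q‖ := by gcongr; exact plateau_le_one τ
      _ < r₃ := by rwa [one_mul]
  have hsrc := (ψ.extend I).map_target hyt
  rw [ψ.extend_source] at hsrc
  show (ψ.extend I).symm y ∈ L
  rw [hslice _ hsrc, (ψ.extend I).right_inv hyt]
  exact hyF

end CornerPaths

/-! ### Filling a short arc by a cap of small area -/

section Caps

variable {E : Type*} [NormedAddCommGroup E] [NormedSpace ℝ E]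

/-- The homotopy from `g` to the constant `y₀` with prescribed boundary paths `α`, `β`. -/
def capHomotopy (y₀ : E) (g α β : ℝ → E) (z : ℝ × ℝ) : E :=
  y₀ + plateau z.1 • (g z.2 - y₀) + (1 - z.2) • (α z.1 - y₀ - plateau z.1 • (g 0 - y₀))
    + z.2 • (β z.1 - y₀ - plateau z.1 • (g 1 - y₀))

lemma contDiffOn_capHomotopy {y₀ : E} {g α β : ℝ → E} {T : Set ℝ} (hg : ContDiffOn ℝ ∞ g T)
    (hα : ContDiff ℝ ∞ α) (hβ : ContDiff ℝ ∞ β) :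
    ContDiffOn ℝ ∞ (capHomotopy y₀ g α β) (Set.univ ×ˢ T) := by
  have hg' : ContDiffOn ℝ ∞ (fun z : ℝ × ℝ => g z.2) (Set.univ ×ˢ T) :=
    hg.comp contDiffOn_snd fun z hz => hz.2
  have h1 : ContDiff ℝ ∞ fun z : ℝ × ℝ => plateau z.1 := contDiff_plateau.comp contDiff_fst
  have h2 : ContDiff ℝ ∞ fun z : ℝ × ℝ => α z.1 := hα.comp contDiff_fst
  have h3 : ContDiff ℝ ∞ fun z : ℝ × ℝ => β z.1 := hβ.comp contDiff_fst
  have h4 : ContDiff ℝ ∞ fun z : ℝ × ℝ =>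
      (1 - z.2) • (α z.1 - y₀ - plateau z.1 • (g 0 - y₀)) :=
    (contDiff_const.sub contDiff_snd).smul
      ((h2.sub contDiff_const).sub (h1.smul contDiff_const))
  have h5 : ContDiff ℝ ∞ fun z : ℝ × ℝ => z.2 • (β z.1 - y₀ - plateau z.1 • (g 1 - y₀)) :=
    contDiff_snd.smul ((h3.sub contDiff_const).sub (h1.smul contDiff_const))
  exact ((contDiffOn_const.add (h1.contDiffOn.smul (hg'.sub contDiffOn_const))).add
    h4.contDiffOn).add h5.contDiffOn

/-- Only values of `g`, and not `g'`, enter the derivative in `τ`, so it is uniformly small. The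
derivative in `t` contains `g'`, which is controlled only in `L¹`; a product of one uniform and one
integral bound is what the area estimate needs. -/
lemma capHomotopy_fst {y₀ : E} {g α β : ℝ → E} {τ t : ℝ} {α' β' : E}
    (hα : HasDerivAt α α' τ) (hβ : HasDerivAt β β' τ) :
    HasDerivAt (fun τ => capHomotopy y₀ g α β (τ, t))
      (deriv plateau τ • (g t - y₀) + (1 - t) • (α' - deriv plateau τ • (g 0 - y₀))
        + t • (β' - deriv plateau τ • (g 1 - y₀))) τ := by
  have hp := hasDerivAt_plateau τ
  exact (((hp.smul_const (g t - y₀)).const_add y₀).add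
    (((hα.sub_const y₀).sub (hp.smul_const (g 0 - y₀))).const_smul (1 - t))).add
    (((hβ.sub_const y₀).sub (hp.smul_const (g 1 - y₀))).const_smul t)

lemma capHomotopy_snd {y₀ : E} {g α β : ℝ → E} {τ t : ℝ} {g' : E} (hg : HasDerivAt g g' t) :
    HasDerivAt (fun t => capHomotopy y₀ g α β (τ, t))
      (plateau τ • g' + (-1 : ℝ) • (α τ - y₀ - plateau τ • (g 0 - y₀))
        + (1 : ℝ) • (β τ - y₀ - plateau τ • (g 1 - y₀))) t :=
  ((((hg.sub_const y₀).const_smul (plateau τ)).const_add y₀).add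
    (((hasDerivAt_id t).const_sub 1).smul_const (α τ - y₀ - plateau τ • (g 0 - y₀)))).add
    ((hasDerivAt_id t).smul_const (β τ - y₀ - plateau τ • (g 1 - y₀)))

/-- The interpolation term is at most `δ` and each of the two boundary corrections at most `2 δ`, so
`6 δ` leaves room for a strict inequality. -/
lemma norm_capHomotopy_sub_lt {y₀ : E} {g α β : ℝ → E} {τ t δ : ℝ} (ht : t ∈ Set.Icc (0 : ℝ) 1)
    (hg : ∀ s ∈ Set.Icc (0 : ℝ) 1, ‖g s - y₀‖ < δ) (hα : ‖α τ - y₀‖ < δ) (hβ : ‖β τ - y₀‖ < δ) :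
    ‖capHomotopy y₀ g α β (τ, t) - y₀‖ < 6 * δ := by
  have hp0 := plateau_nonneg τ
  have hp1 := plateau_le_one τ
  have hδ : 0 < δ := (norm_nonneg _).trans_lt hα
  have hc : ∀ s ∈ Set.Icc (0 : ℝ) 1, ‖plateau τ • (g s - y₀)‖ ≤ δ := fun s hs => by
    rw [norm_smul, Real.norm_of_nonneg hp0]
    nlinarith [norm_nonneg (g s - y₀), hg s hs]
  have h0 := hc 0 (by simp)
  have h1 := hc 1 (by simp)
  have ha : ‖(1 - t) • (α τ - y₀ - plateau τ • (g 0 - y₀))‖ ≤ 2 * δ := by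
    rw [norm_smul, Real.norm_of_nonneg (by linarith [ht.2])]
    nlinarith [norm_sub_le (α τ - y₀) (plateau τ • (g 0 - y₀)), ht.1, ht.2,
      norm_nonneg (α τ - y₀ - plateau τ • (g 0 - y₀))]
  have hb : ‖t • (β τ - y₀ - plateau τ • (g 1 - y₀))‖ ≤ 2 * δ := by
    rw [norm_smul, Real.norm_of_nonneg ht.1]
    nlinarith [norm_sub_le (β τ - y₀) (plateau τ • (g 1 - y₀)), ht.1, ht.2,
      norm_nonneg (β τ - y₀ - plateau τ • (g 1 - y₀))]
  have e : capHomotopy y₀ g α β (τ, t) - y₀ = plateau τ • (g t - y₀)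
      + (1 - t) • (α τ - y₀ - plateau τ • (g 0 - y₀))
      + t • (β τ - y₀ - plateau τ • (g 1 - y₀)) := by
    simp only [capHomotopy]; abel
  rw [e]
  calc _ ≤ δ + 2 * δ + 2 * δ :=
        (norm_add₃_le).trans (add_le_add (add_le_add (hc t ht) ha) hb)
    _ < 6 * δ := by linarith

variable {M : Type*} [TopologicalSpace M] [ChartedSpace E M] [IsManifold 𝓘(ℝ, E) ∞ M]

/-- A short arc near `p`, together with corner paths at its end points, bounds a cap of small
area. -/
theorem exists_cap (σ : SymplecticForm E M) (p : M) {ε : ℝ} (hε : 0 < ε) :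
    ∃ δ > 0, ∀ γ a b : ℝ → M, ContMDiffOn 𝓘(ℝ, ℝ) 𝓘(ℝ, E) ∞ γ (Set.Icc 0 1) →
      (∀ t ∈ Set.Icc 0 1, γ t ∈ chartBall (E := E) p δ) →
      IntegrableOn (fun t => ‖deriv (extChartAt 𝓘(ℝ, E) p ∘ γ) t‖) (Set.Ioo 0 1) →
      ∫ t in Set.Ioo 0 1, ‖deriv (extChartAt 𝓘(ℝ, E) p ∘ γ) t‖ ≤ δ →
      IsCornerPath (E := E) p δ (γ 0) a → IsCornerPath (E := E) p δ (γ 1) b →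
      ∃ c : ℝ × ℝ → M, ContMDiffOn 𝓘(ℝ, ℝ × ℝ) 𝓘(ℝ, E) ∞ c (Set.univ ×ˢ Set.Icc 0 1) ∧
        (∀ τ ≤ 1 / 3, ∀ t ∈ Set.Icc (0 : ℝ) 1, c (τ, t) = γ t) ∧
        (∀ τ, 2 / 3 ≤ τ → ∀ t, c (τ, t) = p) ∧
        (∀ τ, c (τ, 0) = a τ) ∧ (∀ τ, c (τ, 1) = b τ) ∧
        IntegrableOn (dens σ c) (Set.Ioo 0 1 ×ˢ Set.Ioo 0 1) ∧
        |∫ z in Set.Ioo (0 : ℝ) 1 ×ˢ Set.Ioo (0 : ℝ) 1, dens σ c z| ≤ ε := by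
  set φ := extChartAt 𝓘(ℝ, E) p with hφ
  obtain ⟨K, hK, hKb⟩ := exists_deriv_plateau_bound
  have hcf := ((continuous_norm (E := E →L[ℝ] E →L[ℝ] ℝ)).comp_continuousOn
    (σ.smooth p).continuousOn).continuousAt
    (x := φ p) ((isOpen_target (E := E) p).mem_nhds (mem_extChartAt_target p))
  have hlt : ∀ᶠ y in 𝓝 (φ p), ‖coordForm σ.form p y‖ < ‖coordForm σ.form p (φ p)‖ + 1 :=
    hcf.eventually_lt_const (lt_add_one _)
  obtain ⟨r, hr, hrb⟩ := Metric.eventually_nhds_iff_ball.1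
    (hlt.and ((isOpen_target p).mem_nhds (mem_extChartAt_target p)))
  set C := ‖coordForm σ.form p (φ p)‖ + 1 with hC
  have hC0 : 0 < C := by positivity
  -- The bound `r / 6` keeps the homotopy in the chart ball of radius `r`. The density is at most `C
  -- (2K + 1) δ (‖g'‖ + 4 δ)`, and `δ ≤ 1` makes the integral of the last factor at most `δ + 4 δ ≤
  -- 5`.
  refine ⟨min (min (r / 6) 1) (ε / (5 * C * (2 * K + 1))), by positivity, ?_⟩
  set δ := min (min (r / 6) 1) (ε / (5 * C * (2 * K + 1))) with hδ
  have hδ0 : 0 < δ := by positivity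
  have hδr : 6 * δ ≤ r := by
    have : δ ≤ r / 6 := (min_le_left _ _).trans (min_le_left _ _)
    linarith
  have hδ1 : δ ≤ 1 := (min_le_left _ _).trans (min_le_right _ _)
  have hδε : C * ((2 * K + 1) * δ) * 5 ≤ ε := by
    have : δ ≤ ε / (5 * C * (2 * K + 1)) := min_le_right _ _
    rw [le_div_iff₀ (by positivity)] at this
    linarith
  intro γ a b hγ hγb hint hle ha hb
  set g := φ ∘ γ with hg
  have hgs : ContDiffOn ℝ ∞ g (Set.Icc 0 1) := contDiffOn_chart_comp p hγ fun t ht => (hγb t ht).1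
  have hαs : ContDiff ℝ ∞ (φ ∘ a) := by
    rw [← contDiffOn_univ]
    exact contDiffOn_chart_comp p ha.smooth.contMDiffOn fun t _ => (ha.mem t).1
  have hβs : ContDiff ℝ ∞ (φ ∘ b) := by
    rw [← contDiffOn_univ]
    exact contDiffOn_chart_comp p hb.smooth.contMDiffOn fun t _ => (hb.mem t).1
  set G := capHomotopy (φ p) g (φ ∘ a) (φ ∘ b) with hG
  have hGs : ContDiffOn ℝ ∞ G (Set.univ ×ˢ Set.Icc 0 1) := contDiffOn_capHomotopy hgs hαs hβs
  have hgb : ∀ s ∈ Set.Icc (0 : ℝ) 1, ‖g s - φ p‖ < δ := fun s hs => (hγb s hs).2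
  have hGb : ∀ z ∈ Set.univ ×ˢ Set.Icc (0 : ℝ) 1, G z ∈ Metric.ball (φ p) r := by
    rintro ⟨τ, t⟩ hz
    rw [Metric.mem_ball, dist_eq_norm]
    exact (norm_capHomotopy_sub_lt hz.2 hgb (ha.mem τ).2 (hb.mem τ).2).trans_le hδr
  have hGt : ∀ z ∈ Set.univ ×ˢ Set.Icc (0 : ℝ) 1, G z ∈ φ.target := fun z hz =>
    (hrb _ (hGb z hz)).2
  have hopen : IsOpen (Set.univ ×ˢ Set.Ioo (0 : ℝ) 1 : Set (ℝ × ℝ)) := isOpen_univ.prod isOpen_Ioo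
  have hsub : (Set.univ ×ˢ Set.Ioo (0 : ℝ) 1 : Set (ℝ × ℝ)) ⊆ Set.univ ×ˢ Set.Icc 0 1 :=
    Set.prod_mono subset_rfl Set.Ioo_subset_Icc_self
  have hsub2 : (Set.Ioo (0 : ℝ) 1 ×ˢ Set.Ioo (0 : ℝ) 1 : Set (ℝ × ℝ)) ⊆
      Set.univ ×ˢ Set.Ioo 0 1 := Set.prod_mono (Set.subset_univ _) subset_rfl
  have hGd : ∀ z ∈ Set.univ ×ˢ Set.Ioo (0 : ℝ) 1, HasFDerivAt G (fderiv ℝ G z) z := fun z hz =>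
    (((hGs.mono hsub).contDiffAt (hopen.mem_nhds hz)).differentiableAt (by simp)).hasFDerivAt
  have hG1 : ∀ z ∈ Set.univ ×ˢ Set.Ioo (0 : ℝ) 1, ‖fderiv ℝ G z (1, 0)‖ ≤ (2 * K + 1) * δ := by
    rintro ⟨τ, t⟩ hz
    have hα' : HasDerivAt (φ ∘ a) (deriv (φ ∘ a) τ) τ :=
      (hαs.differentiable (by simp) τ).hasDerivAt
    have hβ' : HasDerivAt (φ ∘ b) (deriv (φ ∘ b) τ) τ :=
      (hβs.differentiable (by simp) τ).hasDerivAt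
    have e : HasDerivAt (fun s => G (s, t)) (fderiv ℝ G (τ, t) (1, 0)) τ :=
      HasFDerivAt.comp_hasDerivAt (f := fun s : ℝ => (s, t)) (l := G) τ (hGd (τ, t) hz)
        ((hasDerivAt_id' τ).prodMk (hasDerivAt_const τ t))
    rw [e.unique (capHomotopy_fst hα' hβ')]
    have hk : ∀ s ∈ Set.Icc (0 : ℝ) 1, ‖deriv plateau τ • (g s - φ p)‖ ≤ K * δ := fun s hs => by
      rw [norm_smul]
      exact mul_le_mul (hKb τ) (hgb s hs).le (norm_nonneg _) hK.le
    have h0 := hk 0 (by simp)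
    have h1 := hk 1 (by simp)
    have ht0 := hz.2.1
    have ht1 := hz.2.2
    simp only at ht0 ht1
    have e1 : ‖(1 - t) • (deriv (φ ∘ a) τ - deriv plateau τ • (g 0 - φ p))‖ ≤
        (1 - t) * (δ + K * δ) := by
      rw [norm_smul, Real.norm_of_nonneg (by linarith)]
      exact mul_le_mul_of_nonneg_left ((norm_sub_le _ _).trans (add_le_add (ha.deriv_le τ) h0))
        (by linarith)
    have e2 : ‖t • (deriv (φ ∘ b) τ - deriv plateau τ • (g 1 - φ p))‖ ≤ t * (δ + K * δ) := by
      rw [norm_smul, Real.norm_of_nonneg ht0.le]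
      exact mul_le_mul_of_nonneg_left ((norm_sub_le _ _).trans (add_le_add (hb.deriv_le τ) h1))
        ht0.le
    calc _ ≤ K * δ + (1 - t) * (δ + K * δ) + t * (δ + K * δ) :=
          norm_add₃_le.trans (add_le_add (add_le_add (hk t (Set.Ioo_subset_Icc_self hz.2)) e1) e2)
      _ = (2 * K + 1) * δ := by ring
  have hG2 : ∀ z ∈ Set.univ ×ˢ Set.Ioo (0 : ℝ) 1,
      ‖fderiv ℝ G z (0, 1)‖ ≤ ‖deriv g z.2‖ + 4 * δ := by
    rintro ⟨τ, t⟩ hz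
    have hg' : HasDerivAt g (deriv g t) t :=
      ((hgs.contDiffAt (Icc_mem_nhds hz.2.1 hz.2.2)).differentiableAt (by simp)).hasDerivAt
    have e : HasDerivAt (fun s => G (τ, s)) (fderiv ℝ G (τ, t) (0, 1)) t :=
      (hGd _ hz).comp_hasDerivAt t ((hasDerivAt_const t τ).prodMk (hasDerivAt_id t))
    rw [e.unique (capHomotopy_snd hg')]
    have hp0 := plateau_nonneg τ
    have hp1 := plateau_le_one τ
    have hc : ∀ v : E, ‖plateau τ • v‖ ≤ ‖v‖ := fun v => by
      rw [norm_smul, Real.norm_of_nonneg hp0]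
      exact mul_le_of_le_one_left (norm_nonneg _) hp1
    have h0 := (hc _).trans (hgb 0 (by simp)).le
    have h1 := (hc _).trans (hgb 1 (by simp)).le
    have e1 : ‖(-1 : ℝ) • ((φ ∘ a) τ - φ p - plateau τ • (g 0 - φ p))‖ ≤ δ + δ := by
      rw [neg_one_smul, norm_neg]
      exact (norm_sub_le _ _).trans (add_le_add (ha.mem τ).2.le h0)
    have e2 : ‖(1 : ℝ) • ((φ ∘ b) τ - φ p - plateau τ • (g 1 - φ p))‖ ≤ δ + δ := by
      rw [one_smul]
      exact (norm_sub_le _ _).trans (add_le_add (hb.mem τ).2.le h1)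
    calc _ ≤ ‖deriv g t‖ + (δ + δ) + (δ + δ) :=
          norm_add₃_le.trans (add_le_add (add_le_add (hc _) e1) e2)
      _ = _ := by ring
  have hdens : ∀ z ∈ Set.univ ×ˢ Set.Ioo (0 : ℝ) 1, dens σ (φ.symm ∘ G) z =
      coordForm σ.form p (G z) (fderiv ℝ G z (1, 0)) (fderiv ℝ G z (0, 1)) := fun z hz =>
    dens_symm_comp σ p (hGd z hz) (hGt z (hsub hz)) (Filter.EventuallyEq.refl _ _)
  have hdle : ∀ z ∈ Set.univ ×ˢ Set.Ioo (0 : ℝ) 1, ‖dens σ (φ.symm ∘ G) z‖ ≤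
      C * ((2 * K + 1) * δ) * (‖deriv g z.2‖ + 4 * δ) := by
    intro z hz
    rw [hdens z hz]
    calc _ ≤ ‖coordForm σ.form p (G z)‖ * ‖fderiv ℝ G z (1, 0)‖ * ‖fderiv ℝ G z (0, 1)‖ :=
          ContinuousLinearMap.le_opNorm₂ _ _ _
      _ ≤ _ := by
          gcongr
          · exact (hrb _ (hGb z (hsub hz))).1.le
          · exact hG1 z hz
          · exact hG2 z hz
  have hcont : ContinuousOn (dens σ (φ.symm ∘ G)) (Set.univ ×ˢ Set.Ioo (0 : ℝ) 1) := by
    have h1 : ContinuousOn (fun z => coordForm σ.form p (G z)) (Set.univ ×ˢ Set.Ioo (0 : ℝ) 1) :=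
      (σ.smooth p).continuousOn.comp (hGs.continuousOn.mono hsub) fun z hz => hGt z (hsub hz)
    have h2 : ContinuousOn (fderiv ℝ G) (Set.univ ×ˢ Set.Ioo (0 : ℝ) 1) :=
      (hGs.mono hsub).continuousOn_fderiv_of_isOpen hopen (by simp)
    exact ((h1.clm_apply (h2.clm_apply continuousOn_const)).clm_apply
      (h2.clm_apply continuousOn_const)).congr hdens
  have hQm : MeasurableSet (Set.Ioo (0 : ℝ) 1 ×ˢ Set.Ioo (0 : ℝ) 1) :=
    measurableSet_Ioo.prod measurableSet_Ioo
  have hBi : Integrable (fun z : ℝ × ℝ => (1 : ℝ) * (‖deriv g z.2‖ + 4 * δ))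
      ((volume.restrict (Set.Ioo (0 : ℝ) 1)).prod (volume.restrict (Set.Ioo (0 : ℝ) 1))) :=
    Integrable.mul_prod (f := fun _ : ℝ => (1 : ℝ)) (g := fun t => ‖deriv g t‖ + 4 * δ)
      (integrable_const _) (hint.add (integrable_const _))
  rw [Measure.prod_restrict] at hBi
  have hBv : ∫ z in Set.Ioo (0 : ℝ) 1 ×ˢ Set.Ioo (0 : ℝ) 1, (1 : ℝ) * (‖deriv g z.2‖ + 4 * δ) =
      (∫ t in Set.Ioo (0 : ℝ) 1, ‖deriv g t‖) + 4 * δ := by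
    have h1 := setIntegral_prod_mul (μ := volume) (ν := volume) (fun _ : ℝ => (1 : ℝ))
      (fun t => ‖deriv g t‖ + 4 * δ) (Set.Ioo 0 1) (Set.Ioo 0 1)
    rw [integral_add hint (integrable_const _)] at h1
    rw [← Measure.volume_eq_prod] at h1
    simpa using h1
  have hBi' := hBi.const_mul (C * ((2 * K + 1) * δ))
  have hdle' : ∀ z ∈ Set.Ioo (0 : ℝ) 1 ×ˢ Set.Ioo (0 : ℝ) 1, ‖dens σ (φ.symm ∘ G) z‖ ≤
      C * ((2 * K + 1) * δ) * (1 * (‖deriv g z.2‖ + 4 * δ)) := fun z hz => by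
    rw [one_mul]; exact hdle z (hsub2 hz)
  refine ⟨φ.symm ∘ G, ?_, ?_, ?_, ?_, ?_, ?_, ?_⟩
  · exact (contMDiffOn_extChartAt_symm p).comp hGs.contMDiffOn hGt
  · intro τ hτ t ht
    have e : G (τ, t) = φ (γ t) := by
      simp only [hG, capHomotopy, plateau_of_le hτ, Function.comp, ha.left τ hτ, hb.left τ hτ, hg]
      simp
    rw [Function.comp_apply, e]
    exact φ.left_inv (hγb t ht).1
  · intro τ hτ t
    have e : G (τ, t) = φ p := by
      simp only [hG, capHomotopy, plateau_of_ge hτ, Function.comp, ha.right τ hτ, hb.right τ hτ, hg]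
      simp
    rw [Function.comp_apply, e]
    exact φ.left_inv (mem_extChartAt_source p)
  · intro τ
    have e : G (τ, 0) = φ (a τ) := by
      simp only [hG, capHomotopy, Function.comp, hg]
      simp
    rw [Function.comp_apply, e]
    exact φ.left_inv (ha.mem τ).1
  · intro τ
    have e : G (τ, 1) = φ (b τ) := by
      simp only [hG, capHomotopy, Function.comp, hg]
      simp
    rw [Function.comp_apply, e]
    exact φ.left_inv (hb.mem τ).1
  · exact hBi'.mono' ((hcont.mono hsub2).aestronglyMeasurable hQm)
      ((ae_restrict_iff' hQm).2 (.of_forall hdle'))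
  · rw [← Real.norm_eq_abs]
    calc _ ≤ ∫ z in Set.Ioo (0 : ℝ) 1 ×ˢ Set.Ioo (0 : ℝ) 1,
          C * ((2 * K + 1) * δ) * (1 * (‖deriv g z.2‖ + 4 * δ)) :=
          norm_integral_le_of_norm_le hBi' ((ae_restrict_iff' hQm).2 (.of_forall hdle'))
      _ = C * ((2 * K + 1) * δ) * ((∫ t in Set.Ioo (0 : ℝ) 1, ‖deriv g t‖) + 4 * δ) := by
          rw [integral_const_mul, hBv]
      _ ≤ C * ((2 * K + 1) * δ) * 5 := by
          gcongr
          linarith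
      _ ≤ ε := hδε

end Caps

/-! ### Radial reparametrizations that come to rest -/

section Cutoff

/-- A smooth reparametrization of the line which is the identity on `(-∞, 1]`, increases strictly
up to `R₁` and is equal to `R` on `[R₁, ∞)`. -/
structure IsRadialCutoff (ρ : ℝ → ℝ) (R R₁ : ℝ) : Prop where
  smooth : ContDiff ℝ ∞ ρ
  one_lt : 1 < R₁
  eq_self : ∀ r ≤ 1, ρ r = r
  eq_const : ∀ r, R₁ ≤ r → ρ r = R
  strictMono : StrictMonoOn ρ (Set.Iic R₁)
  deriv_nonneg : ∀ r, 0 ≤ deriv ρ r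

/-- A translate of the primitive of `plateau`. The primitive is the identity up to `1/3` and stops
at a height `c ≤ 2/3`; shifting both coordinates by `R - c ≥ 4/3` keeps the identity on `(-∞, 1]`,
which is where `2 ≤ R` enters. -/
lemma exists_isRadialCutoff {R : ℝ} (hR : 2 ≤ R) : ∃ ρ R₁, IsRadialCutoff ρ R R₁ := by
  set ρ₀ : ℝ → ℝ := fun x => ∫ y in (0 : ℝ)..x, plateau y with hρ₀
  have hpc : Continuous plateau := contDiff_plateau.continuous
  have hd : ∀ x, HasDerivAt ρ₀ (plateau x) x := fun x =>
    (hpc.integral_hasStrictDerivAt 0 x).hasDerivAt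
  have hde : deriv ρ₀ = plateau := funext fun x => (hd x).deriv
  have hs : ContDiff ℝ ∞ ρ₀ := by
    rw [contDiff_infty_iff_deriv, hde]
    exact ⟨fun x => (hd x).differentiableAt, contDiff_plateau⟩
  have hle : ∀ x ≤ 1 / 3, ρ₀ x = x := by
    intro x hx
    have : ∫ y in (0 : ℝ)..x, plateau y = ∫ y in (0 : ℝ)..x, (1 : ℝ) := by
      refine intervalIntegral.integral_congr fun y hy => plateau_of_le ?_
      exact hy.2.trans (max_le (by norm_num) hx)
    simp only [hρ₀, this, intervalIntegral.integral_const]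
    simp
  have hge : ∀ x, 2 / 3 ≤ x → ρ₀ x = ρ₀ (2 / 3) := by
    intro x hx
    have h1 : ρ₀ x - ρ₀ (2 / 3) = ∫ y in (2 / 3 : ℝ)..x, plateau y :=
      intervalIntegral.integral_interval_sub_left (hpc.intervalIntegrable _ _)
        (hpc.intervalIntegrable _ _)
    have h2 : ∫ y in (2 / 3 : ℝ)..x, plateau y = ∫ y in (2 / 3 : ℝ)..x, (0 : ℝ) := by
      refine intervalIntegral.integral_congr fun y hy => plateau_of_ge ?_
      rw [Set.uIcc_of_le hx] at hy
      exact hy.1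
    rw [h2, intervalIntegral.integral_zero] at h1
    linarith
  set c := ρ₀ (2 / 3) with hc
  have hc1 : c ≤ 2 / 3 := by
    have h := norm_image_sub_le_of_norm_deriv_le_segment' (f := ρ₀) (f' := plateau) (a := 0)
      (b := 2 / 3) (C := 1) (fun x _ => (hd x).hasDerivWithinAt)
      (fun x _ => by
        rw [Real.norm_of_nonneg (plateau_nonneg x)]
        exact plateau_le_one x) (2 / 3) (by norm_num)
    rw [hle 0 (by norm_num), Real.norm_eq_abs] at h
    linarith [le_abs_self (ρ₀ (2 / 3) - 0)]
  set K := R - c with hK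
  have hd' : ∀ r, HasDerivAt (fun r => K + ρ₀ (r - K)) (plateau (r - K)) r := fun r => by
    simpa using ((hd (r - K)).comp r ((hasDerivAt_id r).sub_const K)).const_add K
  have hsm : ContDiff ℝ ∞ fun r => K + ρ₀ (r - K) :=
    contDiff_const.add (hs.comp (contDiff_id.sub contDiff_const))
  refine ⟨fun r => K + ρ₀ (r - K), K + 2 / 3, hsm, by linarith, fun r hr => ?_, fun r hr => ?_,
    ?_, fun r => ?_⟩
  · rw [hle _ (by linarith)]
    ring
  · rw [hge _ (by linarith)]
    ring
  · refine strictMonoOn_of_deriv_pos (convex_Iic _) hsm.continuous.continuousOn fun x hx => ?_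
    rw [interior_Iic] at hx
    rw [(hd' x).deriv, plateau]
    have := Real.smoothTransition.lt_one_of_lt_one (x := 3 * (x - K) - 1)
      (by linarith [Set.mem_Iio.1 hx])
    linarith
  · rw [(hd' r).deriv]
    exact plateau_nonneg _

variable {ρ : ℝ → ℝ} {R R₁ : ℝ}

lemma IsRadialCutoff.apply_right (h : IsRadialCutoff ρ R R₁) : ρ R₁ = R := h.eq_const _ le_rfl

lemma IsRadialCutoff.pos (h : IsRadialCutoff ρ R R₁) {r : ℝ} (hr : 0 < r) : 0 < ρ r := by
  have h0 : ρ 0 = 0 := h.eq_self 0 zero_le_one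
  have h1 := h.one_lt
  have key : ∀ s, 0 < s → s ≤ R₁ → 0 < ρ s := fun s hs hs' =>
    h0 ▸ h.strictMono (show (0 : ℝ) ≤ R₁ by linarith) hs' hs
  rcases le_total r R₁ with hle | hle
  · exact key r hr hle
  · rw [h.eq_const r hle, ← h.apply_right]
    exact key R₁ (by linarith) le_rfl

lemma IsRadialCutoff.image_Ioo (h : IsRadialCutoff ρ R R₁) :
    ρ '' Set.Ioo 0 R₁ = Set.Ioo 0 R := by
  have h0 : ρ 0 = 0 := h.eq_self 0 zero_le_one
  have h1 := h.one_lt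
  apply subset_antisymm
  · rintro _ ⟨r, hr, rfl⟩
    refine ⟨h.pos hr.1, ?_⟩
    rw [← h.apply_right]
    exact h.strictMono hr.2.le (le_refl R₁) hr.2
  · have := intermediate_value_Ioo (f := ρ) (a := 0) (b := R₁) (by linarith)
      h.smooth.continuous.continuousOn
    rwa [h0, h.apply_right] at this

end Cutoff

/-! ### Gluing a cap to a truncated end -/

section EndCap

variable {E : Type*} [NormedAddCommGroup E] [NormedSpace ℝ E]
variable {M : Type*} [TopologicalSpace M] [ChartedSpace E M]

/-- Change of variables for products of one-dimensional reparametrizations. -/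
lemma integral_dens_prodMap (σ : SymplecticForm E M) {w v : ℝ × ℝ → M} {f g f' g' : ℝ → ℝ}
    {A B A' B' : Set ℝ} (hA : IsOpen A) (hB : IsOpen B)
    (hf : ∀ x ∈ A, HasDerivAt f (f' x) x) (hg : ∀ x ∈ B, HasDerivAt g (g' x) x)
    (hfi : Set.InjOn f A) (hgi : Set.InjOn g B) (hfA : f '' A = A') (hgB : g '' B = B')
    (hdet : ∀ x ∈ A, ∀ y ∈ B, 0 ≤ f' x * g' y)
    (hw : ∀ z ∈ A' ×ˢ B', MDifferentiableAt 𝓘(ℝ, ℝ × ℝ) 𝓘(ℝ, E) w z)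
    (hv : ∀ z ∈ A ×ˢ B, v z = w (f z.1, g z.2)) :
    ∫ z in A ×ˢ B, dens σ v z = ∫ z in A' ×ˢ B', dens σ w z ∧
      (IntegrableOn (dens σ v) (A ×ˢ B) ↔ IntegrableOn (dens σ w) (A' ×ˢ B')) := by
  refine integral_dens_comp σ (Φ := Prod.map f g)
    (Φ' := fun z => (ContinuousLinearMap.toSpanSingleton ℝ (f' z.1)).prodMap
      (ContinuousLinearMap.toSpanSingleton ℝ (g' z.2))) (hA.prod hB) ?_ ?_ ?_ ?_ hw hv
  · rintro ⟨x, y⟩ hz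
    exact HasFDerivAt.prodMap (x, y) (hf x hz.1).hasFDerivAt (hg y hz.2).hasFDerivAt
  · exact hfi.prodMap hgi
  · rw [Set.prodMap_image_prod, hfA, hgB]
  · rintro ⟨x, y⟩ hz
    rw [det_eq_of_prod]
    simpa using hdet x hz.1 y hz.2

/-- The half-infinite strip `(0, ∞) × [0, 1]`, on which the ends of a quilt are parametrized. -/
def endStrip : Set (ℝ × ℝ) := Set.Ioi 0 ×ˢ Set.Icc 0 1

/-- The interior of `endStrip`. -/
def openEnd : Set (ℝ × ℝ) := Set.Ioi 0 ×ˢ Set.Ioo 0 1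

lemma isOpen_openEnd : IsOpen openEnd := isOpen_Ioi.prod isOpen_Ioo

lemma openEnd_subset : openEnd ⊆ endStrip := Set.prod_mono subset_rfl Set.Ioo_subset_Icc_self

lemma mdifferentiableAt_of_openEnd {w : ℝ × ℝ → M}
    (hw : ContMDiffOn 𝓘(ℝ, ℝ × ℝ) 𝓘(ℝ, E) ∞ w endStrip) {z : ℝ × ℝ} (hz : z ∈ openEnd) :
    MDifferentiableAt 𝓘(ℝ, ℝ × ℝ) 𝓘(ℝ, E) w z :=
  ((hw.mono openEnd_subset).contMDiffAt (isOpen_openEnd.mem_nhds hz)).mdifferentiableAt (by simp)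

/-- The end `w`, reparametrized by `ρ`, followed by the cap `c`. -/
def endCap (w c : ℝ × ℝ → M) (ρ : ℝ → ℝ) (R₁ : ℝ) (z : ℝ × ℝ) : M :=
  if z.1 ≤ R₁ then w (ρ z.1, z.2) else c (z.1 - R₁, z.2)

variable {w c : ℝ × ℝ → M} {ρ : ℝ → ℝ} {R R₁ : ℝ} {p : M}

/-- On `R₁ ≤ r < R₁ + 1/3` the reparametrized end and the cap are both stationary and equal to the
slice at `R`. This overlap of the two formulas is why the glued map is smooth across `r = R₁`. -/
lemma endCap_eq_of_lt (hρ : IsRadialCutoff ρ R R₁)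
    (hc1 : ∀ τ ≤ 1 / 3, ∀ t ∈ Set.Icc (0 : ℝ) 1, c (τ, t) = w (R, t)) {z : ℝ × ℝ}
    (hz : z.1 < R₁ + 1 / 3) (hz2 : z.2 ∈ Set.Icc (0 : ℝ) 1) :
    endCap w c ρ R₁ z = w (ρ z.1, z.2) := by
  unfold endCap
  split_ifs with h
  · rfl
  · rw [hc1 _ (by linarith) _ hz2, hρ.eq_const _ (le_of_not_ge h)]

lemma contMDiffOn_endCap (hρ : IsRadialCutoff ρ R R₁)
    (hw : ContMDiffOn 𝓘(ℝ, ℝ × ℝ) 𝓘(ℝ, E) ∞ w endStrip)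
    (hc : ContMDiffOn 𝓘(ℝ, ℝ × ℝ) 𝓘(ℝ, E) ∞ c (Set.univ ×ˢ Set.Icc 0 1))
    (hc1 : ∀ τ ≤ 1 / 3, ∀ t ∈ Set.Icc (0 : ℝ) 1, c (τ, t) = w (R, t)) :
    ContMDiffOn 𝓘(ℝ, ℝ × ℝ) 𝓘(ℝ, E) ∞ (endCap w c ρ R₁) endStrip := by
  intro z hz
  have h1 : ContMDiffOn 𝓘(ℝ, ℝ × ℝ) 𝓘(ℝ, E) ∞ (fun z : ℝ × ℝ => w (ρ z.1, z.2)) endStrip :=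
    hw.comp (contMDiffOn_iff_contDiffOn.2
      ((hρ.smooth.comp contDiff_fst).prodMk contDiff_snd).contDiffOn)
      fun z hz => ⟨hρ.pos hz.1, hz.2⟩
  have h2 : ContMDiffOn 𝓘(ℝ, ℝ × ℝ) 𝓘(ℝ, E) ∞ (fun z : ℝ × ℝ => c (z.1 - R₁, z.2)) endStrip :=
    hc.comp (contMDiffOn_iff_contDiffOn.2
      ((contDiff_fst.sub contDiff_const).prodMk contDiff_snd).contDiffOn)
      fun z hz => ⟨Set.mem_univ _, hz.2⟩
  by_cases h : z.1 < R₁ + 1 / 3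
  · refine (h1 z hz).congr_of_eventuallyEq ?_ (endCap_eq_of_lt hρ hc1 h hz.2)
    filter_upwards [self_mem_nhdsWithin, mem_nhdsWithin_of_mem_nhds
      (continuous_fst.continuousAt.preimage_mem_nhds (Iio_mem_nhds h))] with y hy hy'
    exact endCap_eq_of_lt hρ hc1 hy' hy.2
  · have hlt : R₁ < z.1 := by linarith
    refine (h2 z hz).congr_of_eventuallyEq ?_ (if_neg (not_le.2 hlt))
    filter_upwards [mem_nhdsWithin_of_mem_nhds
      (continuous_fst.continuousAt.preimage_mem_nhds (Ioi_mem_nhds hlt))] with y hy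
    exact if_neg (not_le.2 hy)

lemma volume_vertical_line (R : ℝ) : volume (({R} : Set ℝ) ×ˢ (Set.univ : Set ℝ)) = 0 := by
  rw [Measure.volume_eq_prod, Measure.prod_prod]
  simp

/-- The cutoff maps `(0, R₁)` bijectively onto `(0, R)`, so slowing down costs no area, and the cap
is a translate. What remains is the null line `r = R₁` and the region `r ≥ R₁ + 1`, where the map is
locally constant. -/
lemma integral_dens_endCap (σ : SymplecticForm E M) (hρ : IsRadialCutoff ρ R R₁)
    (hw : ContMDiffOn 𝓘(ℝ, ℝ × ℝ) 𝓘(ℝ, E) ∞ w endStrip) (hwi : IntegrableOn (dens σ w) openEnd)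
    (hc : ContMDiffOn 𝓘(ℝ, ℝ × ℝ) 𝓘(ℝ, E) ∞ c (Set.univ ×ˢ Set.Icc 0 1))
    (hc2 : ∀ τ, 2 / 3 ≤ τ → ∀ t, c (τ, t) = p)
    (hci : IntegrableOn (dens σ c) (Set.Ioo 0 1 ×ˢ Set.Ioo 0 1)) :
    IntegrableOn (dens σ (endCap w c ρ R₁)) openEnd ∧
      ∫ z in openEnd, dens σ (endCap w c ρ R₁) z =
        (∫ z in Set.Ioo 0 R ×ˢ Set.Ioo 0 1, dens σ w z) +
        ∫ z in Set.Ioo (0 : ℝ) 1 ×ˢ Set.Ioo (0 : ℝ) 1, dens σ c z := by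
  set V := endCap w c ρ R₁ with hV
  have hR₁ := hρ.one_lt
  have hsubR : (Set.Ioo 0 R ×ˢ Set.Ioo 0 1 : Set (ℝ × ℝ)) ⊆ openEnd :=
    Set.prod_mono (fun x hx => hx.1) subset_rfl
  obtain ⟨eA, iA⟩ := integral_dens_prodMap σ (w := w) (v := V) (f := ρ) (g := id) (f' := deriv ρ)
    (g' := fun _ => 1) (A := Set.Ioo 0 R₁) (B := Set.Ioo 0 1) isOpen_Ioo isOpen_Ioo
    (fun x _ => (hρ.smooth.differentiable (by simp) x).hasDerivAt) (fun x _ => hasDerivAt_id x)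
    (hρ.strictMono.injOn.mono fun x hx => hx.2.le) (Set.injOn_id _) hρ.image_Ioo
    (Set.image_id _) (fun x _ y _ => by simpa using hρ.deriv_nonneg x)
    (fun z hz => mdifferentiableAt_of_openEnd hw (hsubR hz))
    (fun z hz => if_pos hz.1.2.le)
  have hcopen : IsOpen (Set.univ ×ˢ Set.Ioo (0 : ℝ) 1 : Set (ℝ × ℝ)) := isOpen_univ.prod isOpen_Ioo
  obtain ⟨eB, iB⟩ := integral_dens_prodMap σ (w := c) (v := V) (f := fun x => x - R₁) (g := id)
    (f' := fun _ => 1) (g' := fun _ => 1) (A := Set.Ioo R₁ (R₁ + 1)) (B := Set.Ioo 0 1)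
    (A' := Set.Ioo 0 1) isOpen_Ioo isOpen_Ioo
    (fun x _ => (hasDerivAt_id x).sub_const R₁) (fun x _ => hasDerivAt_id x)
    (sub_left_injective.injOn) (Set.injOn_id _) (by simp)
    (Set.image_id _) (fun x _ y _ => by simp)
    (fun z hz => ((hc.mono (Set.prod_mono subset_rfl Set.Ioo_subset_Icc_self)).contMDiffAt
      (hcopen.mem_nhds ⟨Set.mem_univ _, hz.2⟩)).mdifferentiableAt (by simp))
    (fun z hz => if_neg (not_le.2 hz.1.1))
  have iA' := iA.2 (hwi.mono_set hsubR)
  have iB' := iB.2 hci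
  have hdisj : Disjoint (Set.Ioo 0 R₁ ×ˢ Set.Ioo 0 1 : Set (ℝ × ℝ))
      (Set.Ioo R₁ (R₁ + 1) ×ˢ Set.Ioo 0 1) := by
    rw [Set.disjoint_left]
    intro z hz hz'
    exact lt_asymm hz.1.2 hz'.1.1
  have hsub : (Set.Ioo 0 R₁ ×ˢ Set.Ioo 0 1 ∪ Set.Ioo R₁ (R₁ + 1) ×ˢ Set.Ioo 0 1 :
      Set (ℝ × ℝ)) ⊆ openEnd :=
    Set.union_subset (Set.prod_mono (fun x hx => hx.1) subset_rfl)
      (Set.prod_mono (fun x hx => by have := hx.1; simp only [Set.mem_Ioi]; linarith) subset_rfl)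
  have hzero : ∀ᵐ z : ℝ × ℝ, z ∈ openEnd \ (Set.Ioo 0 R₁ ×ˢ Set.Ioo 0 1 ∪
      Set.Ioo R₁ (R₁ + 1) ×ˢ Set.Ioo 0 1) → dens σ V z = 0 := by
    have hline : ∀ᵐ z : ℝ × ℝ, z ∉ ({R₁} : Set ℝ) ×ˢ (Set.univ : Set ℝ) :=
      measure_eq_zero_iff_ae_notMem.1 (volume_vertical_line R₁)
    filter_upwards [hline] with z hz hz'
    have h1 : z.1 ≠ R₁ := fun h => hz ⟨h, Set.mem_univ _⟩
    obtain ⟨⟨h0, ht⟩, hn⟩ := hz'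
    have h2 : R₁ + 1 ≤ z.1 := by
      by_contra! hlt
      rcases lt_or_gt_of_ne h1 with h | h
      · exact hn (Or.inl ⟨⟨h0, h⟩, ht⟩)
      · exact hn (Or.inr ⟨⟨h, hlt⟩, ht⟩)
    apply dens_const σ (p := p)
    have h3 : R₁ + 2 / 3 < z.1 := by linarith
    filter_upwards [continuous_fst.continuousAt.preimage_mem_nhds (Ioi_mem_nhds h3)] with y hy
    have hy' : R₁ + 2 / 3 < y.1 := hy
    rw [hV, endCap, if_neg (by linarith), hc2 _ (by linarith)]
  have hm : NullMeasurableSet openEnd := isOpen_openEnd.measurableSet.nullMeasurableSet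
  refine ⟨(iA'.union iB').of_ae_sdiff_eq_zero hm hzero, ?_⟩
  rw [setIntegral_eq_of_subset_of_ae_sdiff_eq_zero hm hsub hzero,
    setIntegral_union hdisj (measurableSet_Ioo.prod measurableSet_Ioo) iA' iB', eA, eB]

end EndCap

/-! ### Choosing radii from finite energy -/

section Radii

lemma restrict_openEnd : (volume : Measure (ℝ × ℝ)).restrict openEnd =
    (volume.restrict (Set.Ioi (0 : ℝ))).prod (volume.restrict (Set.Ioo (0 : ℝ) 1)) := by
  rw [Measure.prod_restrict, ← Measure.volume_eq_prod]
  rfl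

/-- Logarithmically small slices of an integrable function. -/
lemma exists_small_slice {F : ℝ × ℝ → ℝ} (hF : IntegrableOn F openEnd) (N : ℝ) {δ : ℝ}
    (hδ : 0 < δ) : ∃ r ≥ N, IntegrableOn (fun t => F (r, t)) (Set.Ioo 0 1) ∧
      r * ∫ t in Set.Ioo 0 1, F (r, t) < δ := by
  -- Otherwise the slice integral is at least `δ / r` for almost every large `r`, and `1/r` would be
  -- integrable at infinity.
  by_contra! hcon
  unfold IntegrableOn at hF
  rw [restrict_openEnd] at hF
  have h1 := hF.integral_prod_left
  have h2 := hF.prod_right_ae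
  set N' := max N 1 with hN'
  have hsub : Set.Ioi N' ⊆ Set.Ioi (0 : ℝ) := fun x hx =>
    lt_trans (by positivity) (Set.mem_Ioi.1 hx)
  have h1' : IntegrableOn (fun r => ∫ t in Set.Ioo (0 : ℝ) 1, F (r, t)) (Set.Ioi N') :=
    IntegrableOn.mono_set h1 hsub
  refine not_integrableOn_Ioi_inv (a := N') ?_
  refine Integrable.mono' (h1'.div_const δ) measurable_inv.aestronglyMeasurable ?_
  have h2' := ae_restrict_of_ae_restrict_of_subset hsub h2
  filter_upwards [h2', ae_restrict_mem measurableSet_Ioi] with r hr hrN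
  have hrN' : N' < r := hrN
  have hr0 : 0 < r := hsub hrN
  have := hcon r ((le_max_left _ _).trans hrN'.le) hr
  rw [Real.norm_of_nonneg (by positivity), inv_eq_one_div, div_le_div_iff₀ hr0 hδ]
  linarith

lemma exists_tail_bound {F : ℝ × ℝ → ℝ} (hF : IntegrableOn F openEnd) {ε : ℝ} (hε : 0 < ε) :
    ∃ N, ∀ R ≥ N, |(∫ z in Set.Ioo 0 R ×ˢ Set.Ioo 0 1, F z) - ∫ z in openEnd, F z| ≤ ε := by
  have hU : ⋃ R : ℝ, (Set.Ioo 0 R ×ˢ Set.Ioo 0 1 : Set (ℝ × ℝ)) = openEnd := by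
    ext z
    simp only [Set.mem_iUnion, Set.mem_prod, openEnd, Set.mem_Ioi]
    constructor
    · rintro ⟨R, hR⟩
      exact ⟨hR.1.1, hR.2⟩
    · intro h
      exact ⟨z.1 + 1, ⟨h.1, by linarith⟩, h.2⟩
  have ht := tendsto_setIntegral_of_monotone (μ := volume) (f := F)
    (s := fun R : ℝ => (Set.Ioo 0 R ×ˢ Set.Ioo 0 1 : Set (ℝ × ℝ)))
    (fun R => measurableSet_Ioo.prod measurableSet_Ioo)
    (fun R R' h => Set.prod_mono (Set.Ioo_subset_Ioo_right h) subset_rfl) (hU ▸ hF)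
  rw [hU] at ht
  obtain ⟨N, hN⟩ := (Metric.tendsto_atTop.1 ht) ε hε
  exact ⟨N, fun R hR => (Real.dist_eq _ _ ▸ hN R hR).le⟩

end Radii

/-! ### Ends, their slices and their capping -/

section Ends

variable {E : Type*} [NormedAddCommGroup E] [NormedSpace ℝ E]
variable {M : Type*} [TopologicalSpace M] [ChartedSpace E M]

/-- A short arc near `p`. -/
structure IsSmallArc (p : M) (δ : ℝ) (γ : ℝ → M) : Prop where
  mem : ∀ t ∈ Set.Icc 0 1, γ t ∈ chartBall (E := E) p δ
  integrable : IntegrableOn (fun t => ‖deriv (extChartAt 𝓘(ℝ, E) p ∘ γ) t‖) (Set.Ioo 0 1)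
  length_le : ∫ t in Set.Ioo 0 1, ‖deriv (extChartAt 𝓘(ℝ, E) p ∘ γ) t‖ ≤ δ

lemma IsSmallArc.mono {p : M} {δ δ' : ℝ} {γ : ℝ → M} (h : IsSmallArc (E := E) p δ γ)
    (hδ : δ ≤ δ') : IsSmallArc (E := E) p δ' γ :=
  ⟨fun t ht => chartBall_mono p hδ (h.mem t ht), h.integrable, h.length_le.trans hδ⟩

lemma IsCornerPath.mono {p x : M} {δ δ' : ℝ} {a : ℝ → M} (h : IsCornerPath (E := E) p δ x a)
    (hδ : δ ≤ δ') : IsCornerPath (E := E) p δ' x a :=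
  ⟨h.smooth, h.left, h.right, fun t => chartBall_mono p hδ (h.mem t),
    fun t => (h.deriv_le t).trans hδ⟩

/-- `V` agrees with the end `w` near `r = 0`, is constant for large `r`, and has almost the same
symplectic area. -/
structure IsCapped (σ : SymplecticForm E M) (w V : ℝ × ℝ → M) (p : M) (ε K : ℝ) : Prop where
  smooth : ContMDiffOn 𝓘(ℝ, ℝ × ℝ) 𝓘(ℝ, E) ∞ V endStrip
  eq_left : ∀ z : ℝ × ℝ, z.1 ≤ 1 → V z = w z
  eq_right : ∀ z : ℝ × ℝ, K ≤ z.1 → V z = p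
  integrable : IntegrableOn (dens σ V) openEnd
  area_le : |(∫ z in openEnd, dens σ V z) - ∫ z in openEnd, dens σ w z| ≤ ε

variable [IsManifold 𝓘(ℝ, E) ∞ M]

/-- One `ε` pays for the discarded tail and one for the cap. The boundary values are recorded
explicitly so that neighbouring ends, capped with the same `ρ`, `R₁` and a common corner path in the
Lagrangian, satisfy the seam conditions. -/
lemma exists_isCapped (σ : SymplecticForm E M) (p : M) {ε : ℝ} (hε : 0 < ε) :
    ∃ δ > 0, ∀ (w : ℝ × ℝ → M) (a b : ℝ → M) (ρ : ℝ → ℝ) (R R₁ : ℝ), 0 < R → IsRadialCutoff ρ R R₁ →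
      ContMDiffOn 𝓘(ℝ, ℝ × ℝ) 𝓘(ℝ, E) ∞ w endStrip → IntegrableOn (dens σ w) openEnd →
      |(∫ z in Set.Ioo 0 R ×ˢ Set.Ioo 0 1, dens σ w z) - ∫ z in openEnd, dens σ w z| ≤ ε →
      IsSmallArc (E := E) p δ (fun t => w (R, t)) →
      IsCornerPath (E := E) p δ (w (R, 0)) a → IsCornerPath (E := E) p δ (w (R, 1)) b →
      ∃ V, IsCapped σ w V p (2 * ε) (R₁ + 1) ∧
        (∀ r, V (r, 0) = if r ≤ R₁ then w (ρ r, 0) else a (r - R₁)) ∧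
        (∀ r, V (r, 1) = if r ≤ R₁ then w (ρ r, 1) else b (r - R₁)) := by
  obtain ⟨δ, hδ, hcap⟩ := exists_cap σ p hε
  refine ⟨δ, hδ, fun w a b ρ R R₁ hR hρ hw hwi htail hγ ha hb => ?_⟩
  have hγs : ContMDiffOn 𝓘(ℝ, ℝ) 𝓘(ℝ, E) ∞ (fun t => w (R, t)) (Set.Icc 0 1) :=
    hw.comp (contMDiffOn_iff_contDiffOn.2 (contDiff_const.prodMk contDiff_id).contDiffOn)
      fun t ht => ⟨hR, ht⟩
  obtain ⟨c, hc, hc1, hc2, hca, hcb, hci, hcε⟩ :=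
    hcap _ a b hγs hγ.mem hγ.integrable hγ.length_le ha hb
  obtain ⟨hVi, hVe⟩ := integral_dens_endCap σ hρ hw hwi hc hc2 hci
  refine ⟨endCap w c ρ R₁, ⟨contMDiffOn_endCap hρ hw hc hc1, fun z hz => ?_, fun z hz => ?_, hVi,
    ?_⟩, fun r => ?_, fun r => ?_⟩
  · rw [endCap, if_pos (hz.trans hρ.one_lt.le), hρ.eq_self _ hz]
  · rw [endCap, if_neg (by linarith), hc2 _ (by linarith)]
  · rw [hVe]
    rw [abs_le] at *
    constructor <;> linarith [htail.1, htail.2, hcε.1, hcε.2]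
  · simp only [endCap, hca]
  · simp only [endCap, hcb]

/-- An end of a quilt: a map of finite energy on `(0, ∞) × [0, 1]` whose slices have small energy
where its density is small. -/
structure IsEnd {σ : SymplecticForm E M} {k : ℕ∞} (J : CompatibleJ σ k) (w : ℝ × ℝ → M) :
    Prop where
  smooth : ContMDiffOn 𝓘(ℝ, ℝ × ℝ) 𝓘(ℝ, E) ∞ w endStrip
  integrable : IntegrableOn (dens σ w) openEnd
  normSq_le : ∀ z ∈ openEnd, 1 ≤ z.1 →
    J.normSq (w z) (der (E := E) w z (0, 1)) ≤ 4 * z.1 * dens σ w z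

variable {σ : SymplecticForm E M} {k : ℕ∞} {J : CompatibleJ σ k} {w : ℝ × ℝ → M} {p : M}
  {f : Filter ℕ} {r : ℕ → ℝ} {h : ℕ → ℝ → ℝ}

/-- The inequality `normSq_le` bounds the squared speed of the slice by `h n`, whose integral tends
to `0`. Convergence of the end point at `t = 0` then suffices, by `exists_short_arc`. -/
lemma IsEnd.eventually_isSmallArc [T2Space M] [FiniteDimensional ℝ E] (hw : IsEnd J w)
    (hr : ∀ n, 1 ≤ r n) (hi : ∀ n, IntegrableOn (h n) (Set.Ioo 0 1))
    (hle : ∀ n, ∀ t, 4 * r n * dens σ w (r n, t) ≤ h n t)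
    (hh : Filter.Tendsto (fun n => ∫ t in Set.Ioo 0 1, h n t) f (𝓝 0))
    (hp : Filter.Tendsto (fun n => w (r n, 0)) f (𝓝 p)) {δ : ℝ} (hδ : 0 < δ) :
    ∀ᶠ n in f, IsSmallArc (E := E) p δ (fun t => w (r n, t)) := by
  obtain ⟨U, hU, η, hη, key⟩ := exists_short_arc J p hδ
  filter_upwards [hp hU, hh.eventually_lt_const hη] with n hn hn'
  have hr0 : 0 < r n := zero_lt_one.trans_le (hr n)
  have hγs : ContMDiffOn 𝓘(ℝ, ℝ) 𝓘(ℝ, E) ∞ (fun t => w (r n, t)) (Set.Icc 0 1) :=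
    hw.smooth.comp (contMDiffOn_iff_contDiffOn.2 (contDiff_const.prodMk contDiff_id).contDiffOn)
      fun t ht => ⟨hr0, ht⟩
  have hspeed : ∀ t ∈ Set.Ioo (0 : ℝ) 1,
      J.normSq (w (r n, t)) (der (E := E) (fun t => w (r n, t)) t 1) ≤ h n t := by
    intro t ht
    have hz : (r n, t) ∈ openEnd := ⟨hr0, ht⟩
    have e : der (E := E) (fun t => w (r n, t)) t 1 = der (E := E) w (r n, t) (0, 1) := by
      have h0 := der_comp (E := E) (w := w) (Φ := fun t : ℝ => (r n, t)) (z := t)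
        (mdifferentiableAt_of_openEnd hw.smooth hz)
        ((hasDerivAt_const t (r n)).prodMk (hasDerivAt_id' t)).hasFDerivAt
      have h1 : (fun t => w (r n, t)) = w ∘ fun t => (r n, t) := rfl
      rw [h1, h0]
      simp
    rw [e]
    exact (hw.normSq_le _ hz (hr n)).trans (hle n t)
  obtain ⟨h1, h2, h3⟩ := key _ (h n) hγs hn (hi n) hspeed hn'
  exact ⟨h1, h2, h3⟩

/-- Chart balls form a neighbourhood basis. At `t = 1` this carries the limit of a slice from one
seam across to the other. -/
lemma tendsto_of_isSmallArc {γ : ℕ → ℝ → M}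
    (h : ∀ δ > 0, ∀ᶠ n in f, IsSmallArc (E := E) p δ (γ n)) {t : ℝ} (ht : t ∈ Set.Icc (0 : ℝ) 1) :
    Filter.Tendsto (fun n => γ n t) f (𝓝 p) := by
  intro U hU
  obtain ⟨δ, hδ, hb⟩ := exists_chartBall_subset (E := E) p hU
  show ∀ᶠ n in f, γ n t ∈ U
  filter_upwards [h δ hδ] with n hn
  exact hb (hn.mem t ht)

end Ends

/-! ### Capping the four ends simultaneously -/

section Quilt

variable {E₀ : Type*} [NormedAddCommGroup E₀] [NormedSpace ℝ E₀] [FiniteDimensional ℝ E₀]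
  {E₁ : Type*} [NormedAddCommGroup E₁] [NormedSpace ℝ E₁] [FiniteDimensional ℝ E₁]
  {E₂ : Type*} [NormedAddCommGroup E₂] [NormedSpace ℝ E₂] [FiniteDimensional ℝ E₂]
  {M₀ : Type*} [TopologicalSpace M₀] [T2Space M₀] [ChartedSpace E₀ M₀] [IsManifold 𝓘(ℝ, E₀) ∞ M₀]
  {M₁ : Type*} [TopologicalSpace M₁] [T2Space M₁] [ChartedSpace E₁ M₁] [IsManifold 𝓘(ℝ, E₁) ∞ M₁]
  {M₂ : Type*} [TopologicalSpace M₂] [T2Space M₂] [ChartedSpace E₂ M₂] [IsManifold 𝓘(ℝ, E₂) ∞ M₂]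
  {σ₀ : SymplecticForm E₀ M₀} {σ₁ : SymplecticForm E₁ M₁} {σ₂ : SymplecticForm E₂ M₂} {k : ℕ∞}
  {J₀ : CompatibleJ σ₀ k} {J₁ : CompatibleJ σ₁ k} {J₂ : CompatibleJ σ₂ k}
  {L₀₁ : Set (M₀ × M₁)} {L₁₂ : Set (M₁ × M₂)}
  {w₀ : ℝ × ℝ → M₀} {w₁ w₁' : ℝ × ℝ → M₁} {w₂ : ℝ × ℝ → M₂}

/-- Radii along which the slices of the four ends have small energy. -/
lemma exists_radii (h₀ : IsEnd J₀ w₀) (h₁ : IsEnd J₁ w₁) (h₁' : IsEnd J₁ w₁') (h₂ : IsEnd J₂ w₂) :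
    ∃ (r : ℕ → ℝ) (h : ℕ → ℝ → ℝ), (∀ n, 2 ≤ r n) ∧ Filter.Tendsto r Filter.atTop Filter.atTop ∧
      (∀ n, IntegrableOn (h n) (Set.Ioo 0 1)) ∧
      Filter.Tendsto (fun n => ∫ t in Set.Ioo 0 1, h n t) Filter.atTop (𝓝 0) ∧
      ∀ n t, 4 * r n * dens σ₀ w₀ (r n, t) ≤ h n t ∧ 4 * r n * dens σ₁ w₁ (r n, t) ≤ h n t ∧
        4 * r n * dens σ₁ w₁' (r n, t) ≤ h n t ∧ 4 * r n * dens σ₂ w₂ (r n, t) ≤ h n t := by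
  -- Summing the absolute densities makes one radius serve all four ends, so that all are cut at the
  -- same place on the seams.
  set F : ℝ × ℝ → ℝ := fun z =>
    |dens σ₀ w₀ z| + |dens σ₁ w₁ z| + |dens σ₁ w₁' z| + |dens σ₂ w₂ z| with hF
  have hFi : IntegrableOn F openEnd :=
    ((h₀.integrable.abs.add h₁.integrable.abs).add h₁'.integrable.abs).add h₂.integrable.abs
  have hF0 : ∀ z, 0 ≤ F z := fun z => by positivity
  -- The lower bound `n + 2` gives both `r n → ∞` and `2 ≤ r n`, as required by
  -- `exists_isRadialCutoff`.
  choose r hr hri hrs using fun n : ℕ => exists_small_slice hFi (n + 2)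
    (show (0 : ℝ) < 1 / ((n : ℝ) + 1) by positivity)
  have hr2 : ∀ n, 2 ≤ r n := fun n => by
    have := hr n
    have h0 : (0 : ℝ) ≤ n := Nat.cast_nonneg n
    linarith
  refine ⟨r, fun n t => 4 * r n * F (r n, t), hr2, ?_, fun n => (hri n).const_mul _, ?_,
    fun n t => ?_⟩
  · exact Filter.tendsto_atTop_mono (fun n => by linarith [hr n]) tendsto_natCast_atTop_atTop
  · have hlim : Filter.Tendsto (fun n : ℕ => 4 * (1 / ((n : ℝ) + 1))) Filter.atTop (𝓝 (4 * 0)) :=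
      tendsto_one_div_add_atTop_nhds_zero_nat.const_mul 4
    rw [mul_zero] at hlim
    refine squeeze_zero (fun n => integral_nonneg fun t => ?_) (fun n => ?_) hlim
    · have := hr2 n
      have := hF0 (r n, t)
      positivity
    · rw [integral_const_mul, mul_assoc]
      exact mul_le_mul_of_nonneg_left (hrs n).le (by norm_num)
  · have hpos : 0 ≤ 4 * r n := by linarith [hr2 n]
    refine ⟨?_, ?_, ?_, ?_⟩ <;>
    · refine mul_le_mul_of_nonneg_left ?_ hpos
      simp only [hF]
      have a0 := abs_nonneg (dens σ₀ w₀ (r n, t))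
      have a1 := abs_nonneg (dens σ₁ w₁ (r n, t))
      have a2 := abs_nonneg (dens σ₁ w₁' (r n, t))
      have a3 := abs_nonneg (dens σ₂ w₂ (r n, t))
      have b0 := le_abs_self (dens σ₀ w₀ (r n, t))
      have b1 := le_abs_self (dens σ₁ w₁ (r n, t))
      have b2 := le_abs_self (dens σ₁ w₁' (r n, t))
      have b3 := le_abs_self (dens σ₂ w₂ (r n, t))
      linarith

/-- A sequence in a compact set converges along an ultrafilter. -/
lemma _root_.IsCompact.exists_tendsto_ultrafilter {X : Type*} [TopologicalSpace X] {s : Set X}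
    (hs : IsCompact s) (f : Ultrafilter ℕ) {x : ℕ → X} (hx : ∀ n, x n ∈ s) :
    ∃ a ∈ s, Filter.Tendsto x f (𝓝 a) :=
  hs.ultrafilter_le_nhds (f.map x) (by
    rw [Filter.le_principal_iff, Ultrafilter.mem_coe, Ultrafilter.mem_map]
    exact Filter.univ_mem' hx)

/-- The ends of a quilt of finite energy with compact Lagrangian seam conditions can be capped
off at the cost of a small change of the symplectic area. -/
theorem exists_capped_quilt
    (h₀₁ : IsCompactLagrangianCorrespondence σ₀ σ₁ L₀₁)
    (h₁₂ : IsCompactLagrangianCorrespondence σ₁ σ₂ L₁₂)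
    (h₀ : IsEnd J₀ w₀) (h₁ : IsEnd J₁ w₁) (h₁' : IsEnd J₁ w₁') (h₂ : IsEnd J₂ w₂)
    (s₀₁ : ∀ r > 0, (w₀ (r, 1), w₁ (r, 0)) ∈ L₀₁) (s₁₂ : ∀ r > 0, (w₁ (r, 1), w₂ (r, 0)) ∈ L₁₂)
    (s₁₂' : ∀ r > 0, (w₁' (r, 0), w₂ (r, 1)) ∈ L₁₂)
    (s₀₁' : ∀ r > 0, (w₀ (r, 0), w₁' (r, 1)) ∈ L₀₁) {ε : ℝ} (hε : 0 < ε) :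
    ∃ (V₀ : ℝ × ℝ → M₀) (V₁ V₁' : ℝ × ℝ → M₁) (V₂ : ℝ × ℝ → M₂) (p₀ : M₀) (p₁ p₁' : M₁)
      (p₂ : M₂) (K : ℝ),
      IsCapped σ₀ w₀ V₀ p₀ ε K ∧ IsCapped σ₁ w₁ V₁ p₁ ε K ∧ IsCapped σ₁ w₁' V₁' p₁' ε K ∧
      IsCapped σ₂ w₂ V₂ p₂ ε K ∧
      (∀ r > 0, (V₀ (r, 1), V₁ (r, 0)) ∈ L₀₁) ∧ (∀ r > 0, (V₁ (r, 1), V₂ (r, 0)) ∈ L₁₂) ∧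
      (∀ r > 0, (V₁' (r, 0), V₂ (r, 1)) ∈ L₁₂) ∧ (∀ r > 0, (V₀ (r, 0), V₁' (r, 1)) ∈ L₀₁) ∧
      (p₀, p₁) ∈ L₀₁ ∧ (p₁, p₂) ∈ L₁₂ ∧ (p₁', p₂) ∈ L₁₂ ∧ (p₀, p₁') ∈ L₀₁ := by
  obtain ⟨r, h, hr2, hrt, hi, hh, hle⟩ := exists_radii h₀ h₁ h₁' h₂
  -- Along a free ultrafilter every sequence in a compact set converges, so no successive
  -- subsequences are needed.
  set f : Ultrafilter ℕ := Filter.hyperfilter ℕ with hf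
  have hfT : (f : Filter ℕ) ≤ Filter.atTop := by
    rw [← Nat.cofinite_eq_atTop]
    exact Filter.hyperfilter_le_cofinite
  have hr0 : ∀ n, 0 < r n := fun n => by linarith [hr2 n]
  have hr1 : ∀ n, 1 ≤ r n := fun n => by linarith [hr2 n]
  have hhf := hh.mono_left hfT
  obtain ⟨⟨p₀, p₁⟩, hL₁, t₁⟩ := h₀₁.isCompact.exists_tendsto_ultrafilter f
    (fun n => s₀₁ (r n) (hr0 n))
  obtain ⟨⟨q₁, p₂⟩, hL₂, t₂⟩ := h₁₂.isCompact.exists_tendsto_ultrafilter f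
    (fun n => s₁₂ (r n) (hr0 n))
  obtain ⟨⟨p₁', q₂⟩, hL₃, t₃⟩ := h₁₂.isCompact.exists_tendsto_ultrafilter f
    (fun n => s₁₂' (r n) (hr0 n))
  obtain ⟨⟨q₀, q₁'⟩, hL₄, t₄⟩ := h₀₁.isCompact.exists_tendsto_ultrafilter f
    (fun n => s₀₁' (r n) (hr0 n))
  have a₁ := fun δ (hδ : (0 : ℝ) < δ) => h₁.eventually_isSmallArc hr1 hi (fun n t => (hle n t).2.1)
    hhf t₁.snd_nhds hδ
  have a₂ := fun δ (hδ : (0 : ℝ) < δ) => h₂.eventually_isSmallArc hr1 hi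
    (fun n t => (hle n t).2.2.2) hhf t₂.snd_nhds hδ
  have a₃ := fun δ (hδ : (0 : ℝ) < δ) => h₁'.eventually_isSmallArc hr1 hi
    (fun n t => (hle n t).2.2.1) hhf t₃.fst_nhds hδ
  have a₄ := fun δ (hδ : (0 : ℝ) < δ) => h₀.eventually_isSmallArc hr1 hi (fun n t => (hle n t).1)
    hhf t₄.fst_nhds hδ
  have one_mem : (1 : ℝ) ∈ Set.Icc (0 : ℝ) 1 := by simp
  -- Each slice shrinks to a point, so the limits of its two end points, which come from different
  -- seams, coincide. Going once around the four slices leaves `p₀`, `p₂` and one limit for each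
  -- strip end.
  obtain rfl : q₁ = p₁ := tendsto_nhds_unique t₂.fst_nhds (tendsto_of_isSmallArc a₁ one_mem)
  obtain rfl : q₂ = p₂ := tendsto_nhds_unique t₃.snd_nhds (tendsto_of_isSmallArc a₂ one_mem)
  obtain rfl : q₁' = p₁' := tendsto_nhds_unique t₄.snd_nhds (tendsto_of_isSmallArc a₃ one_mem)
  obtain rfl : p₀ = q₀ := tendsto_nhds_unique t₁.fst_nhds (tendsto_of_isSmallArc a₄ one_mem)
  obtain ⟨δ₀, hδ₀, c₀⟩ := exists_isCapped σ₀ p₀ (half_pos hε)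
  obtain ⟨δ₁, hδ₁, c₁⟩ := exists_isCapped σ₁ q₁ (half_pos hε)
  obtain ⟨δ₁', hδ₁', c₁'⟩ := exists_isCapped σ₁ q₁' (half_pos hε)
  obtain ⟨δ₂, hδ₂, c₂⟩ := exists_isCapped σ₂ q₂ (half_pos hε)
  set δ := min (min δ₀ δ₁) (min δ₁' δ₂) with hδdef
  have hδ : 0 < δ := by positivity
  have d₀ : δ ≤ δ₀ := (min_le_left _ _).trans (min_le_left _ _)
  have d₁ : δ ≤ δ₁ := (min_le_left _ _).trans (min_le_right _ _)
  have d₁' : δ ≤ δ₁' := (min_le_right _ _).trans (min_le_left _ _)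
  have d₂ : δ ≤ δ₂ := (min_le_right _ _).trans (min_le_right _ _)
  obtain ⟨U₁, hU₁, k₁⟩ := exists_cornerPaths h₀₁.isLagrangian hL₁ hδ
  obtain ⟨U₂, hU₂, k₂⟩ := exists_cornerPaths h₁₂.isLagrangian hL₂ hδ
  obtain ⟨U₃, hU₃, k₃⟩ := exists_cornerPaths h₁₂.isLagrangian hL₃ hδ
  obtain ⟨U₄, hU₄, k₄⟩ := exists_cornerPaths h₀₁.isLagrangian hL₄ hδ
  obtain ⟨N₀, n₀⟩ := exists_tail_bound h₀.integrable (half_pos hε)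
  obtain ⟨N₁, n₁⟩ := exists_tail_bound h₁.integrable (half_pos hε)
  obtain ⟨N₁', n₁'⟩ := exists_tail_bound h₁'.integrable (half_pos hε)
  obtain ⟨N₂, n₂⟩ := exists_tail_bound h₂.integrable (half_pos hε)
  have hrf := hrt.mono_left hfT
  -- One index at which all tails are small, all corners are close to their limits and all slices
  -- are short.
  obtain ⟨n, ⟨e₀, e₁, e₁', e₂⟩, ⟨m₁, m₂, m₃, m₄⟩, b₀, b₁, b₁', b₂⟩ :=
    (((hrf.eventually_ge_atTop N₀).and ((hrf.eventually_ge_atTop N₁).and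
      ((hrf.eventually_ge_atTop N₁').and (hrf.eventually_ge_atTop N₂)))).and
    (((t₁.eventually_mem hU₁).and ((t₂.eventually_mem hU₂).and
      ((t₃.eventually_mem hU₃).and (t₄.eventually_mem hU₄)))).and
    ((a₄ δ hδ).and ((a₁ δ hδ).and ((a₃ δ hδ).and (a₂ δ hδ)))))).exists
  obtain ⟨α₁, β₁, l₁, hα₁, hβ₁⟩ := k₁ _ m₁ (s₀₁ (r n) (hr0 n))
  obtain ⟨α₂, β₂, l₂, hα₂, hβ₂⟩ := k₂ _ m₂ (s₁₂ (r n) (hr0 n))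
  obtain ⟨α₃, β₃, l₃, hα₃, hβ₃⟩ := k₃ _ m₃ (s₁₂' (r n) (hr0 n))
  obtain ⟨α₄, β₄, l₄, hα₄, hβ₄⟩ := k₄ _ m₄ (s₀₁' (r n) (hr0 n))
  obtain ⟨ρ, R₁, hρ⟩ := exists_isRadialCutoff (hr2 n)
  -- Each of the four corner paths in a Lagrangian has one component for either adjacent end, and
  -- all ends share `ρ` and `R₁`. The caps therefore meet along the seams.
  obtain ⟨V₀, hV₀, v₀, v₀'⟩ := c₀ w₀ α₄ α₁ ρ (r n) R₁ (hr0 n) hρ h₀.smooth h₀.integrable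
    (n₀ _ e₀) (b₀.mono d₀) (hα₄.mono d₀) (hα₁.mono d₀)
  obtain ⟨V₁, hV₁, v₁, v₁'⟩ := c₁ w₁ β₁ α₂ ρ (r n) R₁ (hr0 n) hρ h₁.smooth h₁.integrable
    (n₁ _ e₁) (b₁.mono d₁) (hβ₁.mono d₁) (hα₂.mono d₁)
  obtain ⟨V₁', hV₁', u₁, u₁'⟩ := c₁' w₁' α₃ β₄ ρ (r n) R₁ (hr0 n) hρ h₁'.smooth h₁'.integrable
    (n₁' _ e₁') (b₁'.mono d₁') (hα₃.mono d₁') (hβ₄.mono d₁')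
  obtain ⟨V₂, hV₂, v₂, v₂'⟩ := c₂ w₂ β₂ β₃ ρ (r n) R₁ (hr0 n) hρ h₂.smooth h₂.integrable
    (n₂ _ e₂) (b₂.mono d₂) (hβ₂.mono d₂) (hβ₃.mono d₂)
  rw [mul_div_cancel₀ _ (two_ne_zero' ℝ)] at hV₀ hV₁ hV₁' hV₂
  refine ⟨V₀, V₁, V₁', V₂, p₀, q₁, q₁', q₂, R₁ + 1, hV₀, hV₁, hV₁', hV₂, fun s hs => ?_,
    fun s hs => ?_, fun s hs => ?_, fun s hs => ?_, hL₁, hL₂, hL₃, hL₄⟩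
  · rw [v₀', v₁]
    split_ifs
    · exact s₀₁ _ (hρ.pos hs)
    · exact l₁ _
  · rw [v₁', v₂]
    split_ifs
    · exact s₁₂ _ (hρ.pos hs)
    · exact l₂ _
  · rw [u₁, v₂']
    split_ifs
    · exact s₁₂' _ (hρ.pos hs)
    · exact l₃ _
  · rw [v₀, u₁']
    split_ifs
    · exact s₀₁' _ (hρ.pos hs)
    · exact l₄ _

end Quilt

/-! ### Half planes in polar coordinates -/

section Polar

/-- The derivative of a map of the plane is determined by the partial derivatives. -/
lemma fderiv_eq_partial {F : Type*} [NormedAddCommGroup F] [NormedSpace ℝ F] {Φ : ℝ × ℝ → F}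
    {z : ℝ × ℝ} {a b : F} (h : DifferentiableAt ℝ Φ z)
    (h1 : HasDerivAt (fun s => Φ (s, z.2)) a z.1) (h2 : HasDerivAt (fun t => Φ (z.1, t)) b z.2) :
    fderiv ℝ Φ z (1, 0) = a ∧ fderiv ℝ Φ z (0, 1) = b := by
  have e1 : HasDerivAt (fun s => Φ (s, z.2)) (fderiv ℝ Φ z (1, 0)) z.1 :=
    HasFDerivAt.comp_hasDerivAt (f := fun s : ℝ => (s, z.2)) (l := Φ) z.1 h.hasFDerivAt
      ((hasDerivAt_id' z.1).prodMk (hasDerivAt_const z.1 z.2))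
  have e2 : HasDerivAt (fun t => Φ (z.1, t)) (fderiv ℝ Φ z (0, 1)) z.2 :=
    HasFDerivAt.comp_hasDerivAt (f := fun t : ℝ => (z.1, t)) (l := Φ) z.2 h.hasFDerivAt
      ((hasDerivAt_const z.2 z.1).prodMk (hasDerivAt_id' z.2))
  exact ⟨e1.unique h1, e2.unique h2⟩

/-- The open upper half plane. -/
def openHalf : Set (ℝ × ℝ) := Set.univ ×ˢ Set.Ioi 0

lemma isOpen_openHalf : IsOpen openHalf := isOpen_univ.prod isOpen_Ioi

lemma openHalf_subset : openHalf ⊆ upperHalf 0 := fun _ hz => (Set.mem_Ioi.1 hz.2).le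

/-- Polar coordinates on the upper half plane. -/
def polar (z : ℝ × ℝ) : ℝ × ℝ :=
  (z.1 * Real.cos (Real.pi * z.2), z.1 * Real.sin (Real.pi * z.2))

/-- The inverse of `polar`. -/
def polarInv (z : ℝ × ℝ) : ℝ × ℝ :=
  (‖(⟨z.2, -z.1⟩ : ℂ)‖, Complex.arg ⟨z.2, -z.1⟩ / Real.pi + 1 / 2)

lemma contDiff_polar : ContDiff ℝ ∞ polar := by
  have h : ContDiff ℝ ∞ fun z : ℝ × ℝ => Real.pi * z.2 := contDiff_const.mul contDiff_snd
  exact (contDiff_fst.mul (Real.contDiff_cos.comp h)).prodMk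
    (contDiff_fst.mul (Real.contDiff_sin.comp h))

lemma fderiv_polar (z : ℝ × ℝ) :
    fderiv ℝ polar z (1, 0) = (Real.cos (Real.pi * z.2), Real.sin (Real.pi * z.2)) ∧
    fderiv ℝ polar z (0, 1) = (z.1 * (-Real.sin (Real.pi * z.2) * Real.pi),
      z.1 * (Real.cos (Real.pi * z.2) * Real.pi)) := by
  refine fderiv_eq_partial (contDiff_polar.differentiable (by simp) z) ?_ ?_
  · have h1 := (hasDerivAt_id' z.1).mul_const (Real.cos (Real.pi * z.2))
    have h2 := (hasDerivAt_id' z.1).mul_const (Real.sin (Real.pi * z.2))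
    rw [one_mul] at h1 h2
    exact h1.prodMk h2
  · have h : HasDerivAt (fun t : ℝ => Real.pi * t) Real.pi z.2 := by
      simpa using (hasDerivAt_id' z.2).const_mul Real.pi
    exact (h.cos.const_mul z.1).prodMk (h.sin.const_mul z.1)

lemma polarInv_polar {z : ℝ × ℝ} (hz : z ∈ endStrip) : polarInv (polar z) = z := by
  obtain ⟨r, t⟩ := z
  have hr : 0 < r := hz.1
  have ht : t ∈ Set.Icc (0 : ℝ) 1 := hz.2
  have hpi := Real.pi_pos
  have e : (⟨r * Real.sin (Real.pi * t), -(r * Real.cos (Real.pi * t))⟩ : ℂ) =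
      r * (Complex.cos ((Real.pi * t - Real.pi / 2 : ℝ)) +
        Complex.sin ((Real.pi * t - Real.pi / 2 : ℝ)) * Complex.I) := by
    rw [← Complex.ofReal_cos, ← Complex.ofReal_sin, Real.cos_sub_pi_div_two,
      Real.sin_sub_pi_div_two]
    apply Complex.ext <;> simp [-Complex.ofReal_cos, -Complex.ofReal_sin]
  have harg : Complex.arg ⟨r * Real.sin (Real.pi * t), -(r * Real.cos (Real.pi * t))⟩ =
      Real.pi * t - Real.pi / 2 := by
    rw [e]
    exact Complex.arg_mul_cos_add_sin_mul_I hr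
      ⟨by nlinarith [mul_nonneg hpi.le ht.1], by nlinarith [mul_le_mul_of_nonneg_left ht.2 hpi.le]⟩
  have hnorm : ‖(⟨r * Real.sin (Real.pi * t), -(r * Real.cos (Real.pi * t))⟩ : ℂ)‖ = r := by
    rw [e, norm_mul, ← Complex.ofReal_cos, ← Complex.ofReal_sin, Complex.norm_real,
      Real.norm_of_nonneg hr.le, Complex.ofReal_cos, Complex.ofReal_sin,
      Complex.norm_cos_add_sin_mul_I, mul_one]
  simp only [polarInv, polar, harg, hnorm]
  congr 1
  field_simp
  ring

lemma polar_polarInv (z : ℝ × ℝ) : polar (polarInv z) = z := by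
  obtain ⟨x, y⟩ := z
  have hpi := Real.pi_pos
  have e : Real.pi * (Complex.arg ⟨y, -x⟩ / Real.pi + 1 / 2) =
      Complex.arg ⟨y, -x⟩ + Real.pi / 2 := by
    field_simp
  simp only [polar, polarInv, e, Real.cos_add_pi_div_two, Real.sin_add_pi_div_two]
  rw [mul_neg, Complex.norm_mul_sin_arg, Complex.norm_mul_cos_arg]
  simp

lemma polarInv_mem_endStrip {z : ℝ × ℝ} (hz : z ∈ upperHalf 0) (h0 : z ≠ 0) :
    polarInv z ∈ endStrip := by
  obtain ⟨x, y⟩ := z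
  have hpi := Real.pi_pos
  have hy : 0 ≤ y := hz
  have h := abs_le.1 (Complex.abs_arg_le_pi_div_two_iff (z := ⟨y, -x⟩).2 hy)
  refine ⟨?_, ?_, ?_⟩
  · refine norm_pos_iff.2 fun h => h0 ?_
    have h1 := congrArg Complex.re h
    have h2 := congrArg Complex.im h
    simp only [Complex.zero_re, Complex.zero_im, neg_eq_zero] at h1 h2
    simp [h1, h2]
  · have : -(1 / 2) ≤ Complex.arg ⟨y, -x⟩ / Real.pi := by
      rw [le_div_iff₀ hpi]; linarith [h.1]
    simp only [polarInv]
    linarith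
  · have : Complex.arg ⟨y, -x⟩ / Real.pi ≤ 1 / 2 := by
      rw [div_le_iff₀ hpi]; linarith [h.2]
    simp only [polarInv]
    linarith

/-- Rotating by `-π/2` moves the closed half plane without the origin into the slit plane, where
`arg` is smooth. Without the rotation the negative boundary ray would lie on the branch cut. -/
lemma contDiffAt_polarInv {z : ℝ × ℝ} (hz : z ∈ upperHalf 0) (h0 : z ≠ 0) :
    ContDiffAt ℝ ∞ polarInv z := by
  obtain ⟨x, y⟩ := z
  have hy : 0 ≤ y := hz
  have hs : (⟨y, -x⟩ : ℂ) ∈ Complex.slitPlane := by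
    rw [Complex.mem_slitPlane_iff]
    by_cases h : 0 < y
    · exact Or.inl h
    · right
      intro h1
      simp only [neg_eq_zero] at h1
      exact h0 (by simp [h1, le_antisymm (not_lt.1 h) hy])
  have hlin : ContDiff ℝ ∞ fun z : ℝ × ℝ => (⟨z.2, -z.1⟩ : ℂ) := by
    have : (fun z : ℝ × ℝ => (⟨z.2, -z.1⟩ : ℂ)) =
        fun z => Complex.equivRealProdCLM.symm (z.2, -z.1) := by
      funext z
      exact Complex.ext (by simp) (by simp)
    rw [this]
    exact Complex.equivRealProdCLM.symm.contDiff.comp (contDiff_snd.prodMk contDiff_fst.neg)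
  have hlog : ContDiffAt ℝ ∞ (fun z : ℝ × ℝ => Complex.log ⟨z.2, -z.1⟩) (x, y) :=
    ContDiffAt.comp (f := fun z : ℝ × ℝ => (⟨z.2, -z.1⟩ : ℂ)) (g := Complex.log) (x, y)
      ((Complex.contDiffAt_log hs).restrict_scalars ℝ) hlin.contDiffAt
  have harg : ContDiffAt ℝ ∞ (fun z : ℝ × ℝ => Complex.arg ⟨z.2, -z.1⟩) (x, y) := by
    have := Complex.imCLM.contDiff.contDiffAt.comp (x, y) hlog
    refine this.congr_of_eventuallyEq (.of_forall fun z => ?_)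
    simp [Complex.log_im]
  exact (hlin.contDiffAt.norm ℝ (Complex.slitPlane_ne_zero hs)).prodMk
    ((harg.div_const _).add contDiffAt_const)

lemma polar_mem_upperHalf {z : ℝ × ℝ} (hz : z ∈ endStrip) : polar z ∈ upperHalf 0 := by
  have hr : 0 < z.1 := hz.1
  have hpi := Real.pi_pos
  exact mul_nonneg hr.le (Real.sin_nonneg_of_nonneg_of_le_pi (mul_nonneg hpi.le hz.2.1)
    (mul_le_of_le_one_right hpi.le hz.2.2))

lemma image_polar : polar '' openEnd = openHalf := by
  have hpi := Real.pi_pos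
  apply subset_antisymm
  · rintro _ ⟨z, hz, rfl⟩
    refine ⟨Set.mem_univ _, ?_⟩
    have hr : 0 < z.1 := hz.1
    exact mul_pos hr (Real.sin_pos_of_pos_of_lt_pi (mul_pos hpi hz.2.1)
      (mul_lt_of_lt_one_right hpi hz.2.2))
  · intro z hz
    refine ⟨polarInv z, ?_, polar_polarInv z⟩
    have hy : 0 < z.2 := hz.2
    have h := abs_lt.1 (Complex.abs_arg_lt_pi_div_two_iff (z := ⟨z.2, -z.1⟩).2 (Or.inl hy))
    refine ⟨(polarInv_mem_endStrip (openHalf_subset hz) fun h0 => by simp [h0] at hy).1, ?_, ?_⟩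
    · have : -(1 / 2) < Complex.arg ⟨z.2, -z.1⟩ / Real.pi := by
        rw [lt_div_iff₀ hpi]; linarith [h.1]
      simp only [polarInv]
      linarith
    · have : Complex.arg ⟨z.2, -z.1⟩ / Real.pi < 1 / 2 := by
        rw [div_lt_iff₀ hpi]; linarith [h.2]
      simp only [polarInv]
      linarith

lemma injOn_polar : Set.InjOn polar endStrip := fun z hz z' hz' h => by
  rw [← polarInv_polar hz, ← polarInv_polar hz', h]

variable {E : Type*} [NormedAddCommGroup E] [NormedSpace ℝ E]
variable {M : Type*} [TopologicalSpace M] [ChartedSpace E M]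

lemma mdifferentiableAt_of_openHalf {w : ℝ × ℝ → M}
    (hw : ContMDiffOn 𝓘(ℝ, ℝ × ℝ) 𝓘(ℝ, E) ∞ w (upperHalf 0)) {z : ℝ × ℝ} (hz : z ∈ openHalf) :
    MDifferentiableAt 𝓘(ℝ, ℝ × ℝ) 𝓘(ℝ, E) w z :=
  ((hw.mono openHalf_subset).contMDiffAt (isOpen_openHalf.mem_nhds hz)).mdifferentiableAt (by simp)

lemma integral_dens_polar (σ : SymplecticForm E M) {w v : ℝ × ℝ → M}
    (hw : ContMDiffOn 𝓘(ℝ, ℝ × ℝ) 𝓘(ℝ, E) ∞ w (upperHalf 0))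
    (hv : ∀ z ∈ endStrip, v z = w (polar z)) :
    ∫ z in openEnd, dens σ v z = ∫ z in openHalf, dens σ w z ∧
      (IntegrableOn (dens σ v) openEnd ↔ IntegrableOn (dens σ w) openHalf) := by
  refine integral_dens_comp σ isOpen_openEnd
    (fun z _ => (contDiff_polar.differentiable (by simp) z).hasFDerivAt)
    (injOn_polar.mono openEnd_subset) image_polar (fun z hz => ?_)
    (fun z hz => mdifferentiableAt_of_openHalf hw hz) fun z hz => hv z (openEnd_subset hz)
  have hr : 0 < z.1 := hz.1
  have hpi := Real.pi_pos
  rw [det_eq_of_prod, (fderiv_polar z).1, (fderiv_polar z).2]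
  have : Real.cos (Real.pi * z.2) * (z.1 * (Real.cos (Real.pi * z.2) * Real.pi)) -
      Real.sin (Real.pi * z.2) * (z.1 * (-Real.sin (Real.pi * z.2) * Real.pi)) =
      z.1 * Real.pi * (Real.cos (Real.pi * z.2) ^ 2 + Real.sin (Real.pi * z.2) ^ 2) := by ring
  rw [this]
  positivity

variable {σ : SymplecticForm E M} {k : ℕ∞}

/-- A pseudoholomorphic curve of finite area on the upper half plane. -/
structure IsHalfPlaneCurve (J : CompatibleJ σ k) (w : ℝ × ℝ → M) : Prop where
  smooth : ContMDiffOn 𝓘(ℝ, ℝ × ℝ) 𝓘(ℝ, E) ∞ w (upperHalf 0)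
  cauchyRiemann : ∀ z ∈ openHalf,
    der (E := E) w z (1, 0) + J.op (w z) (der (E := E) w z (0, 1)) = 0
  integrable : IntegrableOn (dens σ w) openHalf

/-- In polar coordinates with angle `π t` the Cauchy-Riemann equation reads `J ∂_t = -(π r) ∂_r`.
Hence `|∂_t|² = π r · density`, and `π ≤ 4` gives the bound. -/
lemma IsHalfPlaneCurve.isEnd {J : CompatibleJ σ k} {w : ℝ × ℝ → M} (h : IsHalfPlaneCurve J w) :
    IsEnd J (w ∘ polar) := by
  refine ⟨h.smooth.comp contDiff_polar.contMDiff.contMDiffOn fun z hz => polar_mem_upperHalf hz,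
    ((integral_dens_polar σ h.smooth fun z _ => rfl).2).2 h.integrable, fun z hz h1 => ?_⟩
  have hz' : polar z ∈ openHalf := image_polar ▸ Set.mem_image_of_mem _ hz
  have hd : der (E := E) (w ∘ polar) z = (der (E := E) w (polar z)).comp (fderiv ℝ polar z) :=
    der_comp (mdifferentiableAt_of_openHalf h.smooth hz')
      (contDiff_polar.differentiable (by simp) z).hasFDerivAt
  have hcr := h.cauchyRiemann _ hz'
  set D := der (E := E) w (polar z) with hD
  set x := w (polar z) with hx
  have hpi := Real.pi_pos
  have hr : 0 < z.1 := hz.1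
  set C := Real.cos (Real.pi * z.2)
  set S := Real.sin (Real.pi * z.2)
  have key : ∀ p : ℝ × ℝ, D p = p.1 • D (1, 0) + p.2 • D (0, 1) := by
    intro p
    rw [← map_smul, ← map_smul, ← map_add]
    simp
  have e1 : D (1, 0) = - J.op x (D (0, 1)) := eq_neg_of_add_eq_zero_left hcr
  have hJ1 : J.op x (D (1, 0)) = D (0, 1) := by
    rw [e1, map_neg, J.op_op, neg_neg]
  have ds : der (E := E) (w ∘ polar) z (1, 0) = C • D (1, 0) + S • D (0, 1) := by
    rw [hd, ContinuousLinearMap.comp_apply, (fderiv_polar z).1, key]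
  have dt : der (E := E) (w ∘ polar) z (0, 1) =
      (z.1 * (-S * Real.pi)) • D (1, 0) + (z.1 * (C * Real.pi)) • D (0, 1) := by
    rw [hd, ContinuousLinearMap.comp_apply, (fderiv_polar z).2, key]
  have hJ2 : J.op x (D (0, 1)) = - D (1, 0) := by rw [e1, neg_neg]
  have hJdt : J.op x (der (E := E) (w ∘ polar) z (0, 1)) =
      (-(z.1 * Real.pi)) • der (E := E) (w ∘ polar) z (1, 0) := by
    rw [dt, map_add, map_smul, map_smul, hJ1, hJ2, ds]
    module
  have hnn := J.normSq_nonneg x (der (E := E) (w ∘ polar) z (0, 1))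
  have heq : J.normSq x (der (E := E) (w ∘ polar) z (0, 1)) =
      z.1 * Real.pi * dens σ (w ∘ polar) z := by
    rw [CompatibleJ.normSq, hJdt, map_smul, σ.bilin_swap, dens, smul_eq_mul, neg_mul_neg]
    rfl
  have hgoal : J.normSq ((w ∘ polar) z) (der (E := E) (w ∘ polar) z (0, 1)) =
      J.normSq x (der (E := E) (w ∘ polar) z (0, 1)) := rfl
  rw [hgoal]
  rw [heq] at hnn ⊢
  have hd0 : 0 ≤ dens σ (w ∘ polar) z := nonneg_of_mul_nonneg_right hnn (by positivity)
  calc z.1 * Real.pi * dens σ (w ∘ polar) z ≤ z.1 * 4 * dens σ (w ∘ polar) z := by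
        gcongr
        exact Real.pi_le_four
    _ = _ := by ring

/-- The map on the half plane which is `w` near the origin and `V` in polar coordinates. -/
def fromPolar (w V : ℝ × ℝ → M) (z : ℝ × ℝ) : M :=
  if (polarInv z).1 < 1 then w z else V (polarInv z)

lemma continuous_polarInv_fst : Continuous fun z : ℝ × ℝ => (polarInv z).1 := by
  have : (fun z : ℝ × ℝ => (polarInv z).1) =
      fun z => ‖Complex.equivRealProdCLM.symm (z.2, -z.1)‖ := by
    ext z
    simp only [polarInv]
    congr 1
  rw [this]
  fun_prop

lemma polarInv_fst_zero : (polarInv 0).1 = 0 := by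
  simp only [polarInv, Prod.fst_zero, Prod.snd_zero, neg_zero]
  exact norm_zero

variable {w V : ℝ × ℝ → M} {p : M} {ε K : ℝ}

/-- `V` agrees with `w ∘ polar` for `r ≤ 1`, so the two branches of `fromPolar` are compatible. -/
lemma fromPolar_polar (hV : IsCapped σ (w ∘ polar) V p ε K) {z : ℝ × ℝ} (hz : z ∈ endStrip) :
    fromPolar w V (polar z) = V z := by
  rw [fromPolar, polarInv_polar hz]
  split_ifs with h
  · exact (hV.eq_left z h.le).symm
  · rfl

lemma fromPolar_zero : fromPolar w V 0 = w 0 := by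
  rw [fromPolar, polarInv_fst_zero, if_pos one_pos]

lemma fromPolar_eq_const (hV : IsCapped σ (w ∘ polar) V p ε K) {z : ℝ × ℝ}
    (hz : z ∈ upperHalf 0) (h0 : z ≠ 0) (hK : K ≤ (polarInv z).1) : fromPolar w V z = p := by
  have := fromPolar_polar hV (polarInv_mem_endStrip hz h0)
  rw [polar_polarInv] at this
  rw [this]
  exact hV.eq_right _ hK

/-- Polar coordinates are singular at the origin, but there the map is still `w`; everywhere else it
is `V ∘ polarInv`. -/
lemma contMDiffOn_fromPolar (hw : ContMDiffOn 𝓘(ℝ, ℝ × ℝ) 𝓘(ℝ, E) ∞ w (upperHalf 0))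
    (hV : IsCapped σ (w ∘ polar) V p ε K) :
    ContMDiffOn 𝓘(ℝ, ℝ × ℝ) 𝓘(ℝ, E) ∞ (fromPolar w V) (upperHalf 0) := by
  intro z hz
  by_cases h : (polarInv z).1 < 1
  · refine (hw z hz).congr_of_eventuallyEq ?_ (if_pos h)
    filter_upwards [mem_nhdsWithin_of_mem_nhds
      (continuous_polarInv_fst.continuousAt.preimage_mem_nhds (Iio_mem_nhds h))] with y hy
    exact if_pos hy
  · have h0 : z ≠ 0 := by
      rintro rfl
      exact h (by rw [polarInv_fst_zero]; exact one_pos)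
    have hne : {y : ℝ × ℝ | y ≠ 0} ∈ 𝓝 z := isOpen_ne.mem_nhds h0
    have heq : ∀ y ∈ upperHalf 0, y ≠ 0 → fromPolar w V y = V (polarInv y) := fun y hy hy0 => by
      conv_lhs => rw [← polar_polarInv y]
      exact fromPolar_polar hV (polarInv_mem_endStrip hy hy0)
    have hs : ContMDiffWithinAt 𝓘(ℝ, ℝ × ℝ) 𝓘(ℝ, E) ∞ (V ∘ polarInv)
        (upperHalf 0 ∩ {y | y ≠ 0}) z :=
      (hV.smooth _ (polarInv_mem_endStrip hz h0)).comp z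
        (contDiffAt_polarInv hz h0).contMDiffAt.contMDiffWithinAt
        fun y hy => polarInv_mem_endStrip hy.1 hy.2
    have hs' := (contMDiffWithinAt_inter hne).1 hs
    refine hs'.congr_of_eventuallyEq ?_ (heq z hz h0)
    filter_upwards [self_mem_nhdsWithin, mem_nhdsWithin_of_mem_nhds hne] with y hy hy0
    exact heq y hy hy0

end Polar

/-! ### From the half plane to the disk by the Cayley transform -/

section Disk

/-- The Cayley transform `z ↦ i (1 + z) / (1 - z)` in real coordinates. -/
def cayley (z : ℝ × ℝ) : ℝ × ℝ :=
  (-2 * z.2 / ((1 - z.1) ^ 2 + z.2 ^ 2), (1 - z.1 ^ 2 - z.2 ^ 2) / ((1 - z.1) ^ 2 + z.2 ^ 2))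

/-- The inverse of `cayley`. -/
def cayleyInv (z : ℝ × ℝ) : ℝ × ℝ :=
  ((z.1 ^ 2 + z.2 ^ 2 - 1) / (z.1 ^ 2 + (z.2 + 1) ^ 2), -2 * z.1 / (z.1 ^ 2 + (z.2 + 1) ^ 2))

/-- The open unit disk. -/
def openDisk : Set (ℝ × ℝ) := {z | z.1 ^ 2 + z.2 ^ 2 < 1}

lemma isOpen_openDisk : IsOpen openDisk :=
  isOpen_lt ((continuous_fst.pow 2).add (continuous_snd.pow 2)) continuous_const

lemma openDisk_subset : openDisk ⊆ disk := fun z (hz : z.1 ^ 2 + z.2 ^ 2 < 1) => hz.le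

lemma convex_disk : Convex ℝ disk := by
  rintro ⟨x, y⟩ hz ⟨x', y'⟩ hz' a b ha hb hab
  have h1 : x ^ 2 + y ^ 2 ≤ 1 := hz
  have h2 : x' ^ 2 + y' ^ 2 ≤ 1 := hz'
  show (a * x + b * x') ^ 2 + (a * y + b * y') ^ 2 ≤ 1
  have e : (a * x + b * x') ^ 2 + (a * y + b * y') ^ 2 =
      (a + b) * (a * (x ^ 2 + y ^ 2) + b * (x' ^ 2 + y' ^ 2)) -
        a * b * ((x - x') ^ 2 + (y - y') ^ 2) := by ring
  have h3 : 0 ≤ a * b * ((x - x') ^ 2 + (y - y') ^ 2) := by positivity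
  rw [e, hab]
  nlinarith

lemma interior_disk : interior disk = openDisk := by
  apply subset_antisymm
  · intro z hz
    by_contra hn
    have hzd : z ∈ disk := interior_subset hz
    have h1 : z.1 ^ 2 + z.2 ^ 2 = 1 := le_antisymm hzd (not_lt.1 hn)
    -- A point of the unit circle leaves the disk when it is scaled by a factor slightly larger than
    -- `1`.
    have hc : Continuous fun s : ℝ => s • z := continuous_id.smul continuous_const
    have hpre : (fun s : ℝ => s • z) ⁻¹' interior disk ∈ 𝓝 (1 : ℝ) :=
      hc.continuousAt.preimage_mem_nhds (isOpen_interior.mem_nhds (by simpa using hz))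
    obtain ⟨δ, hδ, hb⟩ := Metric.mem_nhds_iff.1 hpre
    have h2 := interior_subset (hb (show 1 + δ / 2 ∈ Metric.ball (1 : ℝ) δ by
      rw [Metric.mem_ball, Real.dist_eq, add_sub_cancel_left, abs_of_pos (by positivity)]
      linarith))
    have h3 : ((1 + δ / 2) * z.1) ^ 2 + ((1 + δ / 2) * z.2) ^ 2 ≤ 1 := h2
    have e : ((1 + δ / 2) * z.1) ^ 2 + ((1 + δ / 2) * z.2) ^ 2 =
      (1 + δ / 2) ^ 2 * (z.1 ^ 2 + z.2 ^ 2) := by ring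
    rw [e, h1] at h3
    nlinarith
  · exact interior_maximal openDisk_subset isOpen_openDisk

lemma cayley_denom_pos {z : ℝ × ℝ} (h : z ≠ (1, 0)) : 0 < (1 - z.1) ^ 2 + z.2 ^ 2 := by
  by_contra! hle
  have h1 : (1 - z.1) ^ 2 = 0 := by nlinarith [sq_nonneg (1 - z.1), sq_nonneg z.2]
  have h2 : z.2 ^ 2 = 0 := by nlinarith [sq_nonneg (1 - z.1), sq_nonneg z.2]
  have h3 : 1 - z.1 = 0 := pow_eq_zero_iff two_ne_zero |>.1 h1
  have h4 : z.2 = 0 := pow_eq_zero_iff two_ne_zero |>.1 h2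
  exact h (Prod.ext (by linarith) h4)

lemma ne_of_mem_openDisk {z : ℝ × ℝ} (hz : z ∈ openDisk) : z ≠ (1, 0) := by
  rintro rfl
  have : (1 : ℝ) ^ 2 + 0 ^ 2 < 1 := hz
  norm_num at this

lemma contDiffAt_cayley {z : ℝ × ℝ} (h : z ≠ (1, 0)) : ContDiffAt ℝ ∞ cayley z := by
  have hd := (cayley_denom_pos h).ne'
  have hden : ContDiffAt ℝ ∞ (fun z : ℝ × ℝ => (1 - z.1) ^ 2 + z.2 ^ 2) z := by fun_prop
  have h1 : ContDiffAt ℝ ∞ (fun z : ℝ × ℝ => -2 * z.2) z := by fun_prop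
  have h2 : ContDiffAt ℝ ∞ (fun z : ℝ × ℝ => 1 - z.1 ^ 2 - z.2 ^ 2) z := by fun_prop
  exact (h1.div hden hd).prodMk (h2.div hden hd)

/-- For a holomorphic map the Jacobian is the squared modulus of the derivative, here `(2 / |1 -
z|²)²`. -/
lemma det_fderiv_cayley_nonneg {z : ℝ × ℝ} (h : z ≠ (1, 0)) : 0 ≤ (fderiv ℝ cayley z).det := by
  obtain ⟨x, y⟩ := z
  have hd := (cayley_denom_pos h).ne'
  simp only at hd
  have hx : HasDerivAt (fun s : ℝ => (1 - s) ^ 2 + y ^ 2) (-2 * (1 - x)) x := by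
    have := (((hasDerivAt_id' x).const_sub 1).pow 2).add_const (y ^ 2)
    refine this.congr_deriv ?_
    ring
  have hy : HasDerivAt (fun t : ℝ => (1 - x) ^ 2 + t ^ 2) (2 * y) y := by
    have := ((hasDerivAt_id' y).pow 2).const_add ((1 - x) ^ 2)
    refine this.congr_deriv ?_
    ring
  have hnx : HasDerivAt (fun s : ℝ => 1 - s ^ 2 - y ^ 2) (-2 * x) x := by
    have := (((hasDerivAt_id' x).pow 2).const_sub 1).sub_const (y ^ 2)
    refine this.congr_deriv ?_
    ring
  have hny : HasDerivAt (fun t : ℝ => 1 - x ^ 2 - t ^ 2) (-2 * y) y := by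
    have := ((hasDerivAt_id' y).pow 2).const_sub (1 - x ^ 2)
    refine this.congr_deriv ?_
    ring
  have hny' : HasDerivAt (fun t : ℝ => -2 * t) (-2) y := by
    simpa using (hasDerivAt_id' y).const_mul (-2)
  obtain ⟨e1, e2⟩ := fderiv_eq_partial
    ((contDiffAt_cayley h).differentiableAt (by simp))
    (((hasDerivAt_const x (-2 * y)).div hx hd).prodMk (hnx.div hx hd))
    ((hny'.div hy hd).prodMk (hny.div hy hd))
  rw [det_eq_of_prod, e1, e2]
  have e : (0 * ((1 - x) ^ 2 + y ^ 2) - -2 * y * (-2 * (1 - x))) / ((1 - x) ^ 2 + y ^ 2) ^ 2 *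
      ((-2 * y * ((1 - x) ^ 2 + y ^ 2) - (1 - x ^ 2 - y ^ 2) * (2 * y)) /
        ((1 - x) ^ 2 + y ^ 2) ^ 2) -
      (-2 * x * ((1 - x) ^ 2 + y ^ 2) - (1 - x ^ 2 - y ^ 2) * (-2 * (1 - x))) /
        ((1 - x) ^ 2 + y ^ 2) ^ 2 *
      ((-2 * ((1 - x) ^ 2 + y ^ 2) - -2 * y * (2 * y)) / ((1 - x) ^ 2 + y ^ 2) ^ 2) =
      (2 / ((1 - x) ^ 2 + y ^ 2)) ^ 2 := by
    field_simp
    ring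
  simp only
  rw [e]
  positivity

lemma cayley_mem_upperHalf {z : ℝ × ℝ} (hz : z ∈ disk) : cayley z ∈ upperHalf 0 := by
  have h : z.1 ^ 2 + z.2 ^ 2 ≤ 1 := hz
  show 0 ≤ (1 - z.1 ^ 2 - z.2 ^ 2) / ((1 - z.1) ^ 2 + z.2 ^ 2)
  exact div_nonneg (by linarith) (by positivity)

lemma cayleyInv_cayley {z : ℝ × ℝ} (h : z ≠ (1, 0)) : cayleyInv (cayley z) = z := by
  obtain ⟨x, y⟩ := z
  have hd := (cayley_denom_pos h).ne'
  simp only at hd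
  set d := (1 - x) ^ 2 + y ^ 2 with hdd
  have e : (-2 * y / d) ^ 2 + ((1 - x ^ 2 - y ^ 2) / d + 1) ^ 2 = 4 / d := by
    field_simp
    rw [hdd]
    ring
  simp only [cayleyInv, cayley, ← hdd, e]
  ext
  · simp only
    field_simp
    rw [hdd]
    ring
  · simp only
    field_simp
    ring

lemma cayley_cayleyInv {z : ℝ × ℝ} (h : 0 < z.2) : cayley (cayleyInv z) = z := by
  obtain ⟨a, b⟩ := z
  have hb : 0 < b := h
  have hq : a ^ 2 + (b + 1) ^ 2 ≠ 0 := by positivity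
  set q := a ^ 2 + (b + 1) ^ 2 with hqq
  have e : (1 - (a ^ 2 + b ^ 2 - 1) / q) ^ 2 + (-2 * a / q) ^ 2 = 4 / q := by
    field_simp
    rw [hqq]
    ring
  simp only [cayleyInv, cayley, ← hqq, e]
  ext
  · simp only
    field_simp
    ring
  · simp only
    field_simp
    rw [hqq]
    ring

lemma image_cayley : cayley '' openDisk = openHalf := by
  apply subset_antisymm
  · rintro _ ⟨z, hz, rfl⟩
    have h : z.1 ^ 2 + z.2 ^ 2 < 1 := hz
    exact ⟨Set.mem_univ _, div_pos (by linarith) (cayley_denom_pos (ne_of_mem_openDisk hz))⟩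
  · intro z hz
    have hb : 0 < z.2 := hz.2
    refine ⟨cayleyInv z, ?_, cayley_cayleyInv hb⟩
    show ((z.1 ^ 2 + z.2 ^ 2 - 1) / (z.1 ^ 2 + (z.2 + 1) ^ 2)) ^ 2 +
      (-2 * z.1 / (z.1 ^ 2 + (z.2 + 1) ^ 2)) ^ 2 < 1
    rw [div_pow, div_pow, ← add_div, div_lt_one (by positivity)]
    nlinarith [mul_pos hb (show 0 < z.1 ^ 2 + z.2 ^ 2 + 1 by positivity)]

lemma injOn_cayley : Set.InjOn cayley openDisk := fun z hz z' hz' h => by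
  rw [← cayleyInv_cayley (ne_of_mem_openDisk hz), ← cayleyInv_cayley (ne_of_mem_openDisk hz'), h]

/-- At `e^{iθ}` the boundary value is `lineCoord θ`. So disks and rectangle use the same coordinate
on the seams. -/
lemma cayley_cos_sin {x y : ℝ} (h : x ^ 2 + y ^ 2 = 1) : cayley (x, y) = (y / (x - 1), 0) := by
  have e : (1 - x) ^ 2 + y ^ 2 = -2 * (x - 1) := by nlinarith
  simp only [cayley, e]
  rw [mul_div_mul_left _ _ (by norm_num : (-2 : ℝ) ≠ 0)]
  congr 1
  rw [div_eq_zero_iff]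
  left
  linarith

/-- Near `1` the Cayley transform is large. -/
lemma eventually_lt_cayley (K : ℝ) : ∀ᶠ z in 𝓝 ((1, 0) : ℝ × ℝ), z ≠ (1, 0) →
    K < (cayley z).1 ^ 2 + (cayley z).2 ^ 2 := by
  have hc : ContinuousAt (fun z : ℝ × ℝ => (1 + z.1) ^ 2 + z.2 ^ 2 -
      K * ((1 - z.1) ^ 2 + z.2 ^ 2)) (1, 0) := by fun_prop
  have h0 : ∀ᶠ z in 𝓝 ((1, 0) : ℝ × ℝ), 0 < (1 + z.1) ^ 2 + z.2 ^ 2 -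
      K * ((1 - z.1) ^ 2 + z.2 ^ 2) :=
    hc.eventually_const_lt (by norm_num)
  filter_upwards [h0] with z hz hne
  have hd := cayley_denom_pos hne
  have e : (cayley z).1 ^ 2 + (cayley z).2 ^ 2 =
      ((1 + z.1) ^ 2 + z.2 ^ 2) / ((1 - z.1) ^ 2 + z.2 ^ 2) := by
    simp only [cayley]
    field_simp
    ring
  rw [e, lt_div_iff₀ hd]
  linarith

variable {E : Type*} [NormedAddCommGroup E] [NormedSpace ℝ E]
variable {M : Type*} [TopologicalSpace M] [ChartedSpace E M]

open Classical in
/-- The map on the disk which corresponds to the map `v` on the half plane, with value `p` at the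
point `1`, which corresponds to infinity. -/
def fromCayley (v : ℝ × ℝ → M) (p : M) (z : ℝ × ℝ) : M := if z = (1, 0) then p else v (cayley z)

variable {v : ℝ × ℝ → M} {p : M} {K : ℝ}

lemma fromCayley_of_ne {z : ℝ × ℝ} (h : z ≠ (1, 0)) : fromCayley v p z = v (cayley z) := if_neg h

lemma fromCayley_one : fromCayley v p (1, 0) = p := if_pos rfl

/-- Since `v` is constant near infinity, the map on the disk is constant near `1`, and the
singularity there is removable for trivial reasons. -/
lemma contMDiffOn_fromCayley (hv : ContMDiffOn 𝓘(ℝ, ℝ × ℝ) 𝓘(ℝ, E) ∞ v (upperHalf 0))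
    (hp : ∀ z ∈ upperHalf 0, K < z.1 ^ 2 + z.2 ^ 2 → v z = p) :
    ContMDiffOn 𝓘(ℝ, ℝ × ℝ) 𝓘(ℝ, E) ∞ (fromCayley v p) disk := by
  intro z hz
  by_cases h : z = (1, 0)
  · have hc : ContMDiffWithinAt 𝓘(ℝ, ℝ × ℝ) 𝓘(ℝ, E) ∞ (fun _ => p) disk z :=
      contMDiffWithinAt_const
    refine hc.congr_of_eventuallyEq ?_ (if_pos h)
    subst h
    filter_upwards [self_mem_nhdsWithin, mem_nhdsWithin_of_mem_nhds (eventually_lt_cayley K)]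
      with y hy hy'
    by_cases hy1 : y = (1, 0)
    · rw [hy1, fromCayley_one]
    · rw [fromCayley_of_ne hy1]
      exact hp _ (cayley_mem_upperHalf hy) (hy' hy1)
  · have hs : ContMDiffWithinAt 𝓘(ℝ, ℝ × ℝ) 𝓘(ℝ, E) ∞ (v ∘ cayley) disk z :=
      (hv _ (cayley_mem_upperHalf hz)).comp z
        (contDiffAt_cayley h).contMDiffAt.contMDiffWithinAt fun y hy => cayley_mem_upperHalf hy
    refine hs.congr_of_eventuallyEq ?_ (fromCayley_of_ne h)
    filter_upwards [mem_nhdsWithin_of_mem_nhds (isOpen_ne.mem_nhds h)] with y hy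
    exact fromCayley_of_ne hy

lemma area_fromCayley (σ : SymplecticForm E M)
    (hv : ContMDiffOn 𝓘(ℝ, ℝ × ℝ) 𝓘(ℝ, E) ∞ v (upperHalf 0)) :
    area σ disk (fromCayley v p) = ∫ z in openHalf, dens σ v z := by
  rw [(area_eq_of_convex σ convex_disk interior_disk).1]
  exact (integral_dens_comp σ isOpen_openDisk
    (fun z hz => ((contDiffAt_cayley (ne_of_mem_openDisk hz)).differentiableAt
      (by simp)).hasFDerivAt) injOn_cayley image_cayley
    (fun z hz => det_fderiv_cayley_nonneg (ne_of_mem_openDisk hz))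
    (fun z hz => mdifferentiableAt_of_openHalf hv hz)
    fun z hz => fromCayley_of_ne (ne_of_mem_openDisk hz)).1

end Disk

/-! ### Normalizing half planes by translation and half turn -/

section Affine

variable {E : Type*} [NormedAddCommGroup E] [NormedSpace ℝ E]
variable {M : Type*} [TopologicalSpace M] [ChartedSpace E M]
variable {σ : SymplecticForm E M} {k : ℕ∞}

/-- The map `z ↦ e z + i a`. -/
def affine (e a : ℝ) (z : ℝ × ℝ) : ℝ × ℝ := (e * z.1, e * z.2 + a)

lemma contDiff_affine (e a : ℝ) : ContDiff ℝ ∞ (affine e a) :=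
  (contDiff_const.mul contDiff_fst).prodMk ((contDiff_const.mul contDiff_snd).add contDiff_const)

lemma hasFDerivAt_affine (e a : ℝ) (z : ℝ × ℝ) :
    HasFDerivAt (affine e a) (e • ContinuousLinearMap.id ℝ (ℝ × ℝ)) z := by
  have h : affine e a = fun z => e • z + (0, a) := by
    ext z <;> simp [affine]
  rw [h]
  exact ((hasFDerivAt_id z).const_smul e).add_const _

lemma der_affine {w : ℝ × ℝ → M} {e a : ℝ} {z : ℝ × ℝ}
    (hw : MDifferentiableAt 𝓘(ℝ, ℝ × ℝ) 𝓘(ℝ, E) w (affine e a z)) (v : ℝ × ℝ) :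
    der (E := E) (w ∘ affine e a) z v = e • der (E := E) w (affine e a z) v := by
  rw [der_comp hw (hasFDerivAt_affine e a z)]
  simp

lemma dens_affine (σ : SymplecticForm E M) {w : ℝ × ℝ → M} {e a : ℝ} (he : e * e = 1)
    {z : ℝ × ℝ} (hw : MDifferentiableAt 𝓘(ℝ, ℝ × ℝ) 𝓘(ℝ, E) w (affine e a z)) :
    dens σ (w ∘ affine e a) z = dens σ w (affine e a z) := by
  rw [dens, dens, der_affine hw, der_affine hw, map_smul, map_smul, smul_apply, smul_smul, he,
    one_smul]
  rfl

lemma affine_affine {e : ℝ} (he : e * e = 1) (a : ℝ) (z : ℝ × ℝ) :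
    affine e a (affine e (-e * a) z) = z := by
  simp only [affine]
  ext
  · linear_combination z.1 * he
  · simp only
    linear_combination (z.2 - a) * he

lemma injective_affine {e : ℝ} (he : e * e = 1) (a : ℝ) : Function.Injective (affine e a) := by
  rintro ⟨x, y⟩ ⟨x', y'⟩ h
  have he0 : e ≠ 0 := left_ne_zero_of_mul (he ▸ one_ne_zero)
  simpa [affine, he0] using h

lemma integral_dens_affine (σ : SymplecticForm E M) {w : ℝ × ℝ → M} {e a : ℝ} (he : e * e = 1)
    {U V : Set (ℝ × ℝ)} (hU : IsOpen U) (hUV : ∀ z, affine e a z ∈ V ↔ z ∈ U)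
    (hw : ∀ z ∈ V, MDifferentiableAt 𝓘(ℝ, ℝ × ℝ) 𝓘(ℝ, E) w z) :
    ∫ z in U, dens σ (w ∘ affine e a) z = ∫ z in V, dens σ w z ∧
      (IntegrableOn (dens σ (w ∘ affine e a)) U ↔ IntegrableOn (dens σ w) V) := by
  refine integral_dens_comp σ hU (fun z _ => hasFDerivAt_affine e a z)
    (injective_affine he a).injOn ?_ (fun z _ => ?_) hw fun z _ => rfl
  · ext z
    constructor
    · rintro ⟨y, hy, rfl⟩
      exact (hUV y).2 hy
    · intro hz
      refine ⟨affine e (-e * a) z, (hUV _).1 ?_, affine_affine he a z⟩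
      rwa [affine_affine he a z]
  · rw [det_eq_of_prod]
    simpa using mul_self_nonneg e

/-- For `e = ±1` the substitution multiplies both partial derivatives by `e`, so it preserves the
Cauchy-Riemann equation, and its Jacobian `e²` is `1`, so it preserves the area. -/
lemma IsHolomorphicOn.isHalfPlaneCurve {J : CompatibleJ σ k} {D U : Set (ℝ × ℝ)}
    {w : ℝ × ℝ → M} (h : IsHolomorphicOn J D w) (hf : HasFiniteArea σ D w) (hD : Convex ℝ D)
    (hU : interior D = U) {e a : ℝ} (he : e * e = 1)
    (hUe : ∀ z, affine e a z ∈ U ↔ z ∈ openHalf) (hDe : ∀ z ∈ upperHalf 0, affine e a z ∈ D) :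
    IsHalfPlaneCurve J (w ∘ affine e a) ∧
      area σ D w = ∫ z in openHalf, dens σ (w ∘ affine e a) z := by
  have hnh : ∀ z ∈ U, D ∈ 𝓝 z := fun z hz => mem_interior_iff_mem_nhds.1 (hU ▸ hz)
  have hdiff : ∀ z ∈ U, MDifferentiableAt 𝓘(ℝ, ℝ × ℝ) 𝓘(ℝ, E) w z := fun z hz =>
    ((h.smooth.contMDiffAt (hnh z hz)).mdifferentiableAt (by simp))
  obtain ⟨ha, hi⟩ := area_eq_of_convex σ (w := w) hD hU
  obtain ⟨e1, e2⟩ := integral_dens_affine σ he isOpen_openHalf hUe hdiff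
  refine ⟨⟨h.smooth.comp (contDiff_affine e a).contMDiff.contMDiffOn hDe, fun z hz => ?_,
    e2.2 (hi.1 hf)⟩, ha.trans e1.symm⟩
  have hz' := (hUe z).2 hz
  have hcr : der (E := E) w (affine e a z) (1, 0) +
      J.op (w (affine e a z)) (der (E := E) w (affine e a z) (0, 1)) = 0 := by
    rw [der_eq_of_mem_nhds (hnh _ hz')]
    exact h.cauchyRiemann _ (mem_of_mem_nhds (hnh _ hz'))
  rw [der_affine (hdiff _ hz'), der_affine (hdiff _ hz'), map_smul, ← smul_add]
  exact (congrArg (e • ·) hcr).trans (smul_zero e)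

end Affine

/-! ### The strip and its two ends -/

section Strip

variable {E : Type*} [NormedAddCommGroup E] [NormedSpace ℝ E]
variable {M : Type*} [TopologicalSpace M] [ChartedSpace E M]
variable {σ : SymplecticForm E M} {k : ℕ∞}

/-- The interior of `strip`. -/
def openStrip : Set (ℝ × ℝ) := Set.univ ×ˢ Set.Ioo (-(1 / 2)) (1 / 2)

lemma isOpen_openStrip : IsOpen openStrip := isOpen_univ.prod isOpen_Ioo

lemma strip_eq : strip = Set.univ ×ˢ Set.Icc (-(1 / 2)) (1 / 2) := by
  ext z
  simp [strip]

lemma convex_strip : Convex ℝ strip := by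
  rw [strip_eq]
  exact convex_univ.prod (convex_Icc _ _)

lemma interior_strip : interior strip = openStrip := by
  rw [strip_eq, interior_prod_eq, interior_univ, interior_Icc]
  rfl

lemma openStrip_subset : openStrip ⊆ strip := interior_strip ▸ interior_subset

lemma mdifferentiableAt_of_openStrip {w : ℝ × ℝ → M}
    (hw : ContMDiffOn 𝓘(ℝ, ℝ × ℝ) 𝓘(ℝ, E) ∞ w strip) {z : ℝ × ℝ} (hz : z ∈ openStrip) :
    MDifferentiableAt 𝓘(ℝ, ℝ × ℝ) 𝓘(ℝ, E) w z :=
  ((hw.mono openStrip_subset).contMDiffAt (isOpen_openStrip.mem_nhds hz)).mdifferentiableAt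
    (by simp)

/-- A map of finite area on the strip, whose vertical speed is controlled by its density. -/
structure IsStripCurve (J : CompatibleJ σ k) (w : ℝ × ℝ → M) : Prop where
  smooth : ContMDiffOn 𝓘(ℝ, ℝ × ℝ) 𝓘(ℝ, E) ∞ w strip
  normSq_le : ∀ z ∈ openStrip, J.normSq (w z) (der (E := E) w z (0, 1)) ≤ dens σ w z
  integrable : IntegrableOn (dens σ w) openStrip

/-- The parametrization of the right end of the strip, for `e = 1`, or the left end,
for `e = -1`. -/
def stripEnd (e : ℝ) : ℝ × ℝ → ℝ × ℝ := affine e (-e / 2)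

lemma stripEnd_one (r t : ℝ) : stripEnd 1 (r, t) = (r, t - 1 / 2) := by
  simp only [stripEnd, affine]
  ext <;> ring

lemma stripEnd_neg_one (r t : ℝ) : stripEnd (-1) (r, t) = (-r, 1 / 2 - t) := by
  simp only [stripEnd, affine]
  ext <;> ring

/-- One half of the open strip. -/
def halfStrip (e : ℝ) : Set (ℝ × ℝ) := {z | 0 < e * z.1 ∧ z.2 ∈ Set.Ioo (-(1 / 2)) (1 / 2)}

lemma isOpen_halfStrip (e : ℝ) : IsOpen (halfStrip e) :=
  (isOpen_lt continuous_const (continuous_const.mul continuous_fst)).inter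
    (isOpen_Ioo.preimage continuous_snd)

lemma sign_cases {e : ℝ} (he : e * e = 1) : e = 1 ∨ e = -1 := mul_self_eq_one_iff.1 he

lemma stripEnd_mem_halfStrip {e : ℝ} (he : e * e = 1) (z : ℝ × ℝ) :
    stripEnd e z ∈ halfStrip e ↔ z ∈ openEnd := by
  obtain ⟨r, t⟩ := z
  rcases sign_cases he with rfl | rfl
  · rw [stripEnd_one]
    simp only [halfStrip, openEnd, Set.mem_ofPred_eq, Set.mem_prod, Set.mem_Ioi, Set.mem_Ioo]
    constructor
    · rintro ⟨h1, h2, h3⟩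
      exact ⟨by linarith, by linarith, by linarith⟩
    · rintro ⟨h1, h2, h3⟩
      exact ⟨by linarith, by linarith, by linarith⟩
  · rw [stripEnd_neg_one]
    simp only [halfStrip, openEnd, Set.mem_ofPred_eq, Set.mem_prod, Set.mem_Ioi, Set.mem_Ioo]
    constructor
    · rintro ⟨h1, h2, h3⟩
      exact ⟨by linarith, by linarith, by linarith⟩
    · rintro ⟨h1, h2, h3⟩
      exact ⟨by linarith, by linarith, by linarith⟩

lemma stripEnd_mem_strip {e : ℝ} (he : e * e = 1) {z : ℝ × ℝ} (hz : z ∈ endStrip) :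
    stripEnd e z ∈ strip := by
  obtain ⟨r, t⟩ := z
  have h1 : 0 ≤ t := hz.2.1
  have h2 : t ≤ 1 := hz.2.2
  rcases sign_cases he with rfl | rfl
  · rw [stripEnd_one]
    exact ⟨by simp only; linarith, by simp only; linarith⟩
  · rw [stripEnd_neg_one]
    exact ⟨by simp only; linarith, by simp only; linarith⟩

lemma halfStrip_subset (e : ℝ) : halfStrip e ⊆ openStrip := fun _ hz => ⟨Set.mem_univ _, hz.2⟩

/-- Here the squared vertical speed is bounded by the density itself, and the factor `4 r` is at
least `1` where the estimate is required. The sign `e` disappears because the metric is quadratic.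
-/
lemma IsStripCurve.isEnd {J : CompatibleJ σ k} {w : ℝ × ℝ → M} (h : IsStripCurve J w) {e : ℝ}
    (he : e * e = 1) : IsEnd J (w ∘ stripEnd e) := by
  have hd : ∀ z ∈ halfStrip e, MDifferentiableAt 𝓘(ℝ, ℝ × ℝ) 𝓘(ℝ, E) w z := fun z hz =>
    mdifferentiableAt_of_openStrip h.smooth (halfStrip_subset e hz)
  refine ⟨h.smooth.comp (contDiff_affine _ _).contMDiff.contMDiffOn
    fun z hz => stripEnd_mem_strip he hz, ?_, fun z hz h1 => ?_⟩
  · exact (integral_dens_affine σ he isOpen_openEnd (stripEnd_mem_halfStrip he) hd).2.2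
      (h.integrable.mono_set (halfStrip_subset e))
  · have hz' := (stripEnd_mem_halfStrip he z).2 hz
    have hle := h.normSq_le _ (halfStrip_subset e hz')
    have hnn := (J.normSq_nonneg _ _).trans hle
    have e1 : J.normSq ((w ∘ stripEnd e) z) (der (E := E) (w ∘ stripEnd e) z (0, 1)) =
        J.normSq (w (stripEnd e z)) (der (E := E) w (stripEnd e z) (0, 1)) := by
      simp only [stripEnd] at hz' ⊢
      rw [der_affine (hd _ hz'), CompatibleJ.normSq, map_smul, map_smul, map_smul, smul_apply,
        smul_smul, he, one_smul]
      rfl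
    have e2 : dens σ (w ∘ stripEnd e) z = dens σ w (stripEnd e z) := dens_affine σ he (hd _ hz')
    rw [e1, e2]
    nlinarith

/-- The area of a strip is the sum of the areas of its ends. -/
lemma integral_dens_openStrip (σ : SymplecticForm E M) {v v₁ v₂ : ℝ × ℝ → M}
    (hv : ContMDiffOn 𝓘(ℝ, ℝ × ℝ) 𝓘(ℝ, E) ∞ v strip)
    (h₁ : ∀ z ∈ openEnd, v₁ z = v (stripEnd 1 z)) (h₂ : ∀ z ∈ openEnd, v₂ z = v (stripEnd (-1) z))
    (i₁ : IntegrableOn (dens σ v₁) openEnd) (i₂ : IntegrableOn (dens σ v₂) openEnd) :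
    ∫ z in openStrip, dens σ v z =
      (∫ z in openEnd, dens σ v₁ z) + ∫ z in openEnd, dens σ v₂ z := by
  have hd : ∀ e, ∀ z ∈ halfStrip e, MDifferentiableAt 𝓘(ℝ, ℝ × ℝ) 𝓘(ℝ, E) v z := fun e z hz =>
    mdifferentiableAt_of_openStrip hv (halfStrip_subset e hz)
  have hc : ∀ {u : ℝ × ℝ → M} {e : ℝ}, (∀ z ∈ openEnd, u z = v (stripEnd e z)) →
      ∀ z ∈ openEnd, dens σ u z = dens σ (v ∘ stripEnd e) z := fun h z hz =>
    dens_congr σ (by filter_upwards [isOpen_openEnd.mem_nhds hz] with y hy using h y hy)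
  obtain ⟨e₁, j₁⟩ := integral_dens_affine σ (one_mul 1) isOpen_openEnd
    (stripEnd_mem_halfStrip (one_mul 1)) (hd 1)
  obtain ⟨e₂, j₂⟩ := integral_dens_affine σ (neg_one_mul (-1) |>.trans (neg_neg 1)) isOpen_openEnd
    (stripEnd_mem_halfStrip (neg_one_mul (-1) |>.trans (neg_neg 1))) (hd (-1))
  have m := isOpen_openEnd.measurableSet
  rw [setIntegral_congr_fun m (hc h₁), setIntegral_congr_fun m (hc h₂)]
  have k₁ := j₁.1 ((integrableOn_congr_fun (hc h₁) m).1 i₁)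
  have k₂ := j₂.1 ((integrableOn_congr_fun (hc h₂) m).1 i₂)
  have hdisj : Disjoint (halfStrip 1) (halfStrip (-1)) := by
    rw [Set.disjoint_left]
    rintro z ⟨h, -⟩ ⟨h', -⟩
    linarith
  have hunion := setIntegral_union hdisj (isOpen_halfStrip (-1)).measurableSet k₁ k₂
  have hsub : halfStrip 1 ∪ halfStrip (-1) ⊆ openStrip :=
    Set.union_subset (halfStrip_subset _) (halfStrip_subset _)
  have hae : ∀ᵐ z : ℝ × ℝ, z ∈ openStrip \ (halfStrip 1 ∪ halfStrip (-1)) → dens σ v z = 0 := by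
    have hline : ∀ᵐ z : ℝ × ℝ, z ∉ ({0} : Set ℝ) ×ˢ (Set.univ : Set ℝ) :=
      measure_eq_zero_iff_ae_notMem.1 (volume_vertical_line 0)
    filter_upwards [hline] with z hz hz'
    exfalso
    rcases lt_trichotomy z.1 0 with h | h | h
    · exact hz'.2 (Or.inr ⟨by linarith, hz'.1.2⟩)
    · exact hz ⟨h, Set.mem_univ _⟩
    · exact hz'.2 (Or.inl ⟨by linarith, hz'.1.2⟩)
  rw [setIntegral_eq_of_subset_of_ae_sdiff_eq_zero
    isOpen_openStrip.measurableSet.nullMeasurableSet hsub hae, hunion]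
  exact congrArg₂ (· + ·) e₁.symm e₂.symm

/-- The map on the strip which is `w` near the line `s = 0`, with ends `V` and `V'`. -/
def fromEnds (w V V' : ℝ × ℝ → M) (z : ℝ × ℝ) : M :=
  if |z.1| < 1 then w z else
    if 0 < z.1 then V (z.1, z.2 + 1 / 2) else V' (-z.1, 1 / 2 - z.2)

variable {w V V' : ℝ × ℝ → M} {p p' : M} {ε K : ℝ}

/-- `V` continues the given map for `s ≤ 1`, so the middle formula may be replaced by the formula
for the end on all of `s > 0`. -/
lemma fromEnds_of_pos (hV : IsCapped σ (w ∘ stripEnd 1) V p ε K) {z : ℝ × ℝ} (hz : 0 < z.1) :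
    fromEnds w V V' z = V (z.1, z.2 + 1 / 2) := by
  unfold fromEnds
  split_ifs with h
  · rw [hV.eq_left (z.1, z.2 + 1 / 2) (lt_of_abs_lt h).le, Function.comp_apply, stripEnd_one]
    simp
  · rfl

lemma fromEnds_of_neg (hV' : IsCapped σ (w ∘ stripEnd (-1)) V' p' ε K) {z : ℝ × ℝ}
    (hz : z.1 < 0) : fromEnds w V V' z = V' (-z.1, 1 / 2 - z.2) := by
  unfold fromEnds
  split_ifs with h h'
  · rw [hV'.eq_left (-z.1, 1 / 2 - z.2) (by have := (abs_lt.1 h).1; simp only; linarith),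
      Function.comp_apply, stripEnd_neg_one]
    simp
  · linarith
  · rfl

lemma contMDiffOn_fromEnds (hw : ContMDiffOn 𝓘(ℝ, ℝ × ℝ) 𝓘(ℝ, E) ∞ w strip)
    (hV : IsCapped σ (w ∘ stripEnd 1) V p ε K) (hV' : IsCapped σ (w ∘ stripEnd (-1)) V' p' ε K) :
    ContMDiffOn 𝓘(ℝ, ℝ × ℝ) 𝓘(ℝ, E) ∞ (fromEnds w V V') strip := by
  intro z hz
  have key : ∀ {Φ : ℝ × ℝ → ℝ × ℝ} {u : ℝ × ℝ → M} {O : Set (ℝ × ℝ)}, ContDiff ℝ ∞ Φ →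
      ContMDiffOn 𝓘(ℝ, ℝ × ℝ) 𝓘(ℝ, E) ∞ u endStrip → O ∈ 𝓝 z →
      (∀ y ∈ strip, y ∈ O → Φ y ∈ endStrip) →
      (∀ y ∈ strip, y ∈ O → fromEnds w V V' y = u (Φ y)) →
      ContMDiffWithinAt 𝓘(ℝ, ℝ × ℝ) 𝓘(ℝ, E) ∞ (fromEnds w V V') strip z := by
    intro Φ u O hΦ hu hO hm he
    have hs : ContMDiffWithinAt 𝓘(ℝ, ℝ × ℝ) 𝓘(ℝ, E) ∞ (u ∘ Φ) (strip ∩ O) z :=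
      (hu _ (hm z hz (mem_of_mem_nhds hO))).comp z hΦ.contMDiff.contMDiffAt.contMDiffWithinAt
        fun y hy => hm y hy.1 hy.2
    refine ((contMDiffWithinAt_inter hO).1 hs).congr_of_eventuallyEq ?_
      (he z hz (mem_of_mem_nhds hO))
    filter_upwards [self_mem_nhdsWithin, mem_nhdsWithin_of_mem_nhds hO] with y hy hy'
    exact he y hy hy'
  rcases lt_trichotomy z.1 0 with h | h | h
  · have hO : {y : ℝ × ℝ | y.1 < 0} ∈ 𝓝 z :=
      continuous_fst.continuousAt.preimage_mem_nhds (Iio_mem_nhds h)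
    refine key (Φ := fun y => (-y.1, 1 / 2 - y.2))
      (contDiff_fst.neg.prodMk (contDiff_const.sub contDiff_snd)) hV'.smooth hO ?_
      fun y _ hy => fromEnds_of_neg hV' hy
    intro y hy hy'
    have h1 : y.1 < 0 := hy'
    exact ⟨by simpa using h1, by simp only; linarith [hy.2], by simp only; linarith [hy.1]⟩
  · have hO : {y : ℝ × ℝ | |y.1| < 1} ∈ 𝓝 z :=
      (continuous_abs.comp continuous_fst).continuousAt.preimage_mem_nhds
        (Iio_mem_nhds (by simp [h]))
    refine (hw z hz).congr_of_eventuallyEq ?_ (if_pos (mem_of_mem_nhds hO))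
    filter_upwards [mem_nhdsWithin_of_mem_nhds hO] with y hy
    exact if_pos hy
  · have hO : {y : ℝ × ℝ | 0 < y.1} ∈ 𝓝 z :=
      continuous_fst.continuousAt.preimage_mem_nhds (Ioi_mem_nhds h)
    refine key (Φ := fun y => (y.1, y.2 + 1 / 2))
      (contDiff_fst.prodMk (contDiff_snd.add contDiff_const)) hV.smooth hO ?_
      fun y _ hy => fromEnds_of_pos hV hy
    intro y hy hy'
    exact ⟨hy', by simp only; linarith [hy.1], by simp only; linarith [hy.2]⟩

lemma integral_dens_fromEnds (hw : ContMDiffOn 𝓘(ℝ, ℝ × ℝ) 𝓘(ℝ, E) ∞ w strip)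
    (hV : IsCapped σ (w ∘ stripEnd 1) V p ε K) (hV' : IsCapped σ (w ∘ stripEnd (-1)) V' p' ε K) :
    ∫ z in openStrip, dens σ (fromEnds w V V') z =
      (∫ z in openEnd, dens σ V z) + ∫ z in openEnd, dens σ V' z := by
  refine integral_dens_openStrip σ (contMDiffOn_fromEnds hw hV hV') ?_ ?_ hV.integrable
    hV'.integrable
  · rintro ⟨r, t⟩ hz
    have hr : 0 < r := hz.1
    rw [stripEnd_one, fromEnds_of_pos hV hr]
    simp
  · rintro ⟨r, t⟩ hz
    have hr : 0 < r := hz.1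
    rw [stripEnd_neg_one, fromEnds_of_neg hV' (by simpa using hr)]
    simp

end Strip

/-! ### From the strip to the rectangle and the annulus -/

section Rectangle

/-- The coordinate `-cot (θ / 2)` on the circle minus a point. -/
def lineCoord (θ : ℝ) : ℝ := Real.sin θ / (Real.cos θ - 1)

lemma cos_lt_one {θ : ℝ} (h : θ ∈ Set.Ioo 0 (2 * Real.pi)) : Real.cos θ < 1 := by
  refine lt_of_le_of_ne (Real.cos_le_one θ) fun h1 => ?_
  exact h.1.ne' ((Real.cos_eq_one_iff_of_lt_of_lt (by linarith [h.1, Real.pi_pos]) h.2).1 h1)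

lemma hasDerivAt_lineCoord {θ : ℝ} (h : Real.cos θ ≠ 1) :
    HasDerivAt lineCoord (1 / (1 - Real.cos θ)) θ := by
  have h1 : Real.cos θ - 1 ≠ 0 := sub_ne_zero.2 h
  have h2 : 1 - Real.cos θ ≠ 0 := sub_ne_zero.2 h.symm
  refine ((Real.hasDerivAt_sin θ).div ((Real.hasDerivAt_cos θ).sub_const 1) h1).congr_deriv ?_
  rw [div_eq_div_iff (pow_ne_zero 2 h1) h2]
  linear_combination (1 - Real.cos θ) * (Real.sin_sq_add_cos_sq θ)

lemma lineCoord_arctan (s : ℝ) : lineCoord (Real.pi + 2 * Real.arctan s) = s := by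
  have hc : Real.cos (Real.arctan s) ≠ 0 := (Real.cos_arctan_pos s).ne'
  have ht : Real.sin (Real.arctan s) = s * Real.cos (Real.arctan s) := by
    have := Real.tan_arctan s
    rw [Real.tan_eq_sin_div_cos, div_eq_iff hc] at this
    exact this
  rw [lineCoord, add_comm Real.pi, Real.sin_add_pi, Real.cos_add_pi, Real.sin_two_mul,
    Real.cos_two_mul, ht]
  have : -(2 * Real.cos (Real.arctan s) ^ 2 - 1) - 1 = -2 * Real.cos (Real.arctan s) ^ 2 := by ring
  rw [this]
  field_simp

lemma image_lineCoord : lineCoord '' Set.Ioo 0 (2 * Real.pi) = Set.univ := by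
  refine Set.eq_univ_of_forall fun s => ⟨Real.pi + 2 * Real.arctan s, ⟨?_, ?_⟩, lineCoord_arctan s⟩
  · linarith [Real.neg_pi_div_two_lt_arctan s]
  · linarith [Real.arctan_lt_pi_div_two s]

lemma injOn_lineCoord : Set.InjOn lineCoord (Set.Ioo 0 (2 * Real.pi)) := by
  refine (strictMonoOn_of_deriv_pos (convex_Ioo _ _) (fun θ hθ =>
    (hasDerivAt_lineCoord (cos_lt_one hθ).ne).continuousAt.continuousWithinAt)
    fun θ hθ => ?_).injOn
  rw [interior_Ioo] at hθ
  rw [(hasDerivAt_lineCoord (cos_lt_one hθ).ne).deriv]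
  have := cos_lt_one hθ
  exact div_pos one_pos (by linarith)

/-- Close to the point `1` of the circle, the coordinate on the line is large. -/
lemma lt_abs_div {K x y : ℝ} (hxy : x ^ 2 + y ^ 2 = 1) (hx : x ≠ 1)
    (hK : K ^ 2 * (1 - x) < 1 + x) : K < |y / (x - 1)| := by
  have hx1 : x < 1 := lt_of_le_of_ne (by nlinarith [sq_nonneg y]) hx
  have e : (y / (x - 1)) ^ 2 = (1 + x) / (1 - x) := by
    have h1 : x - 1 ≠ 0 := sub_ne_zero.2 hx
    have h2 : 1 - x ≠ 0 := sub_ne_zero.2 hx.symm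
    rw [div_pow, div_eq_div_iff (pow_ne_zero 2 h1) h2]
    linear_combination (1 - x) * hxy
  refine lt_of_le_of_lt (le_abs_self K) (sq_lt_sq.1 ?_)
  rw [e, lt_div_iff₀ (by linarith)]
  exact hK

variable {E : Type*} [NormedAddCommGroup E] [NormedSpace ℝ E]
variable {M : Type*} [TopologicalSpace M] [ChartedSpace E M]

lemma convex_rectangle : Convex ℝ rectangle := (convex_Icc _ _).prod (convex_Icc _ _)

lemma interior_rectangle :
    interior rectangle = Set.Ioo 0 (2 * Real.pi) ×ˢ Set.Ioo (-(1 / 2)) (1 / 2) := by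
  rw [rectangle, interior_prod_eq, interior_Icc, interior_Icc]

open Classical in
/-- The map on the rectangle which corresponds to the map `v` on the strip. -/
def fromStrip (v : ℝ × ℝ → M) (p p' : M) (z : ℝ × ℝ) : M :=
  if Real.cos z.1 = 1 then (if z.1 ≤ Real.pi then p' else p) else v (lineCoord z.1, z.2)

variable {v : ℝ × ℝ → M} {p p' : M} {K : ℝ}

lemma fromStrip_of_ne {z : ℝ × ℝ} (h : Real.cos z.1 ≠ 1) :
    fromStrip v p p' z = v (lineCoord z.1, z.2) := if_neg h

lemma fromStrip_zero (t : ℝ) : fromStrip v p p' (0, t) = p' := by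
  simp [fromStrip, Real.pi_pos.le]

lemma fromStrip_two_pi (t : ℝ) : fromStrip v p p' (2 * Real.pi, t) = p := by
  have : ¬ 2 * Real.pi ≤ Real.pi := by linarith [Real.pi_pos]
  simp [fromStrip, this]

lemma eventually_large {θ₀ : ℝ} (h : Real.cos θ₀ = 1) (K : ℝ) :
    ∀ᶠ θ in 𝓝 θ₀, Real.cos θ ≠ 1 → K < |lineCoord θ| := by
  have hc : ContinuousAt (fun θ => 1 + Real.cos θ - K ^ 2 * (1 - Real.cos θ)) θ₀ := by fun_prop
  filter_upwards [hc.eventually_const_lt (show 0 < 1 + Real.cos θ₀ - K ^ 2 * (1 - Real.cos θ₀) by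
    rw [h]; norm_num)] with θ hθ hne
  exact lt_abs_div (Real.cos_sq_add_sin_sq θ) hne (by linarith)

/-- As `θ` tends to `0` from above, `lineCoord θ` tends to `-∞`; as `θ` tends to `2π` from below, it
tends to `+∞`. Near the two vertical edges the map is therefore constant, equal to the limit of the
left end and of the right end respectively. -/
lemma contMDiffOn_fromStrip (hv : ContMDiffOn 𝓘(ℝ, ℝ × ℝ) 𝓘(ℝ, E) ∞ v strip)
    (hp : ∀ z : ℝ × ℝ, 0 < z.1 → K < |z.1| → v z = p)
    (hp' : ∀ z : ℝ × ℝ, z.1 < 0 → K < |z.1| → v z = p') :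
    ContMDiffOn 𝓘(ℝ, ℝ × ℝ) 𝓘(ℝ, E) ∞ (fromStrip v p p') rectangle := by
  rintro ⟨θ, t⟩ hz
  have hθ : θ ∈ Set.Icc 0 (2 * Real.pi) := hz.1
  have hpi := Real.pi_pos
  have hnear : ∀ {q : M}, Real.cos θ = 1 → fromStrip v p p' (θ, t) = q →
      (∀ᶠ φ in 𝓝 θ, φ ∈ Set.Icc 0 (2 * Real.pi) → ∀ t, fromStrip v p p' (φ, t) = q) →
      ContMDiffWithinAt 𝓘(ℝ, ℝ × ℝ) 𝓘(ℝ, E) ∞ (fromStrip v p p') rectangle (θ, t) := by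
    intro q _ hq hev
    have hc : ContMDiffWithinAt 𝓘(ℝ, ℝ × ℝ) 𝓘(ℝ, E) ∞ (fun _ => q) rectangle (θ, t) :=
      contMDiffWithinAt_const
    refine hc.congr_of_eventuallyEq ?_ hq
    have hev' := (continuous_fst (X := ℝ) (Y := ℝ)).continuousAt (x := (θ, t)) |>.eventually hev
    filter_upwards [self_mem_nhdsWithin, mem_nhdsWithin_of_mem_nhds hev'] with y hy hy'
    exact hy' hy.1 y.2
  rcases hθ.1.eq_or_lt with h0 | h0
  · subst h0
    refine hnear (q := p') Real.cos_zero (fromStrip_zero t) ?_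
    filter_upwards [eventually_large Real.cos_zero K, Iio_mem_nhds hpi] with φ hφ hφpi hφI s
    have hφpi' : φ < Real.pi := hφpi
    by_cases hc : Real.cos φ = 1
    · simp [fromStrip, hc, hφpi'.le]
    · rw [fromStrip_of_ne hc]
      refine hp' _ ?_ (hφ hc)
      have hφ0 : 0 < φ := lt_of_le_of_ne hφI.1 fun h => hc (by rw [← h, Real.cos_zero])
      exact div_neg_of_pos_of_neg (Real.sin_pos_of_pos_of_lt_pi hφ0 hφpi')
        (by linarith [lt_of_le_of_ne (Real.cos_le_one φ) hc])
  rcases hθ.2.eq_or_lt with h1 | h1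
  · subst h1
    refine hnear (q := p) Real.cos_two_pi (fromStrip_two_pi t) ?_
    filter_upwards [eventually_large Real.cos_two_pi K,
      Ioi_mem_nhds (show Real.pi < 2 * Real.pi by linarith)] with φ hφ hφpi hφI s
    have hφpi' : Real.pi < φ := hφpi
    by_cases hc : Real.cos φ = 1
    · simp [fromStrip, hc, not_le.2 hφpi']
    · rw [fromStrip_of_ne hc]
      refine hp _ ?_ (hφ hc)
      have hφ0 : φ < 2 * Real.pi :=
        lt_of_le_of_ne hφI.2 fun h => hc (by rw [h, Real.cos_two_pi])
      have hsin : Real.sin φ < 0 := by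
        rw [← Real.sin_sub_two_pi]
        exact Real.sin_neg_of_neg_of_neg_pi_lt (by linarith) (by linarith)
      exact div_pos_of_neg_of_neg hsin
        (by linarith [lt_of_le_of_ne (Real.cos_le_one φ) hc])
  · have hne : Real.cos θ ≠ 1 := (cos_lt_one ⟨h0, h1⟩).ne
    have hΦ : ContDiffAt ℝ ∞ (fun z : ℝ × ℝ => (lineCoord z.1, z.2)) (θ, t) := by
      have h2 : ContDiffAt ℝ ∞ lineCoord θ :=
        Real.contDiff_sin.contDiffAt.div (Real.contDiff_cos.contDiffAt.sub contDiffAt_const)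
          (sub_ne_zero.2 hne)
      exact (ContDiffAt.comp (f := Prod.fst) (g := lineCoord) (θ, t) h2 contDiffAt_fst).prodMk
        contDiffAt_snd
    have hs : ContMDiffWithinAt 𝓘(ℝ, ℝ × ℝ) 𝓘(ℝ, E) ∞
        (v ∘ fun z : ℝ × ℝ => (lineCoord z.1, z.2)) rectangle (θ, t) :=
      (hv (lineCoord θ, t) hz.2).comp (θ, t) hΦ.contMDiffAt.contMDiffWithinAt fun y hy => hy.2
    refine hs.congr_of_eventuallyEq ?_ (fromStrip_of_ne hne)
    have hev : ∀ᶠ y : ℝ × ℝ in 𝓝 (θ, t), Real.cos y.1 ≠ 1 :=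
      (Real.continuous_cos.comp continuous_fst).continuousAt.eventually_ne hne
    filter_upwards [mem_nhdsWithin_of_mem_nhds hev] with y hy
    exact fromStrip_of_ne hy

lemma area_fromStrip (σ : SymplecticForm E M)
    (hv : ContMDiffOn 𝓘(ℝ, ℝ × ℝ) 𝓘(ℝ, E) ∞ v strip) :
    area σ rectangle (fromStrip v p p') = ∫ z in openStrip, dens σ v z := by
  rw [(area_eq_of_convex σ convex_rectangle interior_rectangle).1]
  refine (integral_dens_prodMap σ (f' := fun θ => 1 / (1 - Real.cos θ)) (g' := fun _ => 1)
    isOpen_Ioo isOpen_Ioo (fun θ hθ => hasDerivAt_lineCoord (cos_lt_one hθ).ne)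
    (fun t _ => hasDerivAt_id t) injOn_lineCoord (Set.injOn_id _) image_lineCoord
    (Set.image_id _) (fun θ hθ t _ => ?_) (fun z hz => mdifferentiableAt_of_openStrip hv hz)
    fun z hz => fromStrip_of_ne (cos_lt_one hz.1).ne).1
  have := cos_lt_one hθ
  rw [mul_one]
  exact div_nonneg zero_le_one (by linarith)

open Classical in
/-- The map on the annulus which corresponds to the map `v` on the strip. -/
def fromStripCircle (v : ℝ × ℝ → M) (p : M) (z : Circle × ℝ) : M :=
  if (z.1 : ℂ).re = 1 then p else v ((z.1 : ℂ).im / ((z.1 : ℂ).re - 1), z.2)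

/-- `lineCoord θ` depends only on the real and imaginary parts of `e^{iθ}`, and with equal limits
the distinction between the two vertical edges disappears. -/
lemma fromStrip_eq_fromStripCircle (z : ℝ × ℝ) :
    fromStrip v p p z = fromStripCircle v p (Circle.exp z.1, z.2) := by
  simp only [fromStrip, fromStripCircle, lineCoord, Circle.coe_exp, Complex.exp_ofReal_mul_I_re,
    Complex.exp_ofReal_mul_I_im, ite_self]

lemma contMDiffOn_fromStripCircle (hv : ContMDiffOn 𝓘(ℝ, ℝ × ℝ) 𝓘(ℝ, E) ∞ v strip)
    (hp : ∀ z : ℝ × ℝ, K < |z.1| → v z = p) :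
    ContMDiffOn ((𝓡 1).prod 𝓘(ℝ, ℝ)) 𝓘(ℝ, E) ∞ (fromStripCircle v p)
      (Set.univ ×ˢ Set.Icc (-(1 / 2)) (1 / 2)) := by
  have := finrank_real_complex_fact'
  have hcoe : ContMDiff (𝓡 1) 𝓘(ℝ, ℂ) ∞ (fun z : Circle => (z : ℂ)) := contMDiff_coe_sphere
  have hre : ContMDiff ((𝓡 1).prod 𝓘(ℝ, ℝ)) 𝓘(ℝ, ℝ) ∞ fun z : Circle × ℝ => (z.1 : ℂ).re :=
    Complex.reCLM.contDiff.contMDiff.comp (hcoe.comp contMDiff_fst)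
  have him : ContMDiff ((𝓡 1).prod 𝓘(ℝ, ℝ)) 𝓘(ℝ, ℝ) ∞ fun z : Circle × ℝ => (z.1 : ℂ).im :=
    Complex.imCLM.contDiff.contMDiff.comp (hcoe.comp contMDiff_fst)
  intro z hz
  by_cases h : (z.1 : ℂ).re = 1
  · have hc : ContMDiffWithinAt ((𝓡 1).prod 𝓘(ℝ, ℝ)) 𝓘(ℝ, E) ∞ (fun _ => p)
        (Set.univ ×ˢ Set.Icc (-(1 / 2)) (1 / 2)) z := contMDiffWithinAt_const
    refine hc.congr_of_eventuallyEq ?_ (if_pos h)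
    have hcont : Continuous fun y : Circle × ℝ =>
        1 + (y.1 : ℂ).re - K ^ 2 * (1 - (y.1 : ℂ).re) :=
      (continuous_const.add hre.continuous).sub
        (continuous_const.mul (continuous_const.sub hre.continuous))
    filter_upwards [mem_nhdsWithin_of_mem_nhds (hcont.continuousAt.eventually_const_lt
      (show 0 < 1 + (z.1 : ℂ).re - K ^ 2 * (1 - (z.1 : ℂ).re) by rw [h]; norm_num))] with y hy
    unfold fromStripCircle
    split_ifs with h1
    · rfl
    · refine hp _ (lt_abs_div ?_ h1 (by linarith))
      have := Circle.normSq_coe y.1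
      rw [Complex.normSq_apply] at this
      linarith
  · have hΦ : ContMDiffAt ((𝓡 1).prod 𝓘(ℝ, ℝ)) 𝓘(ℝ, ℝ × ℝ) ∞
        (fun y : Circle × ℝ => ((y.1 : ℂ).im / ((y.1 : ℂ).re - 1), y.2)) z := by
      have hdiv : ContDiffAt ℝ ∞ (fun q : ℝ × ℝ => q.2 / (q.1 - 1))
          ((z.1 : ℂ).re, (z.1 : ℂ).im) :=
        contDiffAt_snd.div (contDiffAt_fst.sub contDiffAt_const) (sub_ne_zero.2 h)
      have h1 := hdiv.contMDiffAt.comp z (hre.contMDiffAt.prodMk_space him.contMDiffAt)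
      exact h1.prodMk_space contMDiff_snd.contMDiffAt
    have hs := (hv ((z.1 : ℂ).im / ((z.1 : ℂ).re - 1), z.2) hz.2).comp z
      (hΦ.contMDiffWithinAt (s := Set.univ ×ˢ Set.Icc (-(1 / 2)) (1 / 2))) fun y hy => hy.2
    refine hs.congr_of_eventuallyEq ?_ (if_neg h)
    filter_upwards [mem_nhdsWithin_of_mem_nhds
      (hre.continuous.continuousAt.eventually_ne h)] with y hy
    exact if_neg hy

end Rectangle

section

/-! ### Disks from capped half planes -/

section HalfPlane

variable {E : Type*} [NormedAddCommGroup E] [NormedSpace ℝ E]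
variable {M : Type*} [TopologicalSpace M] [ChartedSpace E M]
variable {σ : SymplecticForm E M} {k : ℕ∞} {w V : ℝ × ℝ → M} {p : M} {ε K : ℝ}

lemma polar_zero_right (r : ℝ) : polar (r, 0) = (r, 0) := by simp [polar]

lemma polar_one_right (r : ℝ) : polar (r, 1) = (-r, 0) := by simp [polar]

lemma fromPolar_pos (hV : IsCapped σ (w ∘ polar) V p ε K) {r : ℝ} (hr : 0 < r) :
    fromPolar w V (r, 0) = V (r, 0) := by
  rw [← fromPolar_polar hV (z := (r, 0)) ⟨hr, by simp⟩, polar_zero_right]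

lemma fromPolar_neg (hV : IsCapped σ (w ∘ polar) V p ε K) {r : ℝ} (hr : 0 < r) :
    fromPolar w V (-r, 0) = V (r, 1) := by
  rw [← fromPolar_polar hV (z := (r, 1)) ⟨hr, by simp⟩, polar_one_right]

lemma fromPolar_eq_const_of_lt (hV : IsCapped σ (w ∘ polar) V p ε K) {z : ℝ × ℝ}
    (hz : z ∈ upperHalf 0) (hK : K ^ 2 < z.1 ^ 2 + z.2 ^ 2) : fromPolar w V z = p := by
  refine fromPolar_eq_const hV hz ?_ ?_
  · rintro rfl
    simp only [Prod.fst_zero, Prod.snd_zero] at hK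
    nlinarith [sq_nonneg K]
  · have h : (polarInv z).1 ^ 2 = z.1 ^ 2 + z.2 ^ 2 := by
      simp only [polarInv]
      rw [Complex.sq_norm, Complex.normSq_apply]
      ring
    exact (le_abs_self K).trans (abs_lt_of_sq_lt_sq (h ▸ hK) (norm_nonneg _)).le

/-- The map on the disk obtained from a capped end of a half plane. -/
lemma IsHalfPlaneCurve.smooth_and_area_fromCayley {J : CompatibleJ σ k}
    (hw : IsHalfPlaneCurve J w) (hV : IsCapped σ (w ∘ polar) V p ε K) :
    SmoothOn (E := E) disk (fromCayley (fromPolar w V) p) ∧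
      |area σ disk (fromCayley (fromPolar w V) p) - ∫ z in openHalf, dens σ w z| ≤ ε := by
  have hs := contMDiffOn_fromPolar hw.smooth hV
  refine ⟨contMDiffOn_fromCayley (K := K ^ 2) hs fun z hz h => fromPolar_eq_const_of_lt hV hz h, ?_⟩
  rw [area_fromCayley σ hs, ← (integral_dens_polar σ hs fun z hz => (fromPolar_polar hV hz).symm).1,
    ← (integral_dens_polar σ (v := w ∘ polar) hw.smooth fun z _ => rfl).1]
  exact hV.area_le

lemma convex_lowerHalf (a : ℝ) : Convex ℝ (lowerHalf a) :=
  (convex_Iic a).linear_preimage (LinearMap.snd ℝ ℝ ℝ)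

lemma convex_upperHalf (a : ℝ) : Convex ℝ (upperHalf a) :=
  (convex_Ici a).linear_preimage (LinearMap.snd ℝ ℝ ℝ)

lemma interior_lowerHalf (a : ℝ) : interior (lowerHalf a) = Set.univ ×ˢ Set.Iio a := by
  have : lowerHalf a = Set.univ ×ˢ Set.Iic a := by
    ext z
    simp [lowerHalf]
  rw [this, interior_prod_eq, interior_univ, interior_Iic]

lemma interior_upperHalf (a : ℝ) : interior (upperHalf a) = Set.univ ×ˢ Set.Ioi a := by
  have : upperHalf a = Set.univ ×ˢ Set.Ici a := by
    ext z
    simp [upperHalf]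
  rw [this, interior_prod_eq, interior_univ, interior_Ici]

/-- A half turn, unlike a reflection, is holomorphic. It sends the boundary coordinate `s` to `-s`,
which explains the sign in the first seam condition of `weak_removal_of_singularity`. -/
lemma IsHolomorphicOn.isHalfPlaneCurve_lower {J : CompatibleJ σ k} {a : ℝ}
    (h : IsHolomorphicOn J (lowerHalf a) w) (hf : HasFiniteArea σ (lowerHalf a) w) :
    IsHalfPlaneCurve J (w ∘ affine (-1) a) ∧
      area σ (lowerHalf a) w = ∫ z in openHalf, dens σ (w ∘ affine (-1) a) z :=
  h.isHalfPlaneCurve hf (convex_lowerHalf a) (interior_lowerHalf a) (by norm_num)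
    (fun z => by simp [affine, openHalf])
    fun z hz => by
      have : 0 ≤ z.2 := hz
      show -1 * z.2 + a ≤ a
      linarith

lemma IsHolomorphicOn.isHalfPlaneCurve_upper {J : CompatibleJ σ k} {a : ℝ}
    (h : IsHolomorphicOn J (upperHalf a) w) (hf : HasFiniteArea σ (upperHalf a) w) :
    IsHalfPlaneCurve J (w ∘ affine 1 a) ∧
      area σ (upperHalf a) w = ∫ z in openHalf, dens σ (w ∘ affine 1 a) z :=
  h.isHalfPlaneCurve hf (convex_upperHalf a) (interior_upperHalf a) (by norm_num)
    (fun z => by simp [affine, openHalf])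
    fun z hz => by
      have : 0 ≤ z.2 := hz
      show a ≤ 1 * z.2 + a
      linarith

end HalfPlane

/-! ### Rectangles and annuli from capped strips -/

section Strip

variable {E : Type*} [NormedAddCommGroup E] [NormedSpace ℝ E]
variable {M : Type*} [TopologicalSpace M] [ChartedSpace E M]
variable {σ : SymplecticForm E M} {k : ℕ∞} {w V V' : ℝ × ℝ → M} {p p' : M} {ε K : ℝ}

lemma fromEnds_eq_const_of_pos (hV : IsCapped σ (w ∘ stripEnd 1) V p ε K) {z : ℝ × ℝ}
    (hz : 0 < z.1) (hK : K < |z.1|) : fromEnds w V V' z = p := by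
  rw [fromEnds_of_pos hV hz]
  exact hV.eq_right _ (abs_of_pos hz ▸ hK).le

lemma fromEnds_eq_const_of_neg (hV' : IsCapped σ (w ∘ stripEnd (-1)) V' p' ε K) {z : ℝ × ℝ}
    (hz : z.1 < 0) (hK : K < |z.1|) : fromEnds w V V' z = p' := by
  rw [fromEnds_of_neg hV' hz]
  exact hV'.eq_right _ (abs_of_neg hz ▸ hK).le

/-- The map on the rectangle obtained from the capped ends of a strip. -/
lemma IsStripCurve.smooth_and_area_fromStrip {J : CompatibleJ σ k} (hw : IsStripCurve J w)
    (hV : IsCapped σ (w ∘ stripEnd 1) V p ε K) (hV' : IsCapped σ (w ∘ stripEnd (-1)) V' p' ε K) :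
    SmoothOn (E := E) rectangle (fromStrip (fromEnds w V V') p p') ∧
      |area σ rectangle (fromStrip (fromEnds w V V') p p') - ∫ z in openStrip, dens σ w z|
        ≤ 2 * ε := by
  have hs := contMDiffOn_fromEnds hw.smooth hV hV'
  refine ⟨contMDiffOn_fromStrip (K := K) hs (fun z => fromEnds_eq_const_of_pos hV)
    fun z => fromEnds_eq_const_of_neg hV', ?_⟩
  rw [area_fromStrip σ hs, integral_dens_fromEnds hw.smooth hV hV',
    integral_dens_openStrip σ (v₁ := w ∘ stripEnd 1) (v₂ := w ∘ stripEnd (-1)) hw.smooth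
      (fun z _ => rfl) (fun z _ => rfl) (hw.isEnd (by norm_num)).integrable
      (hw.isEnd (by norm_num)).integrable]
  have h1 := abs_le.1 hV.area_le
  have h2 := abs_le.1 hV'.area_le
  rw [abs_le]
  constructor <;> linarith [h1.1, h1.2, h2.1, h2.2]

lemma contMDiffOn_fromStripCircle_fromEnds {J : CompatibleJ σ k} (hw : IsStripCurve J w)
    (hV : IsCapped σ (w ∘ stripEnd 1) V p ε K) (hV' : IsCapped σ (w ∘ stripEnd (-1)) V' p ε K) :
    ContMDiffOn ((𝓡 1).prod 𝓘(ℝ, ℝ)) 𝓘(ℝ, E) ∞ (fromStripCircle (fromEnds w V V') p)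
      (Set.univ ×ˢ Set.Icc (-(1 / 2)) (1 / 2)) := by
  refine contMDiffOn_fromStripCircle (K := max K 0) (contMDiffOn_fromEnds hw.smooth hV hV')
    fun z hz => ?_
  obtain ⟨h1, h2⟩ := max_lt_iff.1 hz
  rcases lt_or_gt_of_ne (abs_pos.1 h2) with h | h
  · exact fromEnds_eq_const_of_neg hV' h h1
  · exact fromEnds_eq_const_of_pos hV h h1

/-- By the Cauchy-Riemann equation the density equals the squared length of `∂_t w`, so the
inequality is an equality. -/
lemma IsHolomorphicOn.isStripCurve {J : CompatibleJ σ k} (h : IsHolomorphicOn J strip w)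
    (hf : HasFiniteArea σ strip w) : IsStripCurve J w := by
  refine ⟨h.smooth, fun z hz => ?_, (area_eq_of_convex σ convex_strip interior_strip).2.1 hf⟩
  have hn : strip ∈ 𝓝 z := mem_interior_iff_mem_nhds.1 (interior_strip ▸ hz)
  have hcr : der (E := E) w z (1, 0) + J.op (w z) (der (E := E) w z (0, 1)) = 0 := by
    rw [der_eq_of_mem_nhds hn]
    exact h.cauchyRiemann z (mem_of_mem_nhds hn)
  rw [dens, eq_neg_of_add_eq_zero_left hcr, map_neg, neg_apply, σ.bilin_swap, neg_neg]
  exact le_rfl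

/-- A path, extended to the strip by constants, has density zero. -/
lemma isStripCurve_comp_fst (J : CompatibleJ σ k) {c : ℝ → M}
    (hc : ContMDiff 𝓘(ℝ, ℝ) 𝓘(ℝ, E) ∞ c) : IsStripCurve J fun z : ℝ × ℝ => c z.1 := by
  have hd : ∀ z : ℝ × ℝ, der (E := E) (fun z : ℝ × ℝ => c z.1) z (0, 1) = 0 := by
    intro z
    have := der_comp (E := E) (w := c) (Φ := Prod.fst) (z := z)
      (hc.mdifferentiableAt (by simp)) hasFDerivAt_fst
    change der (E := E) (c ∘ Prod.fst) z (0, 1) = 0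
    rw [this]
    simp
  have h0 : dens σ (fun z : ℝ × ℝ => c z.1) = fun _ => 0 := by
    ext z
    rw [dens, hd, map_zero]
  refine ⟨(hc.comp contDiff_fst.contMDiff).contMDiffOn, fun z _ => ?_, ?_⟩
  · rw [hd, h0, CompatibleJ.normSq, map_zero]
    exact le_rfl
  · rw [h0]
    exact integrableOn_zero

end Strip

/-! ### Assembling the compact quilt -/

variable {E₀ : Type*} [NormedAddCommGroup E₀] [NormedSpace ℝ E₀] [FiniteDimensional ℝ E₀]
  {E₁ : Type*} [NormedAddCommGroup E₁] [NormedSpace ℝ E₁] [FiniteDimensional ℝ E₁]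
  {E₂ : Type*} [NormedAddCommGroup E₂] [NormedSpace ℝ E₂] [FiniteDimensional ℝ E₂]
  {M₀ : Type*} [TopologicalSpace M₀] [T2Space M₀] [ChartedSpace E₀ M₀]
  [IsManifold 𝓘(ℝ, E₀) ∞ M₀]
  {M₁ : Type*} [TopologicalSpace M₁] [T2Space M₁] [ChartedSpace E₁ M₁]
  [IsManifold 𝓘(ℝ, E₁) ∞ M₁]
  {M₂ : Type*} [TopologicalSpace M₂] [T2Space M₂] [ChartedSpace E₂ M₂]
  [IsManifold 𝓘(ℝ, E₂) ∞ M₂]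
  {σ₀ : SymplecticForm E₀ M₀} {σ₁ : SymplecticForm E₁ M₁} {σ₂ : SymplecticForm E₂ M₂}
  {k : ℕ∞} {J₀ : CompatibleJ σ₀ k} {J₁ : CompatibleJ σ₁ k} {J₂ : CompatibleJ σ₂ k}
  {L₀₁ : Set (M₀ × M₁)} {L₁₂ : Set (M₁ × M₂)}

/-- Weak removal of singularity for a quilt that consists of two half planes and a strip. -/
theorem weak_removal_of_singularity
    (h₀₁ : IsCompactLagrangianCorrespondence σ₀ σ₁ L₀₁)
    (h₁₂ : IsCompactLagrangianCorrespondence σ₁ σ₂ L₁₂)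
    {w₀ : ℝ × ℝ → M₀} {w₁ : ℝ × ℝ → M₁} {w₂ : ℝ × ℝ → M₂}
    (h₀ : IsHalfPlaneCurve J₀ w₀) (h₁ : IsStripCurve J₁ w₁) (h₂ : IsHalfPlaneCurve J₂ w₂)
    (s₀₁ : ∀ s : ℝ, (w₀ (-s, 0), w₁ (s, -(1 / 2))) ∈ L₀₁)
    (s₁₂ : ∀ s : ℝ, (w₁ (s, 1 / 2), w₂ (s, 0)) ∈ L₁₂) {ε : ℝ} (hε : 0 < ε) :
    ∃ (u₀ : ℝ × ℝ → M₀) (u₁ : ℝ × ℝ → M₁) (u₂ : ℝ × ℝ → M₂),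
      SmoothOn (E := E₀) disk u₀ ∧ SmoothOn (E := E₁) rectangle u₁ ∧
      SmoothOn (E := E₂) disk u₂ ∧
      (∀ θ ∈ Set.Icc 0 (2 * Real.pi),
        (u₀ (Real.cos θ, -Real.sin θ), u₁ (θ, -(1 / 2))) ∈ L₀₁ ∧
        (u₁ (θ, 1 / 2), u₂ (Real.cos θ, Real.sin θ)) ∈ L₁₂) ∧
      |(area σ₀ disk u₀ + area σ₁ rectangle u₁ + area σ₂ disk u₂) -
        ((∫ z in openHalf, dens σ₀ w₀ z) + (∫ z in openStrip, dens σ₁ w₁ z) +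
          ∫ z in openHalf, dens σ₂ w₂ z)| ≤ ε ∧
      (u₀ (1, 0), u₂ (1, 0)) ∈ geomComposition L₀₁ L₁₂ ∧
      (∃ pplus pminus : M₁,
        (∀ t ∈ Set.Icc (-(1 / 2) : ℝ) (1 / 2), u₁ (0, t) = pplus) ∧
        (∀ t ∈ Set.Icc (-(1 / 2) : ℝ) (1 / 2), u₁ (2 * Real.pi, t) = pminus) ∧
        (u₀ (1, 0), pplus, pplus, u₂ (1, 0)) ∈ fiberProduct L₀₁ L₁₂ ∧
        (u₀ (1, 0), pminus, pminus, u₂ (1, 0)) ∈ fiberProduct L₀₁ L₁₂) ∧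
      (Set.InjOn proj02 (fiberProduct L₀₁ L₁₂) →
        ∃ v : Circle × ℝ → M₁,
          ContMDiffOn ((𝓡 1).prod 𝓘(ℝ, ℝ)) 𝓘(ℝ, E₁) ∞ v
            (Set.univ ×ˢ Set.Icc (-(1 / 2)) (1 / 2)) ∧
          ∀ z ∈ rectangle, u₁ z = v (Circle.exp z.1, z.2)) := by
  -- Each of the four ends may change the area by `ε / 4`. Since `w₀` has been turned around, its
  -- ray at angle `π` meets the right end of the strip.
  obtain ⟨V₀, V₁, V₁', V₂, p₀, p₁, p₁', p₂, K, c₀, c₁, c₁', c₂, t₀₁, t₁₂, t₁₂', t₀₁', m₀₁, m₁₂,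
      m₁₂', m₀₁'⟩ :=
    exists_capped_quilt h₀₁ h₁₂ h₀.isEnd (h₁.isEnd (e := 1) (by norm_num))
      (h₁.isEnd (e := -1) (by norm_num)) h₂.isEnd
      (fun r _ => by simpa [polar_one_right, stripEnd_one] using s₀₁ r)
      (fun r _ => by
        have := s₁₂ r
        simp only [Function.comp_apply, polar_zero_right, stripEnd_one]
        norm_num at this ⊢
        exact this)
      (fun r _ => by simpa [polar_one_right, stripEnd_neg_one] using s₁₂ (-r))
      (fun r _ => by
        have := s₀₁ (-r)
        simp only [Function.comp_apply, polar_zero_right, stripEnd_neg_one]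
        norm_num at this ⊢
        exact this) (show 0 < ε / 4 by linarith)
  obtain ⟨S₀, A₀⟩ := h₀.smooth_and_area_fromCayley c₀
  obtain ⟨S₁, A₁⟩ := h₁.smooth_and_area_fromStrip c₁ c₁'
  obtain ⟨S₂, A₂⟩ := h₂.smooth_and_area_fromCayley c₂
  -- The sign of `s` decides which strip end supplies the condition; at `s = 0` all maps are still
  -- the original ones.
  have seam : ∀ s : ℝ,
      (fromPolar w₀ V₀ (-s, 0), fromEnds w₁ V₁ V₁' (s, -(1 / 2))) ∈ L₀₁ ∧
      (fromEnds w₁ V₁ V₁' (s, 1 / 2), fromPolar w₂ V₂ (s, 0)) ∈ L₁₂ := by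
    intro s
    rcases lt_trichotomy s 0 with h | rfl | h
    · have hs : 0 < -s := by linarith
      have e₂ := fromPolar_neg c₂ hs
      rw [neg_neg] at e₂
      rw [fromEnds_of_neg c₁' h, fromEnds_of_neg c₁' h, fromPolar_pos c₀ hs, e₂]
      have a := t₀₁' _ hs
      have b := t₁₂' _ hs
      norm_num at a b ⊢
      exact ⟨a, b⟩
    · have e : ∀ t, fromEnds w₁ V₁ V₁' (0, t) = w₁ (0, t) := fun t => by simp [fromEnds]
      have z₀ : fromPolar w₀ V₀ (-0, 0) = w₀ (-0, 0) := by
        rw [neg_zero]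
        exact fromPolar_zero
      have z₂ : fromPolar w₂ V₂ (0, 0) = w₂ (0, 0) := fromPolar_zero
      rw [e, e, z₀, z₂]
      exact ⟨s₀₁ 0, s₁₂ 0⟩
    · rw [fromEnds_of_pos c₁ h, fromEnds_of_pos c₁ h, fromPolar_neg c₀ h, fromPolar_pos c₂ h]
      have a := t₀₁ _ h
      have b := t₁₂ _ h
      norm_num at a b ⊢
      exact ⟨a, b⟩
  refine ⟨fromCayley (fromPolar w₀ V₀) p₀, fromStrip (fromEnds w₁ V₁ V₁') p₁ p₁',
    fromCayley (fromPolar w₂ V₂) p₂, S₀, S₁, S₂, fun θ hθ => ?_, ?_, ?_, ?_, fun hinj => ?_⟩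
  · rcases hθ.1.eq_or_lt with rfl | h0
    · simp only [Real.cos_zero, Real.sin_zero, neg_zero, fromCayley_one, fromStrip_zero]
      exact ⟨m₀₁', m₁₂'⟩
    rcases hθ.2.eq_or_lt with rfl | h1
    · simp only [Real.cos_two_pi, Real.sin_two_pi, neg_zero, fromCayley_one, fromStrip_two_pi]
      exact ⟨m₀₁, m₁₂⟩
    have hne : Real.cos θ ≠ 1 := (cos_lt_one ⟨h0, h1⟩).ne
    have hne' : ∀ y : ℝ, (Real.cos θ, y) ≠ ((1, 0) : ℝ × ℝ) := fun y h => hne (Prod.ext_iff.1 h).1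
    rw [fromCayley_of_ne (hne' _), fromCayley_of_ne (hne' _), fromStrip_of_ne hne,
      fromStrip_of_ne hne, cayley_cos_sin (Real.cos_sq_add_sin_sq θ),
      cayley_cos_sin ((congrArg _ (neg_sq _)).trans (Real.cos_sq_add_sin_sq θ)), neg_div]
    exact seam (lineCoord θ)
  · rw [abs_le] at *
    constructor <;> linarith [A₀.1, A₀.2, A₁.1, A₁.2, A₂.1, A₂.2]
  · rw [fromCayley_one, fromCayley_one]
    exact ⟨(p₀, p₁, p₁, p₂), ⟨m₀₁, m₁₂, rfl⟩, rfl⟩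
  · rw [fromCayley_one, fromCayley_one]
    -- The edge `θ = 0` corresponds to `s = -∞`, so the value there is the limit of the left end.
    exact ⟨p₁', p₁, fun t _ => fromStrip_zero t, fun t _ => fromStrip_two_pi t,
      ⟨m₀₁', m₁₂', rfl⟩, ⟨m₀₁, m₁₂, rfl⟩⟩
  -- Both limits give points of the fiber product over `(p₀, p₂)`.
  · have hp : p₁ = p₁' := by
      have : (p₀, p₁, p₁, p₂) = (p₀, p₁', p₁', p₂) :=
        hinj ⟨m₀₁, m₁₂, rfl⟩ ⟨m₀₁', m₁₂', rfl⟩ rfl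
      exact congrArg (fun x => x.2.1) this
    subst hp
    exact ⟨_, contMDiffOn_fromStripCircle_fromEnds h₁ c₁ c₁',
      fun z _ => fromStrip_eq_fromStripCircle z⟩

end

end QuiltBubble

end

/-! ### Figure eight and squashed eight bubbles -/

theorem proposition2p8
    {E₀ : Type*} [NormedAddCommGroup E₀] [NormedSpace ℝ E₀] [FiniteDimensional ℝ E₀]
    {E₁ : Type*} [NormedAddCommGroup E₁] [NormedSpace ℝ E₁] [FiniteDimensional ℝ E₁]
    {E₂ : Type*} [NormedAddCommGroup E₂] [NormedSpace ℝ E₂] [FiniteDimensional ℝ E₂]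
    {M₀ : Type*} [TopologicalSpace M₀] [T2Space M₀] [SecondCountableTopology M₀]
    [ChartedSpace E₀ M₀] [IsManifold 𝓘(ℝ, E₀) ∞ M₀]
    {M₁ : Type*} [TopologicalSpace M₁] [T2Space M₁] [SecondCountableTopology M₁]
    [ChartedSpace E₁ M₁] [IsManifold 𝓘(ℝ, E₁) ∞ M₁]
    {M₂ : Type*} [TopologicalSpace M₂] [T2Space M₂] [SecondCountableTopology M₂]
    [ChartedSpace E₂ M₂] [IsManifold 𝓘(ℝ, E₂) ∞ M₂]
    (σ₀ : SymplecticForm E₀ M₀) (σ₁ : SymplecticForm E₁ M₁) (σ₂ : SymplecticForm E₂ M₂)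
    (k : ℕ∞) (hk : 1 ≤ k)
    (J₀ : CompatibleJ σ₀ k) (J₁ : CompatibleJ σ₁ k) (J₂ : CompatibleJ σ₂ k)
    (L₀₁ : Set (M₀ × M₁)) (L₁₂ : Set (M₁ × M₂))
    (h₀₁ : IsCompactLagrangianCorrespondence σ₀ σ₁ L₀₁)
    (h₁₂ : IsCompactLagrangianCorrespondence σ₁ σ₂ L₁₂)
    -- `A` is the energy of a figure eight bubble or of a squashed eight bubble
    (A : ℝ)
    (hA :
      (∃ (w₀ : ℝ × ℝ → M₀) (w₁ : ℝ × ℝ → M₁) (w₂ : ℝ × ℝ → M₂),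
        IsFigureEight J₀ J₁ J₂ L₀₁ L₁₂ w₀ w₁ w₂ ∧
        A = area σ₀ (lowerHalf (-(1 / 2))) w₀ + area σ₁ strip w₁
          + area σ₂ (upperHalf (1 / 2)) w₂) ∨
      (∃ (w₀ : ℝ × ℝ → M₀) (w₁ : ℝ → M₁) (w₂ : ℝ × ℝ → M₂),
        IsSquashedEight (E₁ := E₁) J₀ J₂ L₀₁ L₁₂ w₀ w₁ w₂ ∧
        A = area σ₀ (lowerHalf 0) w₀ + area σ₁ strip (fun z => w₁ z.1)
          + area σ₂ (upperHalf 0) w₂))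
    (ε : ℝ) (hε : 0 < ε) :
    ∃ (u₀ : ℝ × ℝ → M₀) (u₁ : ℝ × ℝ → M₁) (u₂ : ℝ × ℝ → M₂),
      SmoothOn (E := E₀) disk u₀ ∧ SmoothOn (E := E₁) rectangle u₁ ∧
      SmoothOn (E := E₂) disk u₂ ∧
      -- seam conditions, at `e^{-iθ}` and `e^{iθ}`
      (∀ θ ∈ Set.Icc 0 (2 * Real.pi),
        (u₀ (Real.cos θ, -Real.sin θ), u₁ (θ, -(1 / 2))) ∈ L₀₁ ∧
        (u₁ (θ, 1 / 2), u₂ (Real.cos θ, Real.sin θ)) ∈ L₁₂) ∧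
      -- the total symplectic area is `ε`-close to the energy of the bubble
      |(area σ₀ disk u₀ + area σ₁ rectangle u₁ + area σ₂ disk u₂) - A| ≤ ε ∧
      -- constancy on the end segments, and the two lifts of the point `(u₀ 1, u₂ 1)`
      (u₀ (1, 0), u₂ (1, 0)) ∈ geomComposition L₀₁ L₁₂ ∧
      (∃ pplus pminus : M₁,
        (∀ t ∈ Set.Icc (-(1 / 2) : ℝ) (1 / 2), u₁ (0, t) = pplus) ∧
        (∀ t ∈ Set.Icc (-(1 / 2) : ℝ) (1 / 2), u₁ (2 * Real.pi, t) = pminus) ∧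
        (u₀ (1, 0), pplus, pplus, u₂ (1, 0)) ∈ fiberProduct L₀₁ L₁₂ ∧
        (u₀ (1, 0), pminus, pminus, u₂ (1, 0)) ∈ fiberProduct L₀₁ L₁₂) ∧
      -- if `π₀₂` is injective on the fiber product, `u₁` descends to the annulus
      (Set.InjOn proj02 (fiberProduct L₀₁ L₁₂) →
        ∃ v : Circle × ℝ → M₁,
          ContMDiffOn ((𝓡 1).prod 𝓘(ℝ, ℝ)) 𝓘(ℝ, E₁) ∞ v
            (Set.univ ×ˢ Set.Icc (-(1 / 2)) (1 / 2)) ∧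
          ∀ z ∈ rectangle, u₁ z = v (Circle.exp z.1, z.2)) := by
  obtain ⟨w₀, w₁, w₂, h, rfl⟩ | ⟨w₀, w₁, w₂, h, rfl⟩ := hA
  · obtain ⟨c₀, a₀⟩ := h.holo₀.isHalfPlaneCurve_lower h.finite₀
    obtain ⟨c₂, a₂⟩ := h.holo₂.isHalfPlaneCurve_upper h.finite₂
    rw [a₀, a₂, (area_eq_of_convex σ₁ convex_strip interior_strip).1]
    refine weak_removal_of_singularity h₀₁ h₁₂ c₀ (h.holo₁.isStripCurve h.finite₁) c₂
      (fun s => ?_) (fun s => ?_) hε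
    · simpa [affine] using h.seam₀₁ s
    · simpa [affine] using h.seam₁₂ s
  -- For a squashed eight bubble the seam path, extended to the strip by constants, has zero density
  -- and zero vertical speed, so it qualifies as a strip curve.
  · obtain ⟨c₀, a₀⟩ := h.holo₀.isHalfPlaneCurve_lower h.finite₀
    obtain ⟨c₂, a₂⟩ := h.holo₂.isHalfPlaneCurve_upper h.finite₂
    rw [a₀, a₂, (area_eq_of_convex σ₁ convex_strip interior_strip).1]
    refine weak_removal_of_singularity h₀₁ h₁₂ c₀ (isStripCurve_comp_fst J₁ h.smooth₁) c₂
      (fun s => ?_) (fun s => ?_) hε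
    · simpa [affine] using (h.seam s).1
    · simpa [affine] using (h.seam s).2.1
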